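/- **Setting.** Let $d\ge 1$, $\beta,L>0$, and let $\ell$ be the degree $\lfloor\beta\rfloor$ (for integer $\beta$ both usual conventions $\lfloor\beta\rfloor=\beta$ and $\lfloor\beta\rfloor=\beta-1$ are allowed, i.e. $\ell\in\mathbb N$ with $\ell\le\beta\le\ell+1$). Let $C_0>0$, $\alpha\ge 0$, $c_0,r_0>0$, $0<\mu_{\min}<\mu_{\max}<\infty$, let $S\subset\mathbb R^d$ be compact, let $c>0$ and $C_1,C_2,C_3>0$. Let $K:\mathbb R^d\to\mathbb R$ be a measurable kernel with $K(x)\ge c\,\mathbf 1_{\{\|x\|\le c\}}$ for all $x$, $\int K=1$, $\sup_u(1+\|u\|^{2\beta})K(u)<\infty$, $\int(1+\|u\|^{4\beta})K(u)^2\,du<\infty$ and $\int\|u\|^{\beta+\ell}K(u)\,du<\infty$. For $m\ge2$ let $\mathbf P$ be a probability distribution of $(X,Y)$ on $\mathbb R^d\times\{1,\dots,m\}$, with $X$-marginal $\mathbf P_X$ and (versions of the) conditional probabilities $\eta_j(x)=\mathbf P(Y=j\mid X=x)$, such that: * (Hölder) each $\eta_j:\mathbb R^d\to\mathbb R$ is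 $\ell$ times continuously differentiable and $|\eta_j(x')-\eta_{j,x}(x')|\le L\|x-x'\|^\beta$ for all $x,x'\in\mathbb R^d$, where $\eta_{j,x}$ is the Taylor polynomial of $\eta_j$ of degree $\ell$ at $x$; * (strong density) there is a compact set $A\subseteq S$ with $\lambda[A\cap B(x,r)]\ge c_0\lambda[B(x,r)]$ for all $x\in A$, $0<r\le r_0$ ($\lambda$ Lebesgue measure, $B(x,r)$ the Euclidean ball), and $\mathbf P_X$ has a Lebesgue density $\mu$ with $\mu_{\min}\le\mu\le\mu_{\max}$ on $A$ and $\mu=0$ off $A$; * (margin) $\mathbf P_X(\eta_{(1)}(X)-\eta_{(2)}(X)\le t)\le C_0t^\alpha$ for all $t>0$, where $\eta_{(1)}(x)\ge\eta_{(2)}(x)$ are the largest and second largest of $\eta_1(x),\dots,\eta_m(x)$, counted with multiplicity. Let $Z_i=(X_i,Y_i)$, $i\ge1$, be a sequence of random variables whose stationary distribution is $\mathbf P$, in the sense that every $Z_i$ has law $\mathbf P$, and which is exponentially strongly mixing: for all $k\ge1$, $$\sup\{|\Pr(A_1\cap A_2)-\Pr(A_1)\Pr(A_2)| : t\ge1,\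 A_1\in\sigma(Z_i,i\le t),\ A_2\in\sigma(Z_i,i\ge t+k)\}\le C_1\exp(-C_2k^{C_3}).$$ Let $n_e=\left\lfloor n/\lceil(8n/C_2)^{1/(C_3+1)}\rceil\right\rfloor$ be the effective sample size and $h=n_e^{-1/(2\beta+d)}$. For each class $j$ and each $x$, let $\widehat\eta^{\rm LP}_{n,j}(x)=\widehat\theta(0)$ if there is a unique polynomial $\widehat\theta$ of degree at most $\ell$ minimizing $\sum_{i=1}^n\big(\mathbf 1_{\{Y_i=j\}}-\theta(X_i-x)\big)^2K\big(\tfrac{X_i-x}{h}\big)$, and $\widehat\eta^{\rm LP}_{n,j}(x)=0$ otherwise. Let $\widehat\eta_{n,j}(x)$ be $\widehat\eta^{\rm LP}_{n,j}(x)$ clipped to $[0,1]$. The one-vs-all plug-in classifier is $\widehat f_n(x)\in\arg\max_j\widehat\eta_{n,j}(x)$ (any measurable tie-breaking), and $f^*(x)\in\arg\max_j\eta_j(x)$ is a Bayes classifier. The risk of a classifier $f$ is $R(f)=\mathbf P(Y\ne f(X))$. **Theorem 1.** There is a constant $C_8>0$, depending only on $d,\beta,\ell,L,C_0,\alpha,c_0,r_0,\mu_{\min},\mu_{\max},S,c,K,C_1,C_2,C_3$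 (in particular not on the number of classes $m$, nor on $\mathbf P$ or $n$), such that for all $n$ with $0<n_e^{-1/(2\beta+d)}\le r_0/c$ (where $n_e\ge1$), $$\mathbf E R(\widehat f_n)-R(f^*)\le C_8\,n_e^{-\beta(1+\alpha)/(2\beta+d)}.$$ -/

import Mathlib

open MeasureTheory

noncomputable section

namespace OvA

/-- The observation space `ℝ^d` with its Euclidean distance. -/
abbrev Obs (d : ℕ) : Type := EuclideanSpace ℝ (Fin d)

/-! ### Classifiers, risk, conditional class probabilities -/

/-- The risk `P (Y ≠ f X)` of a classifier, where `(X, Y)` has law `P`. -/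
def risk {d m : ℕ} (P : Measure (Obs d × Fin m)) (f : Obs d → Fin m) : ℝ :=
  P.real {z | z.2 ≠ f z.1}

/-- `g` is a version of the conditional probability `x ↦ P (Y = j | X = x)`. -/
def IsCondProb {d m : ℕ} (P : Measure (Obs d × Fin m)) (j : Fin m) (g : Obs d → ℝ) : Prop :=
  (fun z : Obs d × Fin m => g z.1) =ᵐ[P]
    condExp (MeasurableSpace.comap Prod.fst inferInstance) P
      (Set.indicator {z : Obs d × Fin m | z.2 = j} fun _ => (1 : ℝ))

/-- `f x` is one of the indices `j` that maximize `g j x`, for every `x` (ties are broken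
arbitrarily). -/
def IsArgmax {d m : ℕ} (g : Fin m → Obs d → ℝ) (f : Obs d → Fin m) : Prop :=
  ∀ x j, g j x ≤ g (f x) x

/-! ### The assumptions on the law of `(X, Y)` -/

/-- The Taylor polynomial of degree `ℓ` of `g` at `x`, evaluated at `x'`. -/
def taylorPoly {d : ℕ} (ℓ : ℕ) (g : Obs d → ℝ) (x x' : Obs d) : ℝ :=
  ∑ k ∈ Finset.range (ℓ + 1), (k.factorial : ℝ)⁻¹ * iteratedFDeriv ℝ k g x fun _ => x' - x

/-- The Hölder class with exponent `β`, constant `L` and Taylor polynomials of degree `ℓ`. -/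
def HolderClass {d : ℕ} (β : ℝ) (ℓ : ℕ) (L : ℝ) : Set (Obs d → ℝ) :=
  {g | ContDiff ℝ ℓ g ∧ ∀ x x', |g x' - taylorPoly ℓ g x x'| ≤ L * ‖x - x'‖ ^ β}

/-- `(c₀, r₀)`-regular sets. -/
def IsRegularSet {d : ℕ} (c₀ r₀ : ℝ) (A : Set (Obs d)) : Prop :=
  ∀ x ∈ A, ∀ r : ℝ, 0 < r → r ≤ r₀ →
    ENNReal.ofReal c₀ * volume (Metric.closedBall x r) ≤ volume (A ∩ Metric.closedBall x r)

/-- The strong density assumption on the law `Q` of an observation, relative to the set `S`. -/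
def StrongDensity {d : ℕ} (c₀ r₀ μmin μmax : ℝ) (S : Set (Obs d)) (Q : Measure (Obs d)) : Prop :=
  ∃ (A : Set (Obs d)) (μ : Obs d → ℝ), A ⊆ S ∧ IsCompact A ∧ IsRegularSet c₀ r₀ A ∧
    Measurable μ ∧ Q = volume.withDensity (fun x => ENNReal.ofReal (μ x)) ∧
    (∀ x ∈ A, μmin ≤ μ x ∧ μ x ≤ μmax) ∧ ∀ x ∉ A, μ x = 0

/-- The entries of `v` in decreasing order, with multiplicity: `decreasing v 0` is the largest
entry and `decreasing v 1` the second largest. -/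
def decreasing {m : ℕ} (v : Fin m → ℝ) (k : Fin m) : ℝ :=
  v (Tuple.sort v k.rev)

/-- The multiclass margin assumption with constants `C₀` and `α`, for the law `Q` of an
observation and the conditional class probabilities `η`. -/
def MarginAssumption {d m : ℕ} (hm : 2 ≤ m) (C₀ α : ℝ) (Q : Measure (Obs d))
    (η : Fin m → Obs d → ℝ) : Prop :=
  ∀ t : ℝ, 0 < t →
    Q.real {x | decreasing (fun j => η j x) ⟨0, by omega⟩ -
      decreasing (fun j => η j x) ⟨1, by omega⟩ ≤ t} ≤ C₀ * t ^ α

/-! ### The one-vs-all plug-in classifier -/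

/-- The assumptions on the kernel `K` of the local polynomial estimators. -/
structure IsKernel {d : ℕ} (β : ℝ) (ℓ : ℕ) (c : ℝ) (K : Obs d → ℝ) : Prop where
  measurable : Measurable K
  lower : ∀ x, Set.indicator {x : Obs d | ‖x‖ ≤ c} (fun _ => c) x ≤ K x
  integral_eq_one : ∫ u, K u = 1
  bounded : BddAbove (Set.range fun u => (1 + ‖u‖ ^ (2 * β)) * K u)
  square : Integrable fun u => (1 + ‖u‖ ^ (4 * β)) * K u ^ 2
  moment : Integrable fun u => ‖u‖ ^ (β + ℓ) * K u

/-- The weighted least squares criterion of the polynomial `θ` at the point `x`, for the real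
responses `y i` at the design points `X i`. -/
def lpCriterion {d n : ℕ} (K : Obs d → ℝ) (h : ℝ) (X : Fin n → Obs d) (y : Fin n → ℝ)
    (x : Obs d) (θ : MvPolynomial (Fin d) ℝ) : ℝ :=
  ∑ i, (y i - MvPolynomial.eval (fun k => (X i - x) k) θ) ^ 2 * K (h⁻¹ • (X i - x))

/-- `θ` minimizes the criterion over all polynomials of degree at most `ℓ`. -/
def IsLPFit {d n : ℕ} (ℓ : ℕ) (K : Obs d → ℝ) (h : ℝ) (X : Fin n → Obs d) (y : Fin n → ℝ)
    (x : Obs d) (θ : MvPolynomial (Fin d) ℝ) : Prop :=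
  θ.totalDegree ≤ ℓ ∧ ∀ θ' : MvPolynomial (Fin d) ℝ, θ'.totalDegree ≤ ℓ →
    lpCriterion K h X y x θ ≤ lpCriterion K h X y x θ'

open Classical in
/-- The local polynomial estimator of order `ℓ` at the point `x`: the value at the origin of the
minimizer if that is unique, and `0` otherwise. -/
def lpEstimator {d n : ℕ} (ℓ : ℕ) (K : Obs d → ℝ) (h : ℝ) (X : Fin n → Obs d) (y : Fin n → ℝ)
    (x : Obs d) : ℝ :=
  if H : ∃! θ : MvPolynomial (Fin d) ℝ, IsLPFit ℓ K h X y x θ then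
    MvPolynomial.eval (fun _ => 0) H.choose
  else 0

/-- The one-vs-all estimator of the conditional probability of class `j` from the sample `D`:
the local polynomial estimator for the binary responses `1_{Y_i = j}`, clipped to `[0, 1]`. -/
def classEstimator {d m n : ℕ} (ℓ : ℕ) (K : Obs d → ℝ) (h : ℝ) (D : Fin n → Obs d × Fin m)
    (j : Fin m) (x : Obs d) : ℝ :=
  max 0 (min 1 (lpEstimator ℓ K h (fun i => (D i).1) (fun i => if (D i).2 = j then 1 else 0) x))

/-- `f` maps a sample `D` to a one-vs-all plug-in classifier trained on `D`. -/
def IsPlugIn {d m n : ℕ} (ℓ : ℕ) (K : Obs d → ℝ) (h : ℝ)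
    (f : (Fin n → Obs d × Fin m) → Obs d → Fin m) : Prop :=
  ∀ D, IsArgmax (classEstimator ℓ K h D) (f D)

/-! ### Exponentially strongly mixing sequences -/

/-- The strong mixing coefficient of lag `k` of the sequence `Z 0, Z 1, …`. -/
def mixingCoeff {Ω E : Type*} [MeasurableSpace Ω] [MeasurableSpace E] (Pr : Measure Ω)
    (Z : ℕ → Ω → E) (k : ℕ) : ℝ :=
  sSup {r | ∃ (t : ℕ) (A₁ A₂ : Set Ω),
    MeasurableSet[⨆ i : Set.Iic t, MeasurableSpace.comap (Z i) inferInstance] A₁ ∧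
    MeasurableSet[⨆ i : Set.Ici (t + k), MeasurableSpace.comap (Z i) inferInstance] A₂ ∧
    r = |Pr.real (A₁ ∩ A₂) - Pr.real A₁ * Pr.real A₂|}

/-- Exponential strong mixing with constants `C₁`, `C₂`, `C₃`. -/
def ExpStronglyMixing {Ω E : Type*} [MeasurableSpace Ω] [MeasurableSpace E] (C₁ C₂ C₃ : ℝ)
    (Pr : Measure Ω) (Z : ℕ → Ω → E) : Prop :=
  ∀ k : ℕ, 1 ≤ k → mixingCoeff Pr Z k ≤ C₁ * Real.exp (-C₂ * (k : ℝ) ^ C₃)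

/-- The effective sample size `⌊n / ⌈(8 n / C₂) ^ (1 / (C₃ + 1))⌉⌋`. -/
def effSize (C₂ C₃ : ℝ) (n : ℕ) : ℕ :=
  ⌊(n : ℝ) / (⌈(8 * (n : ℝ) / C₂) ^ (1 / (C₃ + 1))⌉₊ : ℝ)⌋₊

/-- The bandwidth `h = n_e ^ (-1 / (2 β + d))`. -/
def bandwidth (d : ℕ) (β C₂ C₃ : ℝ) (n : ℕ) : ℝ :=
  (effSize C₂ C₃ n : ℝ) ^ (-1 / (2 * β + d))

end OvA

end

open OvA

/-!
The excess risk of a plug-in classifier at a point `x` is at most the sum of the errors of two of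
the estimated class probabilities, `η_{f* x}` and `η_{f x}`. The whole argument rests on the bound
`𝔼 (excess at x) ^ p ≤ C ε ^ p`, where `ε = h ^ β`, `p > 0` is even and `C` depends neither
on the point `x` of the support nor on the number of classes (`exists_excess_moment_const`). Given
this, the margin assumption and a dyadic splitting of the values of the excess, with `p ≥ α + 2`,
bound the excess risk by a multiple of `ε ^ (1 + α)` (`lintegral_le_of_margin`), which is the
asserted rate.

The pointwise error (`excess_le`). The Hölder condition makes the Taylor polynomial of `η_j` at `x`
an approximate fit to the data. As soon as the empirical Gram matrix of the rescaled monomials is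
bounded below, the normal equations bound the error of the local polynomial estimator by the
weighted residuals of that Taylor polynomial (`abs_lpEstimator_sub_le`): a noise term of mean zero,
and a bias term of size `L h ^ β` times an empirical mean that is the same for all classes. The
expected Gram matrix is bounded below because a regular set fills a fixed proportion of the ball of
radius `c h` about each of its points, whereas a polynomial with normalized coefficients is small
only on a small part of the ball (`exists_gram_lower_bound`). If the empirical Gram matrix is far
from its expectation, the excess, being at most one, is bounded by a multiple of that distance. So
there remain deviations of three kinds of empirical means from their expectations.

Deviations for mixing data (`sum_integral_localized_mean_pow_le`). With the block length `a` of the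
effective sample size, the `n` sampling times are split into residue classes mod `a`, and Jensen's
inequality for the exponential reduces the means to sums over one residue class, with terms `a`
apart. The exponential moment of such a sum is bounded by adding one term at a time; each step costs
a factor `1 + variance` and a covariance, which is small by mixing (`sum_integral_exp_sub_one_le`).
The choice of `a` makes the mixing coefficient at most `C₁ exp (-8 n_e)`, which absorbs the
exponential of the sum.

Independence of the number `m` of classes. The class `f x` is random, so its noise is bounded by the
sum over all classes, and `∑_j 𝔼 |noise_j| ^ p` has to be controlled without a factor `m`. The
reason why this is possible is that the noise variables satisfy `∑_j |ξ_j| ≤ M` pointwise, since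
`∑_j (1_{Y = j} + η_j) = 2`; hence also `∑_j Var ξ_j` is bounded, by a multiple of `h ^ d`. Both
`∑_j (exp y_j - 1)` and `∑_j (cosh y_j - 1)`, which dominates even powers, are controlled by `ℓ¹`
bounds. The covariances `∑_j cov (F_j, G_j)` are handled together: there are signs `ε_j` such that
this sum is at most `cov (∑_j ε_j F_j, ∑_j ε_j G_j)`, to which the covariance inequality for bounded
variables applies once (`exists_signs_sum_diag_le`, `sum_covariance_le`).
-/

noncomputable section

namespace OvA

open ProbabilityTheory

/-! ### Covariances under a bound on the dependence of two σ-algebras -/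

section Covariance

variable {Ω : Type*} {m m₁ m₂ m0 : MeasurableSpace Ω} {μ : Measure Ω} [IsProbabilityMeasure μ]

/-- A centered variable with small integrals over all sets of a σ-algebra is almost uncorrelated
with the bounded variables that are measurable for it: test its conditional expectation on the set
where that is nonnegative. -/
lemma abs_integral_mul_le_of_setIntegral (hm : m ≤ m0) {f X : Ω → ℝ}
    {a b : ℝ} (hf : Measurable[m] f) (hfa : ∀ ω, |f ω| ≤ a) (hX : Integrable X μ)
    (hX0 : ∫ ω, X ω ∂μ = 0)
    (hb : ∀ A, MeasurableSet[m] A → |∫ ω in A, X ω ∂μ| ≤ b) :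
    |∫ ω, f ω * X ω ∂μ| ≤ a * (2 * b) := by
  obtain ⟨ω₀⟩ : Nonempty Ω := nonempty_of_isProbabilityMeasure μ
  have ha : 0 ≤ a := (abs_nonneg _).trans (hfa ω₀)
  set H : Ω → ℝ := μ[X | m] with hH
  have hHm : Measurable[m] H := stronglyMeasurable_condExp.measurable
  have hHi : Integrable H μ := integrable_condExp
  have hfX : Integrable (f * X) μ :=
    hX.bdd_mul (hf.mono hm le_rfl).aestronglyMeasurable (ae_of_all _ fun ω => (hfa ω : ‖f ω‖ ≤ a))
  have hfH : Integrable (fun ω => f ω * H ω) μ :=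
    hHi.bdd_mul (hf.mono hm le_rfl).aestronglyMeasurable (ae_of_all _ fun ω => (hfa ω : ‖f ω‖ ≤ a))
  have h1 : ∫ ω, f ω * X ω ∂μ = ∫ ω, f ω * H ω ∂μ := by
    rw [show (∫ ω, f ω * X ω ∂μ) = ∫ ω, (f * X) ω ∂μ from rfl, ← integral_condExp hm]
    exact integral_congr_ae
      (condExp_mul_of_stronglyMeasurable_left (hf.stronglyMeasurable) hfX hX)
  set A : Set Ω := {ω | 0 ≤ H ω} with hA
  have hAm : MeasurableSet[m] A := @measurableSet_le _ _ _ _ _ m _ _ _ _ _ measurable_const hHm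
  have hAm0 : MeasurableSet A := hm _ hAm
  have h2 : |∫ ω, f ω * H ω ∂μ| ≤ a * ∫ ω, |H ω| ∂μ := by
    rw [← integral_const_mul]
    refine (abs_integral_le_integral_abs).trans (integral_mono hfH.abs (hHi.abs.const_mul a) ?_)
    intro ω
    simp only [abs_mul]
    exact mul_le_mul_of_nonneg_right (hfa ω) (abs_nonneg _)
  have h3 : ∫ ω, |H ω| ∂μ = ∫ ω in A, X ω ∂μ - ∫ ω in Aᶜ, X ω ∂μ := by
    rw [← integral_add_compl hAm0 hHi.abs, ← setIntegral_condExp hm hX hAm,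
      ← setIntegral_condExp hm hX hAm.compl, sub_eq_add_neg, ← integral_neg]
    congr 1
    · exact setIntegral_congr_fun hAm0 fun ω hω => abs_of_nonneg hω
    · exact setIntegral_congr_fun hAm0.compl fun ω hω => abs_of_nonpos (le_of_not_ge hω)
  have h4 : ∫ ω in Aᶜ, X ω ∂μ = - ∫ ω in A, X ω ∂μ := by
    have := integral_add_compl hAm0 hX
    linarith
  rw [h1]
  refine h2.trans (mul_le_mul_of_nonneg_left ?_ ha)
  rw [h3, h4]
  have := (abs_le.mp (hb A hAm)).2
  linarith

lemma covariance_eq_integral_mul_sub {F G : Ω → ℝ} (hF : MemLp F 2 μ) (hG : MemLp G 2 μ) :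
    cov[F, G; μ] = ∫ ω, F ω * (G ω - ∫ ω, G ω ∂μ) ∂μ := by
  have h1 : Integrable (fun ω => F ω * G ω) μ := hF.integrable_mul hG
  have h2 := (hF.integrable (by norm_num)).mul_const (∫ ω, G ω ∂μ)
  rw [covariance_eq_sub hF hG]
  simp only [mul_sub]
  rw [integral_sub h1 h2, integral_mul_const]
  rfl

/-- Davydov's covariance inequality for bounded variables. -/
lemma abs_covariance_le (h₁ : m₁ ≤ m0) (h₂ : m₂ ≤ m0) {F G : Ω → ℝ}
    {a b δ : ℝ} (hF : Measurable[m₁] F) (hG : Measurable[m₂] G)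
    (hFa : ∀ ω, |F ω| ≤ a) (hGb : ∀ ω, |G ω| ≤ b)
    (hδ : ∀ A₁ A₂, MeasurableSet[m₁] A₁ → MeasurableSet[m₂] A₂ →
      |μ.real (A₁ ∩ A₂) - μ.real A₁ * μ.real A₂| ≤ δ) :
    |cov[F, G; μ]| ≤ 4 * δ * a * b := by
  have hFL : MemLp F 2 μ := MemLp.of_bound (hF.mono h₁ le_rfl).aestronglyMeasurable a
    (ae_of_all _ hFa)
  have hGL : MemLp G 2 μ := MemLp.of_bound (hG.mono h₂ le_rfl).aestronglyMeasurable b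
    (ae_of_all _ hGb)
  have hGi : Integrable G μ := hGL.integrable (by norm_num)
  rw [covariance_eq_integral_mul_sub hFL hGL]
  have key : ∀ A, MeasurableSet[m₁] A →
      |∫ ω in A, (G ω - ∫ ω, G ω ∂μ) ∂μ| ≤ b * (2 * δ) := by
    intro A hA
    have hA0 := h₁ _ hA
    have hind : Integrable (A.indicator fun _ => (1 : ℝ)) μ :=
      (integrable_const _).indicator hA0
    have e : ∫ ω in A, (G ω - ∫ ω, G ω ∂μ) ∂μ
        = ∫ ω, G ω * (A.indicator (fun _ => (1 : ℝ)) ω - μ.real A) ∂μ := by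
      rw [integral_sub hGi.integrableOn (integrable_const _), integral_const]
      simp only [mul_sub]
      have hGA : (fun ω => G ω * A.indicator (fun _ => (1 : ℝ)) ω) = A.indicator G := by
        ext ω
        by_cases h : ω ∈ A <;> simp [h]
      rw [integral_sub (by rw [hGA]; exact hGi.indicator hA0) (hGi.mul_const _),
        integral_mul_const, hGA, integral_indicator hA0]
      simp [mul_comm]
    rw [e]
    refine abs_integral_mul_le_of_setIntegral h₂ hG hGb (hind.sub (integrable_const _)) ?_ ?_
    · rw [integral_sub hind (integrable_const _), integral_indicator hA0]
      simp
    · intro B hB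
      rw [integral_sub hind.integrableOn (integrable_const _), integral_indicator hA0,
        Measure.restrict_restrict hA0]
      have := hδ A B hA hB
      simpa [mul_comm] using this
  have := abs_integral_mul_le_of_setIntegral (X := fun ω => G ω - ∫ ω, G ω ∂μ) h₁ hF hFa
    (hGi.sub (integrable_const _))
    (by rw [integral_sub hGi (integrable_const _)]; simp) key
  linarith

/-- The diagonal of a square matrix is dominated by one of its signed total sums: with signs
chosen one after the other, every new pair of off-diagonal contributions can be made nonnegative. -/
lemma exists_signs_sum_diag_le {J : Type*} [DecidableEq J] (c : J → J → ℝ) (s : Finset J) :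
    ∃ ε : J → ℝ, (∀ j, |ε j| = 1) ∧
      ∑ j ∈ s, c j j ≤ ∑ j ∈ s, ∑ k ∈ s, ε j * ε k * c j k := by
  induction s using Finset.induction_on with
  | empty => exact ⟨fun _ => 1, by simp, by simp⟩
  | insert l s hl ih =>
    obtain ⟨ε, hε, h⟩ := ih
    set q : ℝ := ∑ k ∈ s, ε k * (c l k + c k l) with hq
    obtain ⟨σ, hσ, hσq⟩ : ∃ σ : ℝ, |σ| = 1 ∧ 0 ≤ σ * q := by
      rcases le_total 0 q with h0 | h0
      · exact ⟨1, by simp, by linarith⟩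
      · exact ⟨-1, by simp, by linarith⟩
    refine ⟨Function.update ε l σ, fun j => ?_, ?_⟩
    · by_cases hj : j = l
      · subst hj; simpa using hσ
      · simpa [Function.update_of_ne hj] using hε j
    · have hne : ∀ k ∈ s, Function.update ε l σ k = ε k := fun k hk =>
        Function.update_of_ne (ne_of_mem_of_not_mem hk hl) _ _
      simp only [Finset.sum_insert hl, Function.update_self, Finset.sum_add_distrib]
      have e1 : ∑ k ∈ s, σ * Function.update ε l σ k * c l k
          + ∑ j ∈ s, Function.update ε l σ j * σ * c j l = σ * q := by
        rw [hq, Finset.mul_sum, ← Finset.sum_add_distrib]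
        refine Finset.sum_congr rfl fun k hk => ?_
        rw [hne k hk]; ring
      have e2 : ∑ j ∈ s, ∑ k ∈ s, Function.update ε l σ j * Function.update ε l σ k * c j k
          = ∑ j ∈ s, ∑ k ∈ s, ε j * ε k * c j k :=
        Finset.sum_congr rfl fun j hj => Finset.sum_congr rfl fun k hk => by
          rw [hne j hj, hne k hk]
      have e3 : σ * σ = 1 := by rw [← abs_mul_abs_self, hσ]; norm_num
      rw [e2, e3]
      linarith

/-- A covariance inequality for families: the bound involves the number of summands only through
the bounds on the sums of absolute values. -/
lemma sum_covariance_le {J : Type*} [Fintype J] (h₁ : m₁ ≤ m0)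
    (h₂ : m₂ ≤ m0) {F G : J → Ω → ℝ} {a b δ : ℝ} (hF : ∀ j, Measurable[m₁] (F j))
    (hG : ∀ j, Measurable[m₂] (G j))
    (hFa : ∀ ω, ∑ j, |F j ω| ≤ a) (hGb : ∀ ω, ∑ j, |G j ω| ≤ b)
    (hδ : ∀ A₁ A₂, MeasurableSet[m₁] A₁ → MeasurableSet[m₂] A₂ →
      |μ.real (A₁ ∩ A₂) - μ.real A₁ * μ.real A₂| ≤ δ) :
    ∑ j, cov[F j, G j; μ] ≤ 4 * δ * a * b := by
  classical
  obtain ⟨ε, hε, h⟩ := exists_signs_sum_diag_le (fun j k => cov[F j, G k; μ]) Finset.univ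
  have hFL : ∀ j, MemLp (fun ω => ε j * F j ω) 2 μ := fun j =>
    (MemLp.of_bound ((hF j).mono h₁ le_rfl).aestronglyMeasurable a (ae_of_all _ fun ω =>
      (Finset.single_le_sum (f := fun j => |F j ω|) (fun _ _ => abs_nonneg _)
        (Finset.mem_univ j)).trans (hFa ω))).const_mul _
  have hGL : ∀ j, MemLp (fun ω => ε j * G j ω) 2 μ := fun j =>
    (MemLp.of_bound ((hG j).mono h₂ le_rfl).aestronglyMeasurable b (ae_of_all _ fun ω =>
      (Finset.single_le_sum (f := fun j => |G j ω|) (fun _ _ => abs_nonneg _)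
        (Finset.mem_univ j)).trans (hGb ω))).const_mul _
  have e : cov[fun ω => ∑ j, ε j * F j ω, fun ω => ∑ k, ε k * G k ω; μ]
      = ∑ j, ∑ k, ε j * ε k * cov[F j, G k; μ] := by
    rw [covariance_fun_sum_fun_sum hFL hGL]
    refine Finset.sum_congr rfl fun j _ => Finset.sum_congr rfl fun k _ => ?_
    rw [covariance_const_mul_left, covariance_const_mul_right]; ring
  have bd : ∀ (H : J → Ω → ℝ) ω, |∑ j, ε j * H j ω| ≤ ∑ j, |H j ω| := fun H ω =>
    (Finset.abs_sum_le_sum_abs _ _).trans (le_of_eq (Finset.sum_congr rfl fun j _ => by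
      rw [abs_mul, hε, one_mul]))
  have := abs_covariance_le (μ := μ) h₁ h₂
    (F := fun ω => ∑ j, ε j * F j ω) (G := fun ω => ∑ j, ε j * G j ω)
    (Finset.measurable_fun_sum _ fun j _ => (hF j).const_mul _)
    (Finset.measurable_fun_sum _ fun j _ => (hG j).const_mul _)
    (fun ω => (bd F ω).trans (hFa ω)) (fun ω => (bd G ω).trans (hGb ω)) hδ
  rw [e] at this
  exact h.trans ((le_abs_self _).trans this)

end Covariance

/-! ### Exponential moments of sums over well separated times -/

/-- The strong mixing coefficient of lag `a` of the sequence `Z` is at most `δ`. -/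
def MixingLE {Ω E : Type*} [MeasurableSpace Ω] [MeasurableSpace E] (Pr : Measure Ω)
    (Z : ℕ → Ω → E) (a : ℕ) (δ : ℝ) : Prop :=
  ∀ (t : ℕ) (A₁ A₂ : Set Ω),
    MeasurableSet[⨆ i : Set.Iic t, MeasurableSpace.comap (Z i) inferInstance] A₁ →
    MeasurableSet[⨆ i : Set.Ici (t + a), MeasurableSpace.comap (Z i) inferInstance] A₂ →
    |Pr.real (A₁ ∩ A₂) - Pr.real A₁ * Pr.real A₂| ≤ δ

lemma mixingLE_of_mixingCoeff_le {Ω E : Type*} [MeasurableSpace Ω] [MeasurableSpace E]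
    {Pr : Measure Ω} [IsProbabilityMeasure Pr] {Z : ℕ → Ω → E} {a : ℕ} {δ : ℝ}
    (h : mixingCoeff Pr Z a ≤ δ) : MixingLE Pr Z a δ := by
  intro t A₁ A₂ h₁ h₂
  unfold mixingCoeff at h
  refine le_trans ?_ h
  refine le_csSup ?_ ⟨t, A₁, A₂, h₁, h₂, rfl⟩
  refine ⟨2, ?_⟩
  rintro r ⟨t, A₁, A₂, -, -, rfl⟩
  have h1 := measureReal_nonneg (μ := Pr) (s := A₁ ∩ A₂)
  have h2 := measureReal_le_one (μ := Pr) (s := A₁ ∩ A₂)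
  have h3 := measureReal_nonneg (μ := Pr) (s := A₁)
  have h4 := measureReal_le_one (μ := Pr) (s := A₁)
  have h5 := measureReal_nonneg (μ := Pr) (s := A₂)
  have h6 := measureReal_le_one (μ := Pr) (s := A₂)
  rw [abs_le]
  constructor <;> nlinarith

/-- An `ℓ¹` bound controls `∑ (exp y - 1)`, whatever the number of terms. -/
lemma sum_abs_exp_sub_one_le {J : Type*} (s : Finset J) (y : J → ℝ) :
    ∑ j ∈ s, |Real.exp (y j) - 1| ≤ Real.exp (∑ j ∈ s, |y j|) - 1 := by
  classical
  induction s using Finset.induction_on with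
  | empty => simp
  | insert l s hl ih =>
    rw [Finset.sum_insert hl, Finset.sum_insert hl, Real.exp_add]
    have h1 : |Real.exp (y l) - 1| ≤ Real.exp |y l| - 1 := by
      rcases le_total 0 (y l) with h | h
      · rw [abs_of_nonneg h, abs_of_nonneg (by linarith [Real.one_le_exp h])]
      · rw [abs_of_nonpos h, abs_of_nonpos (by linarith [Real.exp_le_one_iff.2 h])]
        nlinarith [Real.exp_pos (y l), Real.add_one_le_exp (y l), Real.add_one_le_exp (-y l)]
    have h2 : 1 ≤ Real.exp |y l| := Real.one_le_exp (abs_nonneg _)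
    have h3 : 1 ≤ Real.exp (∑ j ∈ s, |y j|) :=
      Real.one_le_exp (Finset.sum_nonneg fun _ _ => abs_nonneg _)
    nlinarith

lemma integral_comp_of_map_eq {Ω E : Type*} [MeasurableSpace Ω] [MeasurableSpace E]
    {Pr : Measure Ω} {P : Measure E} {Z : ℕ → Ω → E} (hZ : ∀ i, Measurable (Z i))
    (hP : ∀ i, Pr.map (Z i) = P) {g : E → ℝ} (hg : Measurable g) (i : ℕ) :
    ∫ ω, g (Z i ω) ∂Pr = ∫ z, g z ∂P := by
  rw [← hP i, integral_map (hZ i).aemeasurable hg.aestronglyMeasurable]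

section ExpMoment

variable {Ω E J : Type*} [MeasurableSpace Ω] [MeasurableSpace E] [Fintype J]
  {Pr : Measure Ω} [IsProbabilityMeasure Pr] {P : Measure E} [IsProbabilityMeasure P]
  {Z : ℕ → Ω → E}

lemma abs_le_of_sum_abs_le {x : J → ℝ} {ρ : ℝ} (h : ∑ j, |x j| ≤ ρ) (j : J) : |x j| ≤ ρ :=
  (Finset.single_le_sum (f := fun j => |x j|) (fun _ _ => abs_nonneg _) (Finset.mem_univ j)).trans h

/-- The total excess `∑ (𝔼 exp S_j - 1)` of the exponential moments of a family of sums over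
times that are `a` apart. Adding the latest time multiplies each moment by at most `1 + ∫ ξ_j²`, up
to a covariance; the covariances of the whole family are controlled at once. -/
lemma sum_integral_exp_sub_one_le (hZ : ∀ i, Measurable (Z i)) (hP : ∀ i, Pr.map (Z i) = P)
    {a : ℕ} {δ : ℝ} (hδ : 0 ≤ δ) (hmix : MixingLE Pr Z a δ) {ξ : J → E → ℝ}
    (hξ : ∀ j, Measurable (ξ j)) {ρ v : ℝ} (hρ : ρ ≤ 1 / 2) (hξρ : ∀ z, ∑ j, |ξ j z| ≤ ρ)
    (hmean : ∀ j, ∫ z, ξ j z ∂P = 0) (hv : ∑ j, ∫ z, ξ j z ^ 2 ∂P ≤ v) {N : ℕ}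
    (T : Finset ℕ) (hT : ∀ i ∈ T, ∀ i' ∈ T, i < i' → i + a ≤ i') (hTN : T.card ≤ N) :
    ∑ j, (∫ ω, Real.exp (∑ i ∈ T, ξ j (Z i ω)) ∂Pr - 1)
      ≤ (1 + v + 4 * δ * Real.exp (N * ρ)) ^ T.card - 1 := by
  classical
  obtain ⟨z₀⟩ : Nonempty E := nonempty_of_isProbabilityMeasure P
  have hρ0 : 0 ≤ ρ := (Finset.sum_nonneg fun _ _ => abs_nonneg _).trans (hξρ z₀)
  have hξj : ∀ j z, |ξ j z| ≤ ρ := fun j z => abs_le_of_sum_abs_le (hξρ z) j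
  have hv0 : 0 ≤ v := (Finset.sum_nonneg fun j _ => integral_nonneg fun z => sq_nonneg _).trans hv
  set e : ℝ := 4 * δ * Real.exp (N * ρ) with he
  have he0 : 0 ≤ e := by positivity
  -- the sums over a set of times, and their exponentials, are bounded
  have hSb : ∀ (T : Finset ℕ) ω, ∑ j, |∑ i ∈ T, ξ j (Z i ω)| ≤ T.card * ρ := by
    intro T ω
    calc ∑ j, |∑ i ∈ T, ξ j (Z i ω)| ≤ ∑ j, ∑ i ∈ T, |ξ j (Z i ω)| :=
          Finset.sum_le_sum fun j _ => Finset.abs_sum_le_sum_abs _ _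
      _ = ∑ i ∈ T, ∑ j, |ξ j (Z i ω)| := Finset.sum_comm
      _ ≤ ∑ i ∈ T, ρ := Finset.sum_le_sum fun i _ => hξρ _
      _ = T.card * ρ := by simp
  have hSm : ∀ (T : Finset ℕ) j, Measurable fun ω => ∑ i ∈ T, ξ j (Z i ω) := fun T j =>
    Finset.measurable_fun_sum _ fun i _ => (hξ j).comp (hZ i)
  have hexpb : ∀ (T : Finset ℕ) j ω,
      ‖Real.exp (∑ i ∈ T, ξ j (Z i ω))‖ ≤ Real.exp (T.card * ρ) := by
    intro T j ω
    rw [Real.norm_of_nonneg (Real.exp_pos _).le]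
    exact Real.exp_le_exp.2 ((le_abs_self _).trans (abs_le_of_sum_abs_le (hSb T ω) j))
  have hexpi : ∀ (T : Finset ℕ) j, Integrable (fun ω => Real.exp (∑ i ∈ T, ξ j (Z i ω))) Pr :=
    fun T j => Integrable.of_bound (hSm T j).exp.aestronglyMeasurable _
      (ae_of_all _ (hexpb T j))
  have hξi : ∀ j, Integrable (ξ j) P := fun j =>
    Integrable.of_bound (hξ j).aestronglyMeasurable ρ (ae_of_all _ (hξj j))
  -- the exponential moment is at least one, the variables being centered
  have hge : ∀ (T : Finset ℕ) j, 1 ≤ ∫ ω, Real.exp (∑ i ∈ T, ξ j (Z i ω)) ∂Pr := by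
    intro T j
    have hi : ∀ i, Integrable (fun ω => ξ j (Z i ω)) Pr := fun i =>
      Integrable.of_bound ((hξ j).comp (hZ i)).aestronglyMeasurable ρ
        (ae_of_all _ fun ω => hξj j _)
    have h1 : ∫ ω, (∑ i ∈ T, ξ j (Z i ω) + 1) ∂Pr = 1 := by
      rw [integral_add (integrable_finsetSum _ fun i _ => hi i) (integrable_const _),
        integral_finsetSum _ fun i _ => hi i]
      simp [integral_comp_of_map_eq hZ hP (hξ j), hmean]
    rw [← h1]
    exact integral_mono ((integrable_finsetSum _ fun i _ => hi i).add (integrable_const _))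
      (hexpi T j) fun ω => Real.add_one_le_exp _
  -- one factor
  have hsqi : ∀ j, Integrable (fun z => ξ j z ^ 2) P := fun j =>
    Integrable.of_bound ((hξ j).pow_const 2).aestronglyMeasurable (ρ ^ 2) (ae_of_all _ fun z => by
      rw [Real.norm_of_nonneg (sq_nonneg _), ← sq_abs]
      exact pow_le_pow_left₀ (abs_nonneg _) (hξj j z) 2)
  have hadd : ∀ j, Integrable (fun z => 1 + ξ j z) P := fun j => (integrable_const _).add (hξi j)
  have hone : ∀ j i, ∫ ω, Real.exp (ξ j (Z i ω)) ∂Pr ≤ 1 + ∫ z, ξ j z ^ 2 ∂P := by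
    intro j i
    rw [integral_comp_of_map_eq hZ hP (hξ j).exp i]
    have h1 : ∫ z, (1 + ξ j z + ξ j z ^ 2) ∂P = 1 + ∫ z, ξ j z ^ 2 ∂P := by
      rw [integral_add (hadd j) (hsqi j),
        integral_add (integrable_const _) (hξi j), hmean]
      simp
    rw [← h1]
    refine integral_mono (Integrable.of_bound (hξ j).exp.aestronglyMeasurable (Real.exp ρ)
      (ae_of_all _ fun z => ?_)) ((hadd j).add (hsqi j)) fun z => ?_
    · rw [Real.norm_of_nonneg (Real.exp_pos _).le]
      exact Real.exp_le_exp.2 ((le_abs_self _).trans (hξj j z))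
    · have := (abs_le.1 (Real.abs_exp_sub_one_sub_id_le (x := ξ j z)
        ((hξj j z).trans (by linarith)))).2
      simp only
      linarith
  have hvj : ∀ j, ∫ z, ξ j z ^ 2 ∂P ≤ v := fun j =>
    (Finset.single_le_sum (f := fun j => ∫ z, ξ j z ^ 2 ∂P)
      (fun _ _ => integral_nonneg fun z => sq_nonneg _) (Finset.mem_univ j)).trans hv
  induction T using Finset.induction_on_max with
  | empty => simp
  | insert t T htmax ih =>
    have htT : t ∉ T := fun h => lt_irrefl _ (htmax t h)
    have hcard : (insert t T).card = T.card + 1 := Finset.card_insert_of_notMem htT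
    have ih' := ih (fun i hi i' hi' => hT i (Finset.mem_insert_of_mem hi) i'
      (Finset.mem_insert_of_mem hi')) (by omega)
    have hcov : ∑ j, cov[fun ω => Real.exp (∑ i ∈ T, ξ j (Z i ω)),
        fun ω => Real.exp (ξ j (Z t ω)); Pr] ≤ e := by
      rcases T.eq_empty_or_nonempty with rfl | ⟨i₀, hi₀⟩
      · simpa [covariance_const_left] using he0
      · have hta : ∀ i ∈ T, i ≤ t - a := fun i hi => by
          have := hT i (Finset.mem_insert_of_mem hi) t (Finset.mem_insert_self _ _) (htmax i hi)
          omega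
        have hat : t - a + a = t := by
          have := hT i₀ (Finset.mem_insert_of_mem hi₀) t (Finset.mem_insert_self _ _)
            (htmax i₀ hi₀)
          omega
        have hsub : ∀ j, cov[fun ω => Real.exp (∑ i ∈ T, ξ j (Z i ω)),
            fun ω => Real.exp (ξ j (Z t ω)); Pr]
            = cov[fun ω => Real.exp (∑ i ∈ T, ξ j (Z i ω)) - 1,
            fun ω => Real.exp (ξ j (Z t ω)) - 1; Pr] := by
          intro j
          rw [covariance_sub_const_left (hexpi T j), covariance_sub_const_right]
          simpa using hexpi {t} j
        simp only [hsub]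
        have hle : ∀ (A : Set ℕ),
            (⨆ i : A, MeasurableSpace.comap (Z i) inferInstance) ≤ (inferInstance :
              MeasurableSpace Ω) := fun A => iSup_le fun i => (hZ i).comap_le
        have hmi : ∀ (A : Set ℕ) i, i ∈ A → ∀ j,
            Measurable[⨆ i : A, MeasurableSpace.comap (Z i) inferInstance]
              fun ω => ξ j (Z i ω) := fun A i hi j =>
          ((hξ j).comp (comap_measurable (Z i))).mono
            (le_iSup (fun i : A => MeasurableSpace.comap (Z i) inferInstance) ⟨i, hi⟩) le_rfl
        have hF : ∀ j, Measurable[⨆ i : Set.Iic (t - a),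
            MeasurableSpace.comap (Z i) inferInstance]
            fun ω => Real.exp (∑ i ∈ T, ξ j (Z i ω)) - 1 := fun j =>
          (Real.measurable_exp.comp (Finset.measurable_fun_sum _ fun i hi =>
            hmi (Set.Iic (t - a)) i (hta i hi) j)).sub_const 1
        have hG : ∀ j, Measurable[⨆ i : Set.Ici (t - a + a),
            MeasurableSpace.comap (Z i) inferInstance]
            fun ω => Real.exp (ξ j (Z t ω)) - 1 := fun j =>
          (Real.measurable_exp.comp (hmi (Set.Ici (t - a + a)) t hat.le j)).sub_const 1
        refine (sum_covariance_le (hle _) (hle _) hF hG (a := Real.exp (N * ρ)) (b := 1) ?_ ?_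
          (hmix (t - a))).trans (le_of_eq (by rw [he]; ring))
        · intro ω
          refine (sum_abs_exp_sub_one_le _ _).trans ?_
          have : Real.exp (∑ j, |∑ i ∈ T, ξ j (Z i ω)|) ≤ Real.exp (N * ρ) := by
            refine Real.exp_le_exp.2 ((hSb T ω).trans (mul_le_mul_of_nonneg_right ?_ hρ0))
            exact_mod_cast (by omega : T.card ≤ N)
          linarith
        · intro ω
          calc ∑ j, |Real.exp (ξ j (Z t ω)) - 1| ≤ ∑ j, 2 * |ξ j (Z t ω)| :=
                Finset.sum_le_sum fun j _ =>
                  Real.abs_exp_sub_one_le ((hξj j _).trans (by linarith))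
            _ = 2 * ∑ j, |ξ j (Z t ω)| := by rw [Finset.mul_sum]
            _ ≤ 1 := by linarith [hξρ (Z t ω)]
    have hstep : ∀ j, ∫ ω, Real.exp (∑ i ∈ insert t T, ξ j (Z i ω)) ∂Pr - 1
        ≤ (∫ ω, Real.exp (∑ i ∈ T, ξ j (Z i ω)) ∂Pr - 1) * (1 + v) + ∫ z, ξ j z ^ 2 ∂P
          + cov[fun ω => Real.exp (∑ i ∈ T, ξ j (Z i ω)),
            fun ω => Real.exp (ξ j (Z t ω)); Pr] := by
      intro j
      have hL : ∀ T : Finset ℕ, MemLp (fun ω => Real.exp (∑ i ∈ T, ξ j (Z i ω))) 2 Pr :=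
        fun T => MemLp.of_bound (hSm T j).exp.aestronglyMeasurable _ (ae_of_all _ (hexpb T j))
      have hLt : MemLp (fun ω => Real.exp (ξ j (Z t ω))) 2 Pr := by simpa using hL {t}
      have h1 := covariance_eq_sub (hL T) hLt
      have h2 : ∫ ω, Real.exp (∑ i ∈ insert t T, ξ j (Z i ω)) ∂Pr
          = ∫ ω, ((fun ω => Real.exp (∑ i ∈ T, ξ j (Z i ω)))
            * fun ω => Real.exp (ξ j (Z t ω))) ω ∂Pr := by
        refine integral_congr_ae (ae_of_all _ fun ω => ?_)
        simp only [Pi.mul_apply]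
        rw [Finset.sum_insert htT, Real.exp_add, mul_comm]
      rw [h2]
      have h3 := hge T j
      have h4 := hone j t
      have h5 := hvj j
      have h6 : (0:ℝ) ≤ ∫ z, ξ j z ^ 2 ∂P := integral_nonneg fun z => sq_nonneg _
      rw [h1]
      nlinarith
    calc ∑ j, (∫ ω, Real.exp (∑ i ∈ insert t T, ξ j (Z i ω)) ∂Pr - 1)
        ≤ ∑ j, ((∫ ω, Real.exp (∑ i ∈ T, ξ j (Z i ω)) ∂Pr - 1) * (1 + v) + ∫ z, ξ j z ^ 2 ∂P
          + cov[fun ω => Real.exp (∑ i ∈ T, ξ j (Z i ω)),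
            fun ω => Real.exp (ξ j (Z t ω)); Pr]) := Finset.sum_le_sum fun j _ => hstep j
      _ ≤ ((1 + v + e) ^ T.card - 1) * (1 + v) + v + e := by
          rw [Finset.sum_add_distrib, Finset.sum_add_distrib, ← Finset.sum_mul]
          have := mul_le_mul_of_nonneg_right ih' (by linarith : 0 ≤ 1 + v)
          linarith
      _ ≤ (1 + v + e) ^ (insert t T).card - 1 := by
          rw [hcard, pow_succ]
          have : (1:ℝ) ≤ (1 + v + e) ^ T.card := one_le_pow₀ (by linarith)
          nlinarith

/-- Jensen's inequality reduces a mean over `n` consecutive times to the sums over the residue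
classes modulo `a`, whose times are `a` apart. -/
lemma sum_integral_exp_mean_sub_one_le (hZ : ∀ i, Measurable (Z i)) (hP : ∀ i, Pr.map (Z i) = P)
    {a : ℕ} (ha : 0 < a) {δ : ℝ} (hδ : 0 ≤ δ) (hmix : MixingLE Pr Z a δ) {ξ : J → E → ℝ}
    (hξ : ∀ j, Measurable (ξ j)) {M V : ℝ} (hξM : ∀ z, ∑ j, |ξ j z| ≤ M)
    (hmean : ∀ j, ∫ z, ξ j z ∂P = 0) (hV : ∑ j, ∫ z, ξ j z ^ 2 ∂P ≤ V) {n N : ℕ} (hn : 0 < n)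
    (hN : n / a + 1 ≤ N) {θ : ℝ} (hθM : |θ| * M ≤ 1 / 2) :
    ∑ j, (∫ ω, Real.exp (θ * (n / a) * ((n : ℝ)⁻¹ * ∑ i ∈ Finset.range n, ξ j (Z i ω))) ∂Pr - 1)
      ≤ Real.exp (N * (θ ^ 2 * V + 4 * δ * Real.exp (N * (|θ| * M)))) - 1 := by
  classical
  obtain ⟨z₀⟩ : Nonempty E := nonempty_of_isProbabilityMeasure P
  have hM0 : 0 ≤ M := (Finset.sum_nonneg fun _ _ => abs_nonneg _).trans (hξM z₀)
  have hV0 : 0 ≤ V := (Finset.sum_nonneg fun j _ => integral_nonneg fun z => sq_nonneg _).trans hV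
  have ha' : (0 : ℝ) < a := by exact_mod_cast ha
  have hn' : (0 : ℝ) < n := by exact_mod_cast hn
  set T : ℕ → Finset ℕ := fun r => (Finset.range n).filter (fun i => i % a = r) with hTdef
  have hTcard : ∀ r, (T r).card ≤ N := by
    intro r
    refine le_trans ?_ hN
    have hsub : (T r).card ≤ (Finset.range (n / a + 1)).card := by
      refine Finset.card_le_card_of_injOn (fun i => i / a) ?_ ?_
      · intro i hi
        have := (Finset.mem_filter.1 hi).1
        simp only [Finset.coe_range, Set.mem_Iio]
        exact Nat.lt_succ_of_le (Nat.div_le_div_right (Finset.mem_range.1 this).le)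
      · intro i hi i' hi' h
        have h1 := (Finset.mem_filter.1 hi).2
        have h2 := (Finset.mem_filter.1 hi').2
        simp only at h
        rw [← Nat.div_add_mod i a, ← Nat.div_add_mod i' a, h, h1, h2]
    simpa using hsub
  have hTsp : ∀ r, ∀ i ∈ T r, ∀ i' ∈ T r, i < i' → i + a ≤ i' := by
    intro r i hi i' hi' h
    have h1 := (Finset.mem_filter.1 hi).2
    have h2 := (Finset.mem_filter.1 hi').2
    have hdvd : a ∣ i' - i := (Nat.modEq_iff_dvd' h.le).1 (h1.trans h2.symm)
    have := Nat.le_of_dvd (by omega) hdvd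
    omega
  set ζ : J → E → ℝ := fun j z => θ * ξ j z with hζ
  have hζm : ∀ j, Measurable (ζ j) := fun j => (hξ j).const_mul θ
  have hζb : ∀ z, ∑ j, |ζ j z| ≤ |θ| * M := by
    intro z
    simp only [hζ, abs_mul, ← Finset.mul_sum]
    exact mul_le_mul_of_nonneg_left (hξM z) (abs_nonneg _)
  have hζmean : ∀ j, ∫ z, ζ j z ∂P = 0 := fun j => by
    simp only [hζ, integral_const_mul, hmean, mul_zero]
  have hζV : ∑ j, ∫ z, ζ j z ^ 2 ∂P ≤ θ ^ 2 * V := by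
    simp only [hζ, mul_pow, integral_const_mul, ← Finset.mul_sum]
    exact mul_le_mul_of_nonneg_left hV (sq_nonneg _)
  set e : ℝ := 4 * δ * Real.exp (N * (|θ| * M)) with he
  have he0 : 0 ≤ e := by positivity
  have hmain : ∀ r, ∑ j, (∫ ω, Real.exp (∑ i ∈ T r, ζ j (Z i ω)) ∂Pr - 1)
      ≤ Real.exp (N * (θ ^ 2 * V + e)) - 1 := by
    intro r
    refine (sum_integral_exp_sub_one_le hZ hP hδ hmix hζm hθM hζb hζmean hζV (T r) (hTsp r)
      (hTcard r)).trans (sub_le_sub_right ?_ 1)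
    have hb : 0 ≤ θ ^ 2 * V + e := by positivity
    calc (1 + θ ^ 2 * V + e) ^ (T r).card ≤ Real.exp (θ ^ 2 * V + e) ^ (T r).card :=
          pow_le_pow_left₀ (by linarith) (by linarith [Real.add_one_le_exp (θ ^ 2 * V + e)]) _
      _ = Real.exp ((T r).card * (θ ^ 2 * V + e)) := (Real.exp_nat_mul _ _).symm
      _ ≤ _ := Real.exp_le_exp.2 (mul_le_mul_of_nonneg_right (by exact_mod_cast hTcard r) hb)
  have hexpi : ∀ r j, Integrable (fun ω => Real.exp (∑ i ∈ T r, ζ j (Z i ω))) Pr := by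
    intro r j
    refine Integrable.of_bound (Finset.measurable_fun_sum _ fun i _ =>
      (hζm j).comp (hZ i)).exp.aestronglyMeasurable (Real.exp ((T r).card * (|θ| * M)))
      (ae_of_all _ fun ω => ?_)
    rw [Real.norm_of_nonneg (Real.exp_pos _).le]
    refine Real.exp_le_exp.2 ?_
    calc ∑ i ∈ T r, ζ j (Z i ω) ≤ ∑ i ∈ T r, |θ| * M := Finset.sum_le_sum fun i _ =>
          (le_abs_self _).trans (abs_le_of_sum_abs_le (hζb _) j)
      _ = _ := by simp
  have hjensen : ∀ j ω, Real.exp (θ * (n / a) * ((n : ℝ)⁻¹ * ∑ i ∈ Finset.range n, ξ j (Z i ω)))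
      ≤ ∑ r ∈ Finset.range a, (a : ℝ)⁻¹ * Real.exp (∑ i ∈ T r, ζ j (Z i ω)) := by
    intro j ω
    have h1 : θ * (n / a) * ((n : ℝ)⁻¹ * ∑ i ∈ Finset.range n, ξ j (Z i ω))
        = ∑ r ∈ Finset.range a, (a : ℝ)⁻¹ • ∑ i ∈ T r, ζ j (Z i ω) := by
      simp only [smul_eq_mul]
      rw [← Finset.mul_sum, Finset.sum_fiberwise_of_maps_to
        (fun i _ => Finset.mem_range.2 (Nat.mod_lt i ha)), ← Finset.mul_sum]
      field_simp
    rw [h1]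
    have := convexOn_exp.map_sum_le (t := Finset.range a) (w := fun _ => (a : ℝ)⁻¹)
      (p := fun r => ∑ i ∈ T r, ζ j (Z i ω)) (fun _ _ => by positivity)
      (by simp [ha'.ne']) (fun _ _ => Set.mem_univ _)
    simpa only [smul_eq_mul] using this
  have hj : ∀ j, ∫ ω, Real.exp (θ * (n / a) * ((n : ℝ)⁻¹ *
      ∑ i ∈ Finset.range n, ξ j (Z i ω))) ∂Pr - 1
      ≤ ∑ r ∈ Finset.range a, (a : ℝ)⁻¹ *
        (∫ ω, Real.exp (∑ i ∈ T r, ζ j (Z i ω)) ∂Pr - 1) := by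
    intro j
    have h1 : ∑ r ∈ Finset.range a, (a : ℝ)⁻¹ *
        (∫ ω, Real.exp (∑ i ∈ T r, ζ j (Z i ω)) ∂Pr - 1)
        = ∫ ω, ∑ r ∈ Finset.range a, (a : ℝ)⁻¹ * Real.exp (∑ i ∈ T r, ζ j (Z i ω)) ∂Pr - 1 := by
      rw [integral_finsetSum _ fun r _ => (hexpi r j).const_mul _]
      simp [mul_sub, Finset.sum_sub_distrib, integral_const_mul, ha'.ne']
    rw [h1]
    exact sub_le_sub_right (integral_mono_of_nonneg (ae_of_all _ fun ω => (Real.exp_pos _).le)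
      (integrable_finsetSum _ fun r _ => (hexpi r j).const_mul _)
      (ae_of_all _ (hjensen j))) 1
  calc _ ≤ ∑ j, ∑ r ∈ Finset.range a, (a : ℝ)⁻¹ *
        (∫ ω, Real.exp (∑ i ∈ T r, ζ j (Z i ω)) ∂Pr - 1) := Finset.sum_le_sum fun j _ => hj j
    _ = ∑ r ∈ Finset.range a, (a : ℝ)⁻¹ *
        ∑ j, (∫ ω, Real.exp (∑ i ∈ T r, ζ j (Z i ω)) ∂Pr - 1) := by
        rw [Finset.sum_comm]; simp only [Finset.mul_sum]
    _ ≤ ∑ r ∈ Finset.range a, (a : ℝ)⁻¹ * (Real.exp (N * (θ ^ 2 * V + e)) - 1) :=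
        Finset.sum_le_sum fun r _ => mul_le_mul_of_nonneg_left (hmain r) (by positivity)
    _ = _ := by
        rw [Finset.sum_const, Finset.card_range, nsmul_eq_mul]
        field_simp

/-- Even powers are dominated by `cosh - 1`, which vanishes at the origin: this keeps sums over
arbitrarily many indices under control. -/
lemma pow_le_factorial_mul_cosh_sub_one (x : ℝ) {k : ℕ} (hk : k ≠ 0) :
    x ^ (2 * k) ≤ (2 * k).factorial * (Real.cosh x - 1) := by
  have h := sum_le_hasSum {0, k} (fun i _ => by
    rw [pow_mul]; positivity) (Real.hasSum_cosh x)
  rw [Finset.sum_pair hk.symm] at h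
  simp only [mul_zero, pow_zero, Nat.factorial_zero, Nat.cast_one, div_one] at h
  have hf : (0 : ℝ) < (2 * k).factorial := by positivity
  have : x ^ (2 * k) / (2 * k).factorial ≤ Real.cosh x - 1 := by linarith
  rw [div_le_iff₀ hf] at this
  linarith

/-- Even moments of a family of means of centered variables. -/
lemma sum_integral_mean_pow_le (hZ : ∀ i, Measurable (Z i)) (hP : ∀ i, Pr.map (Z i) = P)
    {a : ℕ} (ha : 0 < a) {δ : ℝ} (hδ : 0 ≤ δ) (hmix : MixingLE Pr Z a δ) {ξ : J → E → ℝ}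
    (hξ : ∀ j, Measurable (ξ j)) {M V : ℝ} (hξM : ∀ z, ∑ j, |ξ j z| ≤ M)
    (hmean : ∀ j, ∫ z, ξ j z ∂P = 0) (hV : ∑ j, ∫ z, ξ j z ^ 2 ∂P ≤ V) {n N : ℕ} (hn : 0 < n)
    (hN : n / a + 1 ≤ N) {θ : ℝ} (hθ : 0 ≤ θ) (hθM : θ * M ≤ 1 / 2) {k : ℕ} (hk : k ≠ 0) :
    (θ * (n / a)) ^ (2 * k) *
      ∑ j, ∫ ω, ((n : ℝ)⁻¹ * ∑ i ∈ Finset.range n, ξ j (Z i ω)) ^ (2 * k) ∂Pr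
      ≤ (2 * k).factorial * Real.exp (N * (θ ^ 2 * V + 4 * δ * Real.exp (N * (θ * M)))) := by
  set lam : ℝ := θ * (n / a) with hlam
  set S : J → Ω → ℝ := fun j ω => (n : ℝ)⁻¹ * ∑ i ∈ Finset.range n, ξ j (Z i ω) with hS
  set B : ℝ := Real.exp (N * (θ ^ 2 * V + 4 * δ * Real.exp (N * (θ * M)))) with hB
  have h1 := sum_integral_exp_mean_sub_one_le hZ hP ha hδ hmix hξ hξM hmean hV hn hN
    (θ := θ) (by rwa [abs_of_nonneg hθ])
  have h2 := sum_integral_exp_mean_sub_one_le hZ hP ha hδ hmix hξ hξM hmean hV hn hN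
    (θ := -θ) (by rwa [abs_neg, abs_of_nonneg hθ])
  simp only [abs_neg, abs_of_nonneg hθ, neg_sq] at h1 h2
  have hSm : ∀ j, Measurable (S j) := fun j => (Finset.measurable_fun_sum _ fun i _ =>
    (hξ j).comp (hZ i)).const_mul _
  have hSb : ∀ j ω, |S j ω| ≤ M := by
    intro j ω
    have hn' : (0 : ℝ) < n := by exact_mod_cast hn
    simp only [hS]
    rw [abs_mul, abs_of_pos (inv_pos.2 hn'), inv_mul_le_iff₀ hn']
    calc |∑ i ∈ Finset.range n, ξ j (Z i ω)| ≤ ∑ i ∈ Finset.range n, |ξ j (Z i ω)| :=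
          Finset.abs_sum_le_sum_abs _ _
      _ ≤ ∑ i ∈ Finset.range n, M := Finset.sum_le_sum fun i _ => abs_le_of_sum_abs_le (hξM _) j
      _ = n * M := by simp
  have hexpi : ∀ (c : ℝ) j, Integrable (fun ω => Real.exp (c * S j ω)) Pr := by
    intro c j
    refine Integrable.of_bound ((hSm j).const_mul c).exp.aestronglyMeasurable
      (Real.exp (|c| * M)) (ae_of_all _ fun ω => ?_)
    rw [Real.norm_of_nonneg (Real.exp_pos _).le]
    refine Real.exp_le_exp.2 ((le_abs_self _).trans ?_)
    rw [abs_mul]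
    exact mul_le_mul_of_nonneg_left (hSb j ω) (abs_nonneg _)
  have hcosh : ∀ j, ∫ ω, (Real.cosh (lam * S j ω) - 1) ∂Pr
      = ((∫ ω, Real.exp (lam * S j ω) ∂Pr - 1) + (∫ ω, Real.exp (-lam * S j ω) ∂Pr - 1)) / 2 := by
    intro j
    simp only [Real.cosh_eq, ← neg_mul]
    have hadd : Integrable (fun ω => (Real.exp (lam * S j ω) + Real.exp (-lam * S j ω)) / 2) Pr :=
      ((hexpi _ j).add (hexpi _ j)).div_const 2
    rw [integral_sub hadd (integrable_const _),
      integral_div, integral_add (hexpi _ j) (hexpi _ j)]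
    simp
    ring
  have hpow : ∀ j, lam ^ (2 * k) * ∫ ω, S j ω ^ (2 * k) ∂Pr
      ≤ (2 * k).factorial * ∫ ω, (Real.cosh (lam * S j ω) - 1) ∂Pr := by
    intro j
    rw [← integral_const_mul, ← integral_const_mul]
    refine integral_mono_of_nonneg (ae_of_all _ fun ω => ?_) ?_ (ae_of_all _ fun ω => ?_)
    · simp only [pow_mul]; positivity
    · simp only [Real.cosh_eq, ← neg_mul]
      exact ((((hexpi _ j).add (hexpi _ j)).div_const 2).sub (integrable_const _)).const_mul _
    · simp only [← mul_pow]
      exact pow_le_factorial_mul_cosh_sub_one _ hk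
  rw [Finset.mul_sum]
  refine (Finset.sum_le_sum fun j _ => hpow j).trans ?_
  rw [← Finset.mul_sum]
  refine mul_le_mul_of_nonneg_left ?_ (by positivity)
  simp only [hcosh]
  rw [← Finset.sum_div, Finset.sum_add_distrib]
  simp only [hlam, neg_mul] at h1 h2 ⊢
  linarith

end ExpMoment

/-! ### Polynomials and the local polynomial estimator -/

/-- The exponents of the monomials of degree at most `ℓ` in `d` variables. -/
abbrev Expo (d ℓ : ℕ) : Type := {s : Fin d →₀ ℕ // s.degree ≤ ℓ}

instance (d ℓ : ℕ) : Fintype (Expo d ℓ) := (Finsupp.finite_of_degree_le ℓ).fintype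

/-- The monomial with exponent `s`, as a function on `ℝ^d`. -/
def monom {d : ℕ} (s : Fin d →₀ ℕ) (u : Obs d) : ℝ :=
  MvPolynomial.eval (fun k => u k) (MvPolynomial.monomial s 1)

/-- The polynomial with coefficients `a` in the basis of the rescaled monomials
`v ↦ monom s (h⁻¹ • v)`. -/
def scaledPoly {d ℓ : ℕ} (h : ℝ) (a : Expo d ℓ → ℝ) : MvPolynomial (Fin d) ℝ :=
  ∑ s, MvPolynomial.monomial s.1 (a s * h⁻¹ ^ s.1.degree)

lemma monom_eq_prod {d : ℕ} (s : Fin d →₀ ℕ) (u : Obs d) : monom s u = ∏ k, u k ^ s k := by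
  simp [monom, MvPolynomial.eval_monomial, Finsupp.prod_fintype]

lemma monom_zero {d : ℕ} (s : Fin d →₀ ℕ) : monom s (0 : Obs d) = if s = 0 then 1 else 0 := by
  rw [monom_eq_prod]
  split_ifs with h
  · simp [h]
  · obtain ⟨k, hk⟩ := Finsupp.ne_iff.1 h
    exact Finset.prod_eq_zero (Finset.mem_univ k) (by simpa using hk)

lemma monom_smul {d : ℕ} (s : Fin d →₀ ℕ) (r : ℝ) (u : Obs d) :
    monom s (r • u) = r ^ s.degree * monom s u := by
  simp only [monom_eq_prod, PiLp.smul_apply, smul_eq_mul, mul_pow, Finset.prod_mul_distrib]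
  rw [Finset.prod_pow_eq_pow_sum, Finsupp.degree_eq_sum]

lemma abs_monom_le {d : ℕ} (s : Fin d →₀ ℕ) (u : Obs d) : |monom s u| ≤ ‖u‖ ^ s.degree := by
  rw [monom_eq_prod, Finset.abs_prod, Finsupp.degree_eq_sum, ← Finset.prod_pow_eq_pow_sum]
  refine Finset.prod_le_prod (fun _ _ => abs_nonneg _) fun k _ => ?_
  rw [abs_pow]
  exact pow_le_pow_left₀ (abs_nonneg _) (PiLp.norm_apply_le u k) _

lemma measurable_monom {d : ℕ} (s : Fin d →₀ ℕ) : Measurable (monom (d := d) s) := by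
  simp only [funext (monom_eq_prod s)]
  fun_prop

lemma continuous_monom {d : ℕ} (s : Fin d →₀ ℕ) : Continuous (monom (d := d) s) := by
  simp only [funext (monom_eq_prod s)]
  fun_prop

lemma eval_scaledPoly {d ℓ : ℕ} (h : ℝ) (a : Expo d ℓ → ℝ) (v : Obs d) :
    MvPolynomial.eval (fun k => v k) (scaledPoly h a) = ∑ s, a s * monom s.1 (h⁻¹ • v) := by
  simp only [scaledPoly, map_sum, monom_smul]
  refine Finset.sum_congr rfl fun s _ => ?_
  simp only [monom, MvPolynomial.eval_monomial]
  ring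

lemma totalDegree_scaledPoly_le {d ℓ : ℕ} (h : ℝ) (a : Expo d ℓ → ℝ) :
    (scaledPoly h a).totalDegree ≤ ℓ := by
  refine MvPolynomial.totalDegree_finsetSum_le fun s _ => ?_
  exact (MvPolynomial.totalDegree_monomial_le _ _).trans s.2

lemma exists_eq_scaledPoly {d ℓ : ℕ} {h : ℝ} (hh : h ≠ 0) {θ : MvPolynomial (Fin d) ℝ}
    (hθ : θ.totalDegree ≤ ℓ) : ∃ a : Expo d ℓ → ℝ, θ = scaledPoly h a := by
  classical
  refine ⟨fun s => θ.coeff s.1 * h ^ s.1.degree, ?_⟩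
  have h1 : ∀ s : Fin d →₀ ℕ, θ.coeff s * h ^ s.degree * h⁻¹ ^ s.degree = θ.coeff s := by
    intro s
    rw [mul_assoc, ← mul_pow, mul_inv_cancel₀ hh, one_pow, mul_one]
  simp only [scaledPoly, h1]
  ext t
  rw [MvPolynomial.coeff_sum]
  simp only [MvPolynomial.coeff_monomial]
  by_cases ht : t.degree ≤ ℓ
  · rw [Finset.sum_eq_single ⟨t, ht⟩]
    · simp
    · intro s _ hs
      exact if_neg fun e => hs (Subtype.ext e)
    · simp
  · rw [Finset.sum_eq_zero fun s _ => if_neg fun e : s.1 = t => ht (e ▸ s.2)]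
    by_contra hne
    exact ht ((MvPolynomial.le_totalDegree (MvPolynomial.mem_support_iff.2 hne)).trans hθ)

/-- A symmetric positive definite system of linear equations is solvable. -/
lemma exists_solution_of_posDef {ι : Type*} [Fintype ι] {B : ι → ι → ℝ} {κ : ℝ} (hκ : 0 < κ)
    (hB : ∀ a : ι → ℝ, κ * ∑ s, a s ^ 2 ≤ ∑ s, ∑ t, a s * a t * B s t) (A : ι → ℝ) :
    ∃ a : ι → ℝ, ∀ s, ∑ t, B s t * a t = A s := by
  let T : (ι → ℝ) →ₗ[ℝ] (ι → ℝ) := Matrix.mulVecLin (Matrix.of B)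
  have hT : ∀ a s, T a s = ∑ t, B s t * a t := fun a s => rfl
  have hinj : Function.Injective T := by
    rw [← LinearMap.ker_eq_bot, LinearMap.ker_eq_bot']
    intro a ha
    have h0 : ∑ s, ∑ t, a s * a t * B s t = 0 := by
      have : ∀ s, ∑ t, a s * a t * B s t = a s * T a s := fun s => by
        rw [hT, Finset.mul_sum]
        exact Finset.sum_congr rfl fun t _ => by ring
      simp [this, ha]
    have h1 := hB a
    rw [h0] at h1
    have h2 : ∑ s, a s ^ 2 = 0 :=
      le_antisymm (by nlinarith) (Finset.sum_nonneg fun _ _ => sq_nonneg _)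
    funext s
    have := (Finset.sum_eq_zero_iff_of_nonneg fun _ _ => sq_nonneg _).1 h2 s (Finset.mem_univ s)
    simpa using this
  obtain ⟨a, ha⟩ := LinearMap.injective_iff_surjective.1 hinj A
  exact ⟨a, fun s => by rw [← hT, ha]⟩

/-- If the (normalized) Gram matrix of the rescaled monomials is bounded below by `κ`, the weighted
least squares fit is unique, and its distance at the origin to any polynomial `θ₀` of degree at most
`ℓ` is controlled by the weighted residuals of `θ₀`, through the normal equations. -/
lemma abs_lpEstimator_sub_le {d n ℓ : ℕ} {K : Obs d → ℝ} {h : ℝ} (hh : h ≠ 0) {X : Fin n → Obs d}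
    {y : Fin n → ℝ} {x : Obs d} {c κ : ℝ} (hc : 0 < c) (hκ : 0 < κ)
    (hB : ∀ a : Expo d ℓ → ℝ, κ * ∑ s, a s ^ 2 ≤ ∑ s, ∑ t, a s * a t *
      (c * ∑ i, K (h⁻¹ • (X i - x)) *
        (monom s.1 (h⁻¹ • (X i - x)) * monom t.1 (h⁻¹ • (X i - x)))))
    {θ₀ : MvPolynomial (Fin d) ℝ} (hθ₀ : θ₀.totalDegree ≤ ℓ) :
    |lpEstimator ℓ K h X y x - MvPolynomial.eval (fun _ => 0) θ₀| ≤
      κ⁻¹ * ∑ s : Expo d ℓ, |c * ∑ i, K (h⁻¹ • (X i - x)) * (monom s.1 (h⁻¹ • (X i - x)) *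
        (y i - MvPolynomial.eval (fun k => (X i - x) k) θ₀))| := by
  set w : Fin n → ℝ := fun i => K (h⁻¹ • (X i - x)) with hw
  set U : Expo d ℓ → Fin n → ℝ := fun s i => monom s.1 (h⁻¹ • (X i - x)) with hU
  set B : Expo d ℓ → Expo d ℓ → ℝ := fun s t => c * ∑ i, w i * (U s i * U t i) with hBdef
  set R : Fin n → ℝ := fun i => y i - MvPolynomial.eval (fun k => (X i - x) k) θ₀ with hR
  set A : Expo d ℓ → ℝ := fun s => c * ∑ i, w i * (U s i * R i) with hA
  change |_| ≤ κ⁻¹ * ∑ s, |A s|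
  obtain ⟨a, ha⟩ := exists_solution_of_posDef (B := B) hκ hB A
  set θ : MvPolynomial (Fin d) ℝ := θ₀ + scaledPoly h a with hθ
  have hθdeg : θ.totalDegree ≤ ℓ :=
    (MvPolynomial.totalDegree_add _ _).trans (max_le hθ₀ (totalDegree_scaledPoly_le h a))
  have hquad : ∀ b : Expo d ℓ → ℝ, ∑ s, ∑ t, b s * b t * B s t
      = c * ∑ i, w i * (∑ s, b s * U s i) ^ 2 := by
    intro b
    simp only [hBdef, Finset.mul_sum, sq, Finset.sum_mul]
    rw [Finset.sum_comm, Finset.sum_congr rfl fun t _ => Finset.sum_comm, Finset.sum_comm]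
    refine Finset.sum_congr rfl fun i _ => Finset.sum_congr rfl fun s _ =>
      Finset.sum_congr rfl fun t _ => by ring
  -- the normal equations say that the residuals are orthogonal to all polynomials
  have horth : ∀ b : Expo d ℓ → ℝ,
      ∑ i, w i * ((R i - ∑ t, a t * U t i) * ∑ s, b s * U s i) = 0 := by
    intro b
    have h1 : ∀ s, ∑ i, w i * (U s i * (R i - ∑ t, a t * U t i)) = 0 := by
      intro s
      have h2 := ha s
      simp only [hBdef, hA] at h2
      have h3 : c * ∑ i, w i * (U s i * (R i - ∑ t, a t * U t i)) = 0 := by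
        have : ∑ i, w i * (U s i * ∑ t, a t * U t i) = ∑ t, (∑ i, w i * (U s i * U t i)) * a t := by
          simp only [Finset.mul_sum, Finset.sum_mul]
          rw [Finset.sum_comm]
          exact Finset.sum_congr rfl fun _ _ => Finset.sum_congr rfl fun _ _ => by ring
        simp only [mul_sub, Finset.sum_sub_distrib]
        rw [this, ← h2, Finset.mul_sum, sub_eq_zero]
        exact Finset.sum_congr rfl fun _ _ => by ring
      exact (mul_eq_zero.1 h3).resolve_left hc.ne'
    have h4 : ∑ i, w i * ((R i - ∑ t, a t * U t i) * ∑ s, b s * U s i)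
        = ∑ s, b s * ∑ i, w i * (U s i * (R i - ∑ t, a t * U t i)) := by
      simp only [Finset.mul_sum]
      rw [Finset.sum_comm]
      exact Finset.sum_congr rfl fun _ _ => Finset.sum_congr rfl fun _ _ => by ring
    rw [h4]
    simp [h1]
  have hcrit : ∀ b : Expo d ℓ → ℝ, lpCriterion K h X y x (θ + scaledPoly h b)
      = lpCriterion K h X y x θ + ∑ i, w i * (∑ s, b s * U s i) ^ 2 := by
    intro b
    have h1 : lpCriterion K h X y x (θ + scaledPoly h b) = lpCriterion K h X y x θ
        - 2 * ∑ i, w i * ((R i - ∑ t, a t * U t i) * ∑ s, b s * U s i)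
        + ∑ i, w i * (∑ s, b s * U s i) ^ 2 := by
      simp only [lpCriterion, hθ, map_add, eval_scaledPoly]
      rw [Finset.mul_sum, ← Finset.sum_sub_distrib, ← Finset.sum_add_distrib]
      refine Finset.sum_congr rfl fun i _ => ?_
      simp only [hR, hw, hU]
      ring
    rw [h1, horth]
    ring
  have hsq : ∀ b : Expo d ℓ → ℝ,
      κ * ∑ s, b s ^ 2 ≤ c * ∑ i, w i * (∑ s, b s * U s i) ^ 2 := fun b =>
    (hB b).trans_eq (hquad b)
  have hsq0 : ∀ b : Expo d ℓ → ℝ, 0 ≤ ∑ s, b s ^ 2 := fun b =>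
    Finset.sum_nonneg fun _ _ => sq_nonneg _
  have hfit : IsLPFit ℓ K h X y x θ := by
    refine ⟨hθdeg, fun θ' hθ' => ?_⟩
    obtain ⟨b, hb⟩ := exists_eq_scaledPoly hh
      ((MvPolynomial.totalDegree_sub θ' θ).trans (max_le hθ' hθdeg))
    rw [show θ' = θ + scaledPoly h b by rw [← hb]; ring, hcrit]
    have h1 : 0 ≤ c * ∑ i, w i * (∑ s, b s * U s i) ^ 2 :=
      (mul_nonneg hκ.le (hsq0 b)).trans (hsq b)
    have := nonneg_of_mul_nonneg_right h1 hc
    linarith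
  have hex : ∃! θ' : MvPolynomial (Fin d) ℝ, IsLPFit ℓ K h X y x θ' := by
    refine ⟨θ, hfit, fun θ' hθ' => ?_⟩
    obtain ⟨b, hb⟩ := exists_eq_scaledPoly hh
      ((MvPolynomial.totalDegree_sub θ' θ).trans (max_le hθ'.1 hθdeg))
    have e : θ' = θ + scaledPoly h b := by rw [← hb]; ring
    have h1 := hθ'.2 θ hθdeg
    rw [e, hcrit] at h1
    have h2 : ∑ s, b s ^ 2 = 0 := by
      refine le_antisymm ?_ (hsq0 b)
      have := hsq b
      nlinarith
    have h3 : b = 0 := by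
      funext s
      have := (Finset.sum_eq_zero_iff_of_nonneg fun _ _ => sq_nonneg _).1 h2 s (Finset.mem_univ s)
      simpa using this
    rw [e, h3]
    simp [scaledPoly]
  have hval : lpEstimator ℓ K h X y x = MvPolynomial.eval (fun _ => 0) θ := by
    rw [lpEstimator, dif_pos hex, hex.unique hex.choose_spec.1 hfit]
  let s₀ : Expo d ℓ := ⟨0, by simp⟩
  have hval' : MvPolynomial.eval (fun _ => 0) θ = MvPolynomial.eval (fun _ => 0) θ₀ + a s₀ := by
    have h0 := eval_scaledPoly h a (0 : Obs d)
    simp only [PiLp.zero_apply, smul_zero, monom_zero] at h0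
    rw [hθ, map_add, h0, Finset.sum_eq_single s₀]
    · simp [s₀]
    · intro s _ hs
      rw [if_neg fun e => hs (Subtype.ext e), mul_zero]
    · simp
  rw [hval, hval', add_sub_cancel_left]
  obtain ⟨s₁, -, hs₁⟩ :=
    Finset.exists_max_image Finset.univ (fun s => |a s|) ⟨s₀, Finset.mem_univ _⟩
  have h1 : κ * |a s₁| ^ 2 ≤ |a s₁| * ∑ s, |A s| := by
    calc κ * |a s₁| ^ 2 ≤ κ * ∑ s, a s ^ 2 := by
          rw [sq_abs]
          exact mul_le_mul_of_nonneg_left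
            (Finset.single_le_sum (f := fun s => a s ^ 2) (fun _ _ => sq_nonneg _)
              (Finset.mem_univ s₁)) hκ.le
      _ ≤ ∑ s, ∑ t, a s * a t * B s t := hB a
      _ = ∑ s, a s * A s := by
          refine Finset.sum_congr rfl fun s _ => ?_
          rw [← ha s, Finset.mul_sum]
          exact Finset.sum_congr rfl fun t _ => by ring
      _ ≤ ∑ s, |a s₁| * |A s| := Finset.sum_le_sum fun s _ =>
          (le_abs_self _).trans (by
            rw [abs_mul]
            exact mul_le_mul_of_nonneg_right (hs₁ s (Finset.mem_univ s)) (abs_nonneg _))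
      _ = |a s₁| * ∑ s, |A s| := by rw [Finset.mul_sum]
  have h2 : |a s₁| ≤ κ⁻¹ * ∑ s, |A s| := by
    rw [le_inv_mul_iff₀ hκ]
    rcases (abs_nonneg (a s₁)).eq_or_lt with h0 | h0
    · rw [← h0, mul_zero]; exact Finset.sum_nonneg fun _ _ => abs_nonneg _
    · exact le_of_mul_le_mul_left (by linarith) h0
  exact (hs₁ s₀ (Finset.mem_univ _)).trans h2

/-- The Taylor polynomial at `x` is a polynomial of degree at most `ℓ` in the increment. -/
lemma exists_polynomial_eval_eq_taylorPoly {d : ℕ} (ℓ : ℕ) (g : Obs d → ℝ) (x : Obs d) :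
    ∃ θ : MvPolynomial (Fin d) ℝ, θ.totalDegree ≤ ℓ ∧
      ∀ v : Obs d, MvPolynomial.eval (fun k => v k) θ = taylorPoly ℓ g x (x + v) := by
  classical
  let e : Fin d → Obs d := fun k => EuclideanSpace.single k 1
  refine ⟨∑ k ∈ Finset.range (ℓ + 1), ∑ r : Fin k → Fin d,
    MvPolynomial.C ((k.factorial : ℝ)⁻¹ * iteratedFDeriv ℝ k g x fun i => e (r i)) *
      ∏ i, MvPolynomial.X (r i), ?_, fun v => ?_⟩
  · refine MvPolynomial.totalDegree_finsetSum_le fun k hk => MvPolynomial.totalDegree_finsetSum_le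
      fun r _ => (MvPolynomial.totalDegree_mul _ _).trans ?_
    rw [MvPolynomial.totalDegree_C, zero_add]
    refine (MvPolynomial.totalDegree_finsetProd _ _).trans ?_
    simp only [MvPolynomial.totalDegree_X, Finset.sum_const, Finset.card_univ, Fintype.card_fin,
      smul_eq_mul, mul_one]
    exact Nat.lt_succ_iff.1 (Finset.mem_range.1 hk)
  · simp only [taylorPoly, map_sum, map_mul, map_prod, MvPolynomial.eval_C, MvPolynomial.eval_X,
      add_sub_cancel_left]
    refine Finset.sum_congr rfl fun k _ => ?_
    have hv : v = ∑ j, v j • e j := by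
      ext i
      simp [e, Pi.single_apply]
    conv_rhs => rw [hv]
    rw [ContinuousMultilinearMap.map_sum (iteratedFDeriv ℝ k g x) (fun _ j => v j • e j),
      Finset.mul_sum]
    refine Finset.sum_congr rfl fun r _ => ?_
    rw [ContinuousMultilinearMap.map_smul_univ, smul_eq_mul]
    ring

lemma taylorPoly_self {d : ℕ} (ℓ : ℕ) (g : Obs d → ℝ) (x : Obs d) : taylorPoly ℓ g x x = g x := by
  rw [taylorPoly, Finset.sum_range_succ', Finset.sum_eq_zero]
  · simp
  · intro k _
    rw [ContinuousMultilinearMap.map_coord_zero _ (0 : Fin (k + 1)) (by simp), mul_zero]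

/-! ### Small values of polynomials -/

/-- The zero set `Z` of a nonzero polynomial is null. By Fubini, almost all of the homothetic copies
of `Z` with a fixed center off `Z` are null, since a line through the center meets `Z` in finitely
many points only. -/
lemma volume_zeroSet_eq_zero {d : ℕ} {θ : MvPolynomial (Fin d) ℝ} (hθ : θ ≠ 0) :
    volume {u : Obs d | MvPolynomial.eval (fun k => u k) θ = 0} = 0 := by
  obtain ⟨y, hy⟩ : ∃ y : Fin d → ℝ, MvPolynomial.eval y θ ≠ 0 := by
    by_contra! h
    exact hθ (MvPolynomial.funext fun y => by simpa using h y)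
  set E : Set (ℝ × Obs d) :=
    {q | MvPolynomial.eval (fun k => y k + q.1 * (q.2 k - y k)) θ = 0} with hE
  have hEm : MeasurableSet E := by
    refine (isClosed_eq ?_ continuous_const).measurableSet
    exact (MvPolynomial.continuous_eval θ).comp (by fun_prop)
  have hline : ∀ u : Obs d, volume ((fun r => (r, u)) ⁻¹' E) = 0 := by
    intro u
    let q : Polynomial ℝ := MvPolynomial.eval₂ Polynomial.C
      (fun k => Polynomial.C (y k) + Polynomial.X * Polynomial.C (u k - y k)) θ
    have hq : ∀ r, q.eval r = MvPolynomial.eval (fun k => y k + r * (u k - y k)) θ := by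
      intro r
      have := MvPolynomial.eval₂_comp_left (Polynomial.evalRingHom r) Polynomial.C
        (fun k => Polynomial.C (y k) + Polynomial.X * Polynomial.C (u k - y k)) θ
      simp only [Polynomial.coe_evalRingHom] at this
      rw [show q.eval r = _ from this, MvPolynomial.eval]
      simp only [MvPolynomial.coe_eval₂Hom]
      congr 1
      · ext; simp
      · ext k; simp
    have hq0 : q ≠ 0 := by
      intro h0
      have := hq 0
      simp only [h0, Polynomial.eval_zero, zero_mul, add_zero] at this
      exact hy this.symm
    have hfin : ((fun r => (r, u)) ⁻¹' E).Finite := by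
      refine (Polynomial.finite_setOfPred_isRoot hq0).subset fun r hr => ?_
      exact (hq r).trans hr
    exact hfin.measure_zero _
  have hprod : ((volume : Measure ℝ).prod (volume : Measure (Obs d))) E = 0 := by
    rw [Measure.prod_apply_symm hEm]
    simp [hline]
  have hae := Measure.measure_ae_null_of_prod_null hprod
  have hne : ∀ᵐ r : ℝ, r ≠ 0 := by simp [ae_iff]
  obtain ⟨r, hr, hr0⟩ := (hae.and hne).exists
  set Z : Set (Obs d) := {u | MvPolynomial.eval (fun k => u k) θ = 0} with hZ
  let y' : Obs d := WithLp.toLp 2 y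
  have hset : Prod.mk r ⁻¹' E = (fun u : Obs d => r • u) ⁻¹'
      ((fun w : Obs d => w + (y' - r • y')) ⁻¹' Z) := by
    ext u
    simp only [hE, hZ, Set.mem_preimage, Set.mem_ofPred_eq]
    have : (fun k => y k + r * (u k - y k)) = fun k => (r • u + (y' - r • y')) k := by
      ext k
      simp [y']
      ring
    rw [this]
  simp only [Pi.zero_apply] at hr
  rw [hset, Measure.addHaar_preimage_smul _ hr0, measure_preimage_add_right] at hr
  refine (mul_eq_zero.1 hr).resolve_left ?_
  simp only [ne_eq, ENNReal.ofReal_eq_zero, not_le, abs_pos]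
  exact inv_ne_zero (pow_ne_zero _ hr0)

/-- The polynomial with coefficients `a`, as a function. -/
def polyFun {d ℓ : ℕ} (a : Expo d ℓ → ℝ) (u : Obs d) : ℝ := ∑ s, a s * monom s.1 u

lemma continuous_polyFun {d ℓ : ℕ} (a : Expo d ℓ → ℝ) : Continuous (polyFun a) :=
  continuous_finsetSum _ fun s _ => continuous_const.mul (continuous_monom s.1)

lemma volume_polyFun_eq_zero {d ℓ : ℕ} {a : Expo d ℓ → ℝ} (ha : a ≠ 0) :
    volume {u : Obs d | polyFun a u = 0} = 0 := by
  have h1 : ∀ u : Obs d, MvPolynomial.eval (fun k => u k) (scaledPoly 1 a) = polyFun a u :=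
    fun u => by simp [eval_scaledPoly, polyFun]
  have h2 : scaledPoly 1 a ≠ 0 := by
    obtain ⟨s, hs⟩ := Function.ne_iff.1 ha
    intro h0
    refine hs ?_
    have := congrArg (MvPolynomial.coeff s.1) h0
    classical
    simp only [scaledPoly, inv_one, one_pow, mul_one, MvPolynomial.coeff_sum,
      MvPolynomial.coeff_monomial, MvPolynomial.coeff_zero] at this
    rwa [Finset.sum_eq_single s (fun t _ ht => if_neg fun e => ht (Subtype.ext e)) (by simp),
      if_pos rfl] at this
  simpa only [h1] using volume_zeroSet_eq_zero h2

lemma abs_polyFun_sub_le {d ℓ : ℕ} {c : ℝ} (a b : Expo d ℓ → ℝ) {u : Obs d}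
    (hu : ‖u‖ ≤ c) :
    |polyFun a u - polyFun b u| ≤ dist a b * (Fintype.card (Expo d ℓ) * (1 + c) ^ ℓ) := by
  have hc : 0 ≤ c := (norm_nonneg _).trans hu
  have h1 : polyFun a u - polyFun b u = ∑ s, (a s - b s) * monom s.1 u := by
    simp only [polyFun, ← Finset.sum_sub_distrib, sub_mul]
  rw [h1]
  refine (Finset.abs_sum_le_sum_abs _ _).trans ?_
  calc ∑ s, |(a s - b s) * monom s.1 u| ≤ ∑ s : Expo d ℓ, dist a b * (1 + c) ^ ℓ := by
        refine Finset.sum_le_sum fun s _ => ?_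
        rw [abs_mul]
        refine mul_le_mul ?_ ?_ (abs_nonneg _) dist_nonneg
        · rw [← Real.dist_eq]; exact dist_le_pi_dist a b s
        · refine (abs_monom_le _ _).trans ?_
          calc ‖u‖ ^ s.1.degree ≤ (1 + c) ^ s.1.degree :=
                pow_le_pow_left₀ (norm_nonneg _) (by linarith) _
            _ ≤ (1 + c) ^ ℓ := pow_le_pow_right₀ (by linarith) s.2
    _ = _ := by rw [Finset.sum_const, Finset.card_univ, nsmul_eq_mul]; ring

/-- Normalized polynomials are uniformly not small on a ball, up to a set of small measure. -/
lemma exists_volume_abs_polyFun_le {d ℓ : ℕ} (c : ℝ) {τ : ENNReal} (hτ : 0 < τ) :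
    ∃ δ : ℝ, 0 < δ ∧ ∀ a : Expo d ℓ → ℝ, ∑ s, a s ^ 2 = 1 →
      volume {u : Obs d | ‖u‖ ≤ c ∧ |polyFun a u| ≤ δ} ≤ τ := by
  set Sph : Set (Expo d ℓ → ℝ) := {a | ∑ s, a s ^ 2 = 1} with hSph
  have hcomp : IsCompact Sph := by
    refine Metric.isCompact_of_isClosed_isBounded
      (isClosed_eq (by fun_prop) continuous_const) ?_
    refine (Metric.isBounded_closedBall (x := (0 : Expo d ℓ → ℝ)) (r := 1)).subset fun a ha => ?_
    rw [mem_closedBall_zero_iff, pi_norm_le_iff_of_nonneg zero_le_one]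
    intro s
    have h1 : a s ^ 2 ≤ 1 := by
      rw [← show ∑ s, a s ^ 2 = 1 from ha]
      exact Finset.single_le_sum (f := fun s => a s ^ 2) (fun _ _ => sq_nonneg _)
        (Finset.mem_univ s)
    rw [Real.norm_eq_abs]
    exact (sq_le_one_iff_abs_le_one _).1 h1
  suffices h : ∃ δ : ℝ, 0 < δ ∧ ∀ a ∈ Sph,
      volume {u : Obs d | ‖u‖ ≤ c ∧ |polyFun a u| ≤ δ} ≤ τ from h
  refine hcomp.induction_on (p := fun U => ∃ δ : ℝ, 0 < δ ∧ ∀ a ∈ U,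
      volume {u : Obs d | ‖u‖ ≤ c ∧ |polyFun a u| ≤ δ} ≤ τ) ⟨1, one_pos, by simp⟩ ?_ ?_ ?_
  · rintro s t hst ⟨δ, hδ, h⟩
    exact ⟨δ, hδ, fun a ha => h a (hst ha)⟩
  · rintro s t ⟨δ, hδ, h⟩ ⟨δ', hδ', h'⟩
    refine ⟨min δ δ', lt_min hδ hδ', fun a ha => ?_⟩
    rcases ha with ha | ha
    · refine le_trans (measure_mono ?_) (h a ha)
      exact fun u hu => ⟨hu.1, hu.2.trans (min_le_left _ _)⟩
    · refine le_trans (measure_mono ?_) (h' a ha)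
      exact fun u hu => ⟨hu.1, hu.2.trans (min_le_right _ _)⟩
  · intro a₀ ha₀
    have ha₀' : a₀ ≠ 0 := by
      rintro rfl
      simp [hSph] at ha₀
    set D : ℕ → Set (Obs d) := fun k => {u | ‖u‖ ≤ c ∧ |polyFun a₀ u| ≤ 1 / ((k : ℝ) + 1)} with hD
    have hDm : ∀ k, MeasurableSet (D k) := fun k =>
      ((isClosed_le continuous_norm continuous_const).inter
        (isClosed_le (continuous_polyFun a₀).abs continuous_const)).measurableSet
    have hanti : Antitone D := fun k k' hk u hu =>
      ⟨hu.1, hu.2.trans (one_div_le_one_div_of_le (by positivity) (by gcongr))⟩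
    have hfin : volume (D 0) ≠ ⊤ := by
      refine ne_top_of_le_ne_top (measure_closedBall_lt_top (x := (0 : Obs d)) (r := c)).ne
        (measure_mono fun u hu => ?_)
      simpa using hu.1
    have hinter : volume (⋂ k, D k) = 0 := by
      refine measure_mono_null (fun u hu => ?_) (volume_polyFun_eq_zero ha₀')
      have h1 : ∀ k : ℕ, |polyFun a₀ u| ≤ 1 / ((k : ℝ) + 1) := fun k =>
        (Set.mem_iInter.1 hu k).2
      have h2 := ge_of_tendsto' tendsto_one_div_add_atTop_nhds_zero_nat h1
      exact abs_eq_zero.1 (le_antisymm h2 (abs_nonneg _))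
    have hlim := tendsto_measure_iInter_atTop (μ := volume)
      (fun k => (hDm k).nullMeasurableSet) hanti ⟨0, hfin⟩
    rw [hinter] at hlim
    obtain ⟨k, hk⟩ := (hlim.eventually (gt_mem_nhds hτ)).exists
    set q : ℝ := 1 / ((k : ℝ) + 1) with hq
    have hq0 : 0 < q := by positivity
    set H : ℝ := Fintype.card (Expo d ℓ) * (1 + |c|) ^ ℓ with hH
    have hH0 : 0 ≤ H := by positivity
    refine ⟨Metric.ball a₀ (q / 2 / (H + 1)), mem_nhdsWithin_of_mem_nhds
      (Metric.ball_mem_nhds _ (by positivity)), q / 2, by positivity, fun a ha => ?_⟩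
    refine (measure_mono fun u hu => ?_).trans hk.le
    refine ⟨hu.1, ?_⟩
    have h1 := abs_polyFun_sub_le a₀ a (hu.1.trans (le_abs_self c))
    have h2 : dist a₀ a * H ≤ q / 2 := by
      rw [dist_comm]
      have h3 : dist a a₀ * (H + 1) ≤ q / 2 := by
        rw [← le_div_iff₀ (by positivity)]
        exact (Metric.mem_ball.1 ha).le
      nlinarith [dist_nonneg (x := a) (y := a₀)]
    have h4 := abs_sub_abs_le_abs_sub (polyFun a₀ u) (polyFun a u)
    have h5 := hu.2
    have h6 : |polyFun a₀ u| ≤ q := by linarith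
    exact h6

/-! ### Localization by the kernel -/

/-- Passage to the local coordinate `u = h⁻¹ (x' - x)` multiplies Lebesgue measure by `h^d`. -/
lemma map_localize_volume {d : ℕ} {h : ℝ} (hh : 0 < h) (x : Obs d) :
    (volume : Measure (Obs d)).map (fun x' => h⁻¹ • (x' - x))
      = ENNReal.ofReal (h ^ d) • volume := by
  ext s hs
  rw [Measure.map_apply (by fun_prop) hs, Measure.smul_apply]
  have e : (fun x' : Obs d => h⁻¹ • (x' - x)) ⁻¹' s
      = (fun w => w + -x) ⁻¹' ((fun w => h⁻¹ • w) ⁻¹' s) := by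
    ext; simp [sub_eq_add_neg]
  rw [e, measure_preimage_add_right, Measure.addHaar_preimage_smul _ (inv_ne_zero hh.ne'),
    smul_eq_mul]
  simp [abs_of_pos hh]

lemma map_localize_le {d : ℕ} {h : ℝ} (hh : 0 < h) (x : Obs d) {μ : Obs d → ℝ} {b : ℝ}
    (hμb : ∀ x, μ x ≤ b) :
    (volume.withDensity fun x => ENNReal.ofReal (μ x)).map (fun x' => h⁻¹ • (x' - x))
      ≤ ENNReal.ofReal (b * h ^ d) • (volume : Measure (Obs d)) := by
  have h1 : (volume.withDensity fun x => ENNReal.ofReal (μ x))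
      ≤ ENNReal.ofReal b • (volume : Measure (Obs d)) := by
    rw [← withDensity_const]
    exact withDensity_mono (ae_of_all _ fun x => ENNReal.ofReal_le_ofReal (hμb x))
  refine (Measure.map_mono h1 (by fun_prop)).trans (le_of_eq ?_)
  rw [Measure.map_smul, map_localize_volume hh, smul_smul,
    ENNReal.ofReal_mul' (by positivity)]

/-- Integrals of functions of the local coordinate against a law with bounded density. -/
lemma integral_localize_le {d : ℕ} {h : ℝ} (hh : 0 < h) (x : Obs d) {Q : Measure (Obs d)}
    {μ : Obs d → ℝ} {b : ℝ} (hb : 0 ≤ b)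
    (hQ : Q = volume.withDensity fun x => ENNReal.ofReal (μ x)) (hμb : ∀ x, μ x ≤ b)
    {F : Obs d → ℝ} (hF0 : ∀ u, 0 ≤ F u) (hF : Integrable F) :
    Integrable (fun x' => F (h⁻¹ • (x' - x))) Q ∧
      ∫ x', F (h⁻¹ • (x' - x)) ∂Q ≤ b * h ^ d * ∫ u, F u := by
  have hle : Q.map (fun x' => h⁻¹ • (x' - x)) ≤ ENNReal.ofReal (b * h ^ d) • volume :=
    hQ ▸ map_localize_le hh x hμb
  have hF' : Integrable F (ENNReal.ofReal (b * h ^ d) • (volume : Measure (Obs d))) :=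
    hF.smul_measure ENNReal.ofReal_ne_top
  have hi : Integrable F (Q.map fun x' => h⁻¹ • (x' - x)) := hF'.mono_measure hle
  have hm : Measurable fun x' : Obs d => h⁻¹ • (x' - x) := by fun_prop
  refine ⟨hi.comp_measurable hm, ?_⟩
  rw [← integral_map hm.aemeasurable hi.aestronglyMeasurable]
  refine (integral_mono_measure hle (ae_of_all _ hF0) hF').trans (le_of_eq ?_)
  rw [integral_smul_measure, ENNReal.toReal_ofReal (by positivity), smul_eq_mul]

/-- The expected Gram matrix of the rescaled monomials is bounded below, uniformly over the points
of all regular sets: a regular set fills a fixed proportion of the ball of radius `c h`, while a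
normalized polynomial is small only on a smaller part of it. -/
lemma exists_gram_lower_bound {d : ℕ} (ℓ : ℕ) {c c₀ r₀ μmin : ℝ} (hc : 0 < c) (hc₀ : 0 < c₀)
    (hμmin : 0 < μmin) :
    ∃ κ : ℝ, 0 < κ ∧ ∀ (K : Obs d → ℝ), (∀ u, 0 ≤ K u) → (∀ u, ‖u‖ ≤ c → c ≤ K u) →
      ∀ (A : Set (Obs d)) (μ : Obs d → ℝ) (Q : Measure (Obs d)),
      IsCompact A → IsRegularSet c₀ r₀ A → (∀ x ∈ A, μmin ≤ μ x) →
      Q = volume.withDensity (fun x => ENNReal.ofReal (μ x)) → IsFiniteMeasure Q →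
      ∀ x ∈ A, ∀ h : ℝ, 0 < h → h * c ≤ r₀ → ∀ a : Expo d ℓ → ℝ,
      Integrable (fun x' => K (h⁻¹ • (x' - x)) * polyFun a (h⁻¹ • (x' - x)) ^ 2) Q →
      κ * h ^ d * ∑ s, a s ^ 2 ≤
        ∫ x', K (h⁻¹ • (x' - x)) * polyFun a (h⁻¹ • (x' - x)) ^ 2 ∂Q := by
  set v : ENNReal := volume (Metric.closedBall (0 : Obs d) c) with hv
  have hv0 : 0 < v := Metric.measure_closedBall_pos _ _ hc
  have hvt : v ≠ ⊤ := measure_closedBall_lt_top.ne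
  have hvr : 0 < v.toReal := ENNReal.toReal_pos hv0.ne' hvt
  obtain ⟨δ, hδ, hδv⟩ := exists_volume_abs_polyFun_le (d := d) (ℓ := ℓ) c
    (τ := ENNReal.ofReal (c₀ * v.toReal / 2)) (by rw [ENNReal.ofReal_pos]; positivity)
  refine ⟨c * δ ^ 2 * (μmin * (c₀ * v.toReal / 2)), by positivity, ?_⟩
  intro K hK0 hKc A μ Q hA hreg hμ hQ hQfin x hx h hh hhc a hint
  set τ : Obs d → Obs d := fun x' => h⁻¹ • (x' - x) with hτ
  have hτm : Measurable τ := by fun_prop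
  -- the case of normalized coefficients
  have main : ∀ b : Expo d ℓ → ℝ, ∑ s, b s ^ 2 = 1 →
      Integrable (fun x' => K (τ x') * polyFun b (τ x') ^ 2) Q →
      c * δ ^ 2 * (μmin * (c₀ * v.toReal / 2)) * h ^ d ≤
        ∫ x', K (τ x') * polyFun b (τ x') ^ 2 ∂Q := by
    intro b hb hib
    set bad : Set (Obs d) := {u | ‖u‖ ≤ c ∧ |polyFun b u| ≤ δ} with hbad
    have hbadm : MeasurableSet bad := ((isClosed_le continuous_norm continuous_const).inter
        (isClosed_le (continuous_polyFun b).abs continuous_const)).measurableSet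
    set D : Set (Obs d) := (A ∩ Metric.closedBall x (h * c)) \ τ ⁻¹' bad with hD
    have hDm : MeasurableSet D :=
      (hA.measurableSet.inter Metric.isClosed_closedBall.measurableSet).diff (hτm hbadm)
    have hvolbad : volume (τ ⁻¹' bad) ≤ ENNReal.ofReal (h ^ d * (c₀ * v.toReal / 2)) := by
      rw [← Measure.map_apply hτm hbadm, map_localize_volume hh, Measure.smul_apply, smul_eq_mul,
        ENNReal.ofReal_mul (by positivity)]
      exact mul_le_mul_right (hδv b hb) _
    have hvolA : ENNReal.ofReal (h ^ d * (c₀ * v.toReal))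
        ≤ volume (A ∩ Metric.closedBall x (h * c)) := by
      refine le_trans (le_of_eq ?_) (hreg x hx (h * c) (by positivity) hhc)
      rw [Measure.addHaar_closedBall_mul_of_pos _ _ hh, ← hv]
      have : v = ENNReal.ofReal v.toReal := (ENNReal.ofReal_toReal hvt).symm
      conv_rhs => rw [this]
      simp only [finrank_euclideanSpace, Fintype.card_fin]
      rw [← ENNReal.ofReal_mul (by positivity), ← ENNReal.ofReal_mul hc₀.le]
      congr 1; ring
    have hvolD : ENNReal.ofReal (h ^ d * (c₀ * v.toReal / 2)) ≤ volume D := by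
      refine le_trans ?_ le_measure_sdiff
      refine le_trans ?_ (tsub_le_tsub hvolA hvolbad)
      rw [← ENNReal.ofReal_sub _ (by positivity)]
      exact ENNReal.ofReal_le_ofReal (by linarith)
    have hQD : ENNReal.ofReal (μmin * (h ^ d * (c₀ * v.toReal / 2))) ≤ Q D := by
      rw [hQ, withDensity_apply _ hDm, ENNReal.ofReal_mul hμmin.le]
      refine (mul_le_mul_right hvolD _).trans ?_
      rw [← setLIntegral_const]
      exact setLIntegral_mono' hDm fun x' hx' => ENNReal.ofReal_le_ofReal (hμ x' hx'.1.1)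
    have hQDr : μmin * (h ^ d * (c₀ * v.toReal / 2)) ≤ Q.real D :=
      (ENNReal.ofReal_le_iff_le_toReal (measure_ne_top Q D)).1 hQD
    have hDlow : ∀ x' ∈ D, c * δ ^ 2 ≤ K (τ x') * polyFun b (τ x') ^ 2 := by
      intro x' hx'
      have h1 : ‖τ x'‖ ≤ c := by
        have := Metric.mem_closedBall.1 hx'.1.2
        rw [dist_eq_norm] at this
        rw [hτ]
        simp only [norm_smul, norm_inv, Real.norm_of_nonneg hh.le]
        rwa [inv_mul_le_iff₀ hh]
      have h2 : δ < |polyFun b (τ x')| := by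
        by_contra! h3
        exact hx'.2 ⟨h1, h3⟩
      have h3 : δ ^ 2 ≤ polyFun b (τ x') ^ 2 := by
        rw [← sq_abs (polyFun b (τ x'))]
        exact pow_le_pow_left₀ hδ.le h2.le 2
      exact mul_le_mul (hKc _ h1) h3 (by positivity) (hK0 _)
    calc c * δ ^ 2 * (μmin * (c₀ * v.toReal / 2)) * h ^ d
        = c * δ ^ 2 * (μmin * (h ^ d * (c₀ * v.toReal / 2))) := by ring
      _ ≤ c * δ ^ 2 * Q.real D := mul_le_mul_of_nonneg_left hQDr (by positivity)
      _ = ∫ _ in D, c * δ ^ 2 ∂Q := by rw [setIntegral_const, smul_eq_mul, mul_comm]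
      _ ≤ ∫ x' in D, K (τ x') * polyFun b (τ x') ^ 2 ∂Q :=
          setIntegral_mono_on (integrable_const _).integrableOn hib.integrableOn hDm hDlow
      _ ≤ ∫ x', K (τ x') * polyFun b (τ x') ^ 2 ∂Q :=
          setIntegral_le_integral hib (ae_of_all _ fun x' => mul_nonneg (hK0 _) (sq_nonneg _))
  rcases (Finset.sum_nonneg fun s _ => sq_nonneg (a s) :
      (0 : ℝ) ≤ ∑ s, a s ^ 2).eq_or_lt with h0 | h0
  · rw [← h0, mul_zero]
    exact integral_nonneg fun x' => mul_nonneg (hK0 _) (sq_nonneg _)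
  · set q : ℝ := ∑ s, a s ^ 2 with hq
    set b : Expo d ℓ → ℝ := fun s => (√q)⁻¹ * a s with hb
    have hsq : (√q)⁻¹ ^ 2 = q⁻¹ := by rw [inv_pow, Real.sq_sqrt h0.le]
    have hb1 : ∑ s, b s ^ 2 = 1 := by
      simp only [hb, mul_pow, ← Finset.mul_sum, hsq]
      exact inv_mul_cancel₀ h0.ne'
    have hpb : ∀ u, polyFun b u ^ 2 = q⁻¹ * polyFun a u ^ 2 := by
      intro u
      rw [← hsq, ← mul_pow, polyFun, polyFun, Finset.mul_sum]
      simp only [hb, mul_assoc]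
    have e : (fun x' => K (τ x') * polyFun b (τ x') ^ 2)
        = fun x' => q⁻¹ * (K (τ x') * polyFun a (τ x') ^ 2) := by
      ext x'; rw [hpb]; ring
    have := main b hb1 (by rw [e]; exact hint.const_mul _)
    rw [e, integral_const_mul, ← div_eq_inv_mul, le_div_iff₀ h0] at this
    exact this

/-! ### Conditional class probabilities and the excess risk -/

lemma ae_condProb_nonneg {d m : ℕ} {P : Measure (Obs d × Fin m)} {η : Fin m → Obs d → ℝ}
    (hη : ∀ j, IsCondProb P j (η j)) :
    ∀ᵐ z ∂P, ∀ j, 0 ≤ η j z.1 := by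
  refine ae_all_iff.2 fun j => ?_
  filter_upwards [hη j, condExp_nonneg (m := MeasurableSpace.comap Prod.fst inferInstance)
    (μ := P) (ae_of_all _ fun z => Set.indicator_nonneg (s := {z : Obs d × Fin m | z.2 = j})
      (f := fun _ => (1 : ℝ)) (fun _ _ => zero_le_one) z)] with z h1 h2
  rw [h1]
  exact h2

section CondProb

variable {d m : ℕ} {P : Measure (Obs d × Fin m)} [IsProbabilityMeasure P]
  {η : Fin m → Obs d → ℝ}

lemma measurableSet_class (j : Fin m) : MeasurableSet {z : Obs d × Fin m | z.2 = j} :=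
  measurable_snd (measurableSet_singleton j)

lemma ae_sum_condProb_eq_one (hη : ∀ j, IsCondProb P j (η j)) :
    ∀ᵐ z ∂P, ∑ j, η j z.1 = 1 := by
  have hi : ∀ j : Fin m, Integrable
      (Set.indicator {z : Obs d × Fin m | z.2 = j} fun _ => (1 : ℝ)) P := fun j =>
    (integrable_const _).indicator (measurableSet_class j)
  have h1 := condExp_finsetSum (s := Finset.univ) (μ := P) (fun j _ => hi j)
    (MeasurableSpace.comap Prod.fst inferInstance)
  have h2 : (∑ j : Fin m, Set.indicator {z : Obs d × Fin m | z.2 = j} fun _ => (1 : ℝ))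
      = fun _ => 1 := by
    ext z
    simp [Finset.sum_apply, Set.indicator_apply]
  rw [h2, condExp_const measurable_fst.comap_le] at h1
  filter_upwards [h1, ae_all_iff.2 hη] with z hz hz'
  simp only [Finset.sum_apply] at hz
  rw [hz]
  exact Finset.sum_congr rfl fun j _ => hz' j

/-- The defining property of the conditional probabilities, tested against a bounded function. -/
lemma integral_mul_indicator_sub_condProb {j : Fin m} {g : Obs d → ℝ} (hg : IsCondProb P j g)
    {F : Obs d → ℝ} (hF : Measurable F) {b : ℝ} (hFb : ∀ x, |F x| ≤ b) :
    Integrable (fun z : Obs d × Fin m => F z.1 * g z.1) P ∧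
    ∫ z, F z.1 * Set.indicator {z : Obs d × Fin m | z.2 = j} (fun _ => (1 : ℝ)) z ∂P
      = ∫ z, F z.1 * g z.1 ∂P := by
  set I : Obs d × Fin m → ℝ := Set.indicator {z : Obs d × Fin m | z.2 = j} fun _ => (1 : ℝ) with hI
  have hi : Integrable I P := (integrable_const _).indicator (measurableSet_class j)
  have hF1 : Measurable fun z : Obs d × Fin m => F z.1 := hF.comp measurable_fst
  have hFc : Measurable[MeasurableSpace.comap Prod.fst inferInstance]
      fun z : Obs d × Fin m => F z.1 := hF.comp (comap_measurable Prod.fst)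
  have hFI : Integrable ((fun z : Obs d × Fin m => F z.1) * I) P :=
    hi.bdd_mul hF1.aestronglyMeasurable (ae_of_all _ fun z => (hFb z.1 : ‖F z.1‖ ≤ b))
  have h1 := condExp_mul_of_stronglyMeasurable_left hFc.stronglyMeasurable hFI hi
  have h2 : (fun z : Obs d × Fin m => F z.1 * g z.1) =ᵐ[P]
      P[(fun z : Obs d × Fin m => F z.1) * I | MeasurableSpace.comap Prod.fst inferInstance] := by
    filter_upwards [h1, hg] with z hz hz'
    rw [hz, Pi.mul_apply, hz']
  refine ⟨integrable_condExp.congr h2.symm, ?_⟩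
  rw [integral_congr_ae h2, integral_condExp measurable_fst.comap_le]
  rfl

lemma measurable_apply_class {g : Fin m → Obs d → ℝ} (hg : ∀ j, Measurable (g j))
    {α : Type*} [MeasurableSpace α] {f : α → Fin m} (hf : Measurable f) {e : α → Obs d}
    (he : Measurable e) : Measurable fun x => g (f x) (e x) := by
  have h : Measurable fun q : Fin m × Obs d => g q.1 q.2 :=
    measurable_from_prod_countable_right fun j => hg j
  exact h.comp (hf.prodMk he)

lemma risk_eq (hη : ∀ j, IsCondProb P j (η j))
    {f : Obs d → Fin m} (hf : Measurable f) :
    Integrable (fun z : Obs d × Fin m => η (f z.1) z.1) P ∧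
      risk P f = 1 - ∫ z, η (f z.1) z.1 ∂P := by
  set I : Fin m → Obs d → ℝ := fun j => Set.indicator {x | f x = j} fun _ => (1 : ℝ) with hI
  have hIm : ∀ j, Measurable (I j) := fun j =>
    measurable_const.indicator (hf (measurableSet_singleton j))
  have hIb : ∀ j x, |I j x| ≤ 1 := by
    intro j x
    simp only [hI, Set.indicator_apply]
    split_ifs <;> simp
  have h1 : (fun z : Obs d × Fin m => η (f z.1) z.1) = fun z => ∑ j, I j z.1 * η j z.1 := by
    ext z
    simp [hI, Set.indicator_apply]
  have key := fun j => integral_mul_indicator_sub_condProb (hη j) (hIm j) (hIb j)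
  have hfm : MeasurableSet {z : Obs d × Fin m | z.2 = f z.1} :=
    measurableSet_eq_fun measurable_snd (hf.comp measurable_fst)
  refine ⟨by rw [h1]; exact integrable_finsetSum _ fun j _ => (key j).1, ?_⟩
  have h2 : risk P f = 1 - P.real {z : Obs d × Fin m | z.2 = f z.1} := by
    rw [risk, ← probReal_compl_eq_one_sub hfm]
    rfl
  have h3 : (fun z : Obs d × Fin m =>
      Set.indicator {z : Obs d × Fin m | z.2 = f z.1} (fun _ => (1 : ℝ)) z)
      = fun z => ∑ j, I j z.1 *
        Set.indicator {z : Obs d × Fin m | z.2 = j} (fun _ => (1 : ℝ)) z := by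
    ext z
    simp [hI, Set.indicator_apply, eq_comm]
  rw [h2, h1, integral_finsetSum _ fun j _ => (key j).1, ← integral_indicator_one hfm]
  change 1 - ∫ z, Set.indicator {z : Obs d × Fin m | z.2 = f z.1} (fun _ => (1 : ℝ)) z ∂P = _
  rw [h3, integral_finsetSum]
  · simp only [fun j => (key j).2]
  · intro j _
    exact ((integrable_const (1 : ℝ)).indicator (measurableSet_class j)).bdd_mul
      ((hIm j).comp measurable_fst).aestronglyMeasurable
      (ae_of_all _ fun z => (hIb j z.1 : ‖I j z.1‖ ≤ 1))

lemma risk_sub_risk_eq (hη : ∀ j, IsCondProb P j (η j)) (hηm : ∀ j, Measurable (η j))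
    {f fstar : Obs d → Fin m} (hf : Measurable f) (hfstar : Measurable fstar) :
    risk P f - risk P fstar = ∫ x, (η (fstar x) x - η (f x) x) ∂(P.map Prod.fst) := by
  obtain ⟨h1, h2⟩ := risk_eq hη hf
  obtain ⟨h3, h4⟩ := risk_eq hη hfstar
  have hm : Measurable fun x => η (fstar x) x - η (f x) x :=
    (measurable_apply_class hηm hfstar measurable_id).sub
      (measurable_apply_class hηm hf measurable_id)
  rw [h2, h4, integral_map measurable_fst.aemeasurable hm.aestronglyMeasurable,
    integral_sub h3 h1]
  ring

end CondProb

/-! ### The margin -/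

/-- The gap between the two largest class probabilities is at most the gap between a maximal
class and any other one. -/
lemma decreasing_sub_decreasing_le {m : ℕ} (hm : 2 ≤ m) (v : Fin m → ℝ) {i j : Fin m}
    (hi : ∀ k, v k ≤ v i) (hij : j ≠ i) :
    decreasing v ⟨0, by omega⟩ - decreasing v ⟨1, by omega⟩ ≤ v i - v j := by
  have hmono := Tuple.monotone_sort v
  set σ := Tuple.sort v with hσ
  have h0 : decreasing v ⟨0, by omega⟩ ≤ v i := hi _
  have hle : ∀ k, k ≠ σ (Fin.rev ⟨0, by omega⟩) → v k ≤ decreasing v ⟨1, by omega⟩ := by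
    intro k hk
    have h1 : σ.symm k ≤ Fin.rev ⟨1, by omega⟩ := by
      have h2 : σ.symm k ≠ Fin.rev ⟨0, by omega⟩ := fun e => hk (by rw [← e]; simp)
      rw [Fin.le_def, Fin.val_rev]
      have h3 : (σ.symm k).val ≠ m - 1 := fun e => h2 (Fin.ext (by rw [Fin.val_rev]; simpa using e))
      have := (σ.symm k).isLt
      simp only
      omega
    have := hmono h1
    simpa [decreasing, Function.comp] using this
  by_cases hj : j = σ (Fin.rev ⟨0, by omega⟩)
  · -- `j` is the last index of the sorted tuple, so the value at `i` ties with it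
    have h2 : v i ≤ decreasing v ⟨1, by omega⟩ := hle i fun e => hij (hj.trans e.symm)
    have h3 := hi j
    linarith
  · have := hle j hj
    linarith

/-! ### Peeling with the margin assumption -/

/-- Peeling: if the variable `G x` can be positive and at most `t` only on a set of points of
measure at most `C₀ t ^ α`, and has `p`-th moment of order `ε ^ p` with `p ≥ α + 2`, then its mean
is of order `ε ^ (1 + α)`. The values of `G` are split at the points `2 ^ k * ε`. -/
lemma lintegral_le_of_margin {X Ω : Type*} [MeasurableSpace X] [MeasurableSpace Ω]
    {Q : Measure X} [IsFiniteMeasure Q] {Pr : Measure Ω} [IsProbabilityMeasure Pr]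
    {G : X → Ω → ℝ} (hG : Measurable (Function.uncurry G)) {E : ℝ → Set X}
    (hE : ∀ t, MeasurableSet (E t)) (hGE : ∀ x ω t, 0 < G x ω → G x ω ≤ t → x ∈ E t)
    {C₀ α : ℝ} (hC₀ : 0 ≤ C₀)
    (hmargin : ∀ t, 0 < t → Q.real (E t) ≤ C₀ * t ^ α) {p : ℕ} (hp : α + 2 ≤ p) {ε C : ℝ}
    (hε : 0 < ε) (hC : 0 ≤ C)
    (hmom : ∀ᵐ x ∂Q, ∫⁻ ω, ENNReal.ofReal (G x ω ^ p) ∂Pr ≤ ENNReal.ofReal (C * ε ^ p)) :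
    ∫⁻ x, ∫⁻ ω, ENNReal.ofReal (G x ω) ∂Pr ∂Q
      ≤ ENNReal.ofReal (C₀ * (1 + 2 ^ (2 + α) * C) * ε ^ (1 + α)) := by
  set c : ℕ → ℝ := fun k => 2 ^ (k + 1) * ε / (2 ^ k * ε) ^ p with hc
  have hc0 : ∀ k, 0 ≤ c k := fun k => by positivity
  set I : ℝ → X → ENNReal := fun t => (E t).indicator 1 with hI
  have hIm : ∀ t, Measurable (I t) := fun t => measurable_one.indicator (hE t)
  have hQE : ∀ t, 0 < t → Q (E t) ≤ ENNReal.ofReal (C₀ * t ^ α) := fun t ht => by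
    rw [← ENNReal.ofReal_toReal (measure_ne_top Q (E t))]
    exact ENNReal.ofReal_le_ofReal (hmargin t ht)
  have hpt : ∀ x ω, ENNReal.ofReal (G x ω) ≤ ENNReal.ofReal ε * I ε x
      + ∑' k : ℕ, I (2 ^ (k + 1) * ε) x * (ENNReal.ofReal (c k) * ENNReal.ofReal (G x ω ^ p)) := by
    intro x ω
    rcases le_or_gt (G x ω) 0 with h0 | h0
    · rw [ENNReal.ofReal_of_nonpos h0]; exact zero_le
    rcases le_or_gt (G x ω) ε with h1 | h1
    · refine le_trans ?_ le_self_add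
      have : I ε x = 1 := Set.indicator_of_mem (hGE x ω ε h0 h1) _
      rw [this, mul_one]
      exact ENNReal.ofReal_le_ofReal h1
    · obtain ⟨k, hk1, hk2⟩ := exists_nat_pow_near (x := G x ω / ε) (y := (2 : ℝ))
        ((one_le_div hε).2 h1.le) one_lt_two
      rw [le_div_iff₀ hε] at hk1
      rw [div_lt_iff₀ hε] at hk2
      refine le_trans ?_ le_add_self
      refine le_trans ?_ (ENNReal.le_tsum k)
      have : I (2 ^ (k + 1) * ε) x = 1 := Set.indicator_of_mem (hGE x ω _ h0 hk2.le) _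
      rw [this, one_mul, ← ENNReal.ofReal_mul (hc0 k)]
      refine ENNReal.ofReal_le_ofReal ?_
      have hb : 0 < 2 ^ k * ε := by positivity
      simp only [hc]
      rw [div_mul_eq_mul_div, le_div_iff₀ (by positivity)]
      exact mul_le_mul hk2.le (pow_le_pow_left₀ hb.le hk1 p) (by positivity) (by positivity)
  have hGm : ∀ x, Measurable fun ω => ENNReal.ofReal (G x ω ^ p) := fun x =>
    ENNReal.measurable_ofReal.comp ((hG.comp measurable_prodMk_left).pow_const p)
  have hGI : Measurable fun x => ∫⁻ ω, ENNReal.ofReal (G x ω ^ p) ∂Pr :=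
    Measurable.lintegral_prod_right' (f := fun q : X × Ω => ENNReal.ofReal (G q.1 q.2 ^ p))
      (ENNReal.measurable_ofReal.comp (hG.pow_const p))
  have hIG : ∀ k : ℕ, Measurable fun x => I (2 ^ (k + 1) * ε) x *
      (ENNReal.ofReal (c k) * ∫⁻ ω, ENNReal.ofReal (G x ω ^ p) ∂Pr) := fun k =>
    (hIm _).mul (hGI.const_mul _)
  have hterm : ∀ k : ℕ, c k * (C * ε ^ p) * (C₀ * (2 ^ (k + 1) * ε) ^ α)
      ≤ (C₀ * C * 2 ^ (1 + α) * ε ^ (1 + α)) * (1 / 2) ^ k := by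
    intro k
    have e1 : (2 ^ (k + 1) * ε) ^ (1 + α) = 2 ^ (k + 1) * ε * (2 ^ (k + 1) * ε) ^ α := by
      rw [Real.rpow_add (by positivity), Real.rpow_one]
    have e2 : c k * (C * ε ^ p) * (C₀ * (2 ^ (k + 1) * ε) ^ α)
        = C₀ * C * ((2 ^ (k + 1) * ε) ^ (1 + α) / (2 ^ k) ^ p) := by
      rw [e1]
      simp only [hc, mul_pow]
      field_simp
    have e3 : ((2 : ℝ) ^ (k + 1) * ε) ^ (1 + α)
        = 2 ^ (1 + α) * ε ^ (1 + α) * (2 ^ k) ^ (1 + α) := by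
      rw [Real.mul_rpow (by positivity) hε.le, pow_succ,
        Real.mul_rpow (by positivity) (by norm_num)]
      ring
    have e4 : ((2 : ℝ) ^ k) ^ (1 + α) / (2 ^ k) ^ p ≤ (1 / 2) ^ k := by
      rw [← Real.rpow_natCast (2 ^ k) p, ← Real.rpow_sub (by positivity)]
      calc ((2 : ℝ) ^ k) ^ (1 + α - p) ≤ (2 ^ k) ^ (-1 : ℝ) :=
            Real.rpow_le_rpow_of_exponent_le (one_le_pow₀ one_le_two) (by linarith)
        _ = (1 / 2) ^ k := by rw [Real.rpow_neg_one, one_div, inv_pow]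
    rw [e2, e3, mul_div_assoc]
    calc C₀ * C * (2 ^ (1 + α) * ε ^ (1 + α) * (((2 : ℝ) ^ k) ^ (1 + α) / (2 ^ k) ^ p))
        ≤ C₀ * C * (2 ^ (1 + α) * ε ^ (1 + α) * (1 / 2) ^ k) := by gcongr
      _ = _ := by ring
  calc ∫⁻ x, ∫⁻ ω, ENNReal.ofReal (G x ω) ∂Pr ∂Q
      ≤ ∫⁻ x, (ENNReal.ofReal ε * I ε x + ∑' k : ℕ, I (2 ^ (k + 1) * ε) x *
          (ENNReal.ofReal (c k) * ∫⁻ ω, ENNReal.ofReal (G x ω ^ p) ∂Pr)) ∂Q := by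
        refine lintegral_mono fun x => (lintegral_mono (hpt x)).trans (le_of_eq ?_)
        rw [lintegral_add_left measurable_const, lintegral_const, measure_univ, mul_one,
          lintegral_tsum fun k => ((hGm x).const_mul _).aemeasurable.const_mul _]
        congr 1
        refine tsum_congr fun k => ?_
        rw [lintegral_const_mul _ ((hGm x).const_mul _), lintegral_const_mul _ (hGm x)]
    _ = ENNReal.ofReal ε * Q (E ε) + ∑' k : ℕ, ∫⁻ x, I (2 ^ (k + 1) * ε) x *
          (ENNReal.ofReal (c k) * ∫⁻ ω, ENNReal.ofReal (G x ω ^ p) ∂Pr) ∂Q := by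
        rw [lintegral_add_left ((hIm ε).const_mul _), lintegral_const_mul _ (hIm ε),
          lintegral_indicator_one (hE ε),
          lintegral_tsum fun k => (hIG k).aemeasurable]
    _ ≤ ENNReal.ofReal (ε * (C₀ * ε ^ α)) + ∑' k : ℕ, ENNReal.ofReal
          ((C₀ * C * 2 ^ (1 + α) * ε ^ (1 + α)) * (1 / 2) ^ k) := by
        refine add_le_add ?_ (ENNReal.tsum_le_tsum fun k => ?_)
        · rw [ENNReal.ofReal_mul hε.le]
          exact mul_le_mul_right (hQE ε hε) _
        · have ht : 0 < 2 ^ (k + 1) * ε := by positivity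
          calc ∫⁻ x, I (2 ^ (k + 1) * ε) x *
                (ENNReal.ofReal (c k) * ∫⁻ ω, ENNReal.ofReal (G x ω ^ p) ∂Pr) ∂Q
              ≤ ∫⁻ x, I (2 ^ (k + 1) * ε) x *
                (ENNReal.ofReal (c k) * ENNReal.ofReal (C * ε ^ p)) ∂Q := by
                refine lintegral_mono_ae (hmom.mono fun x hx => ?_)
                gcongr
            _ = Q (E (2 ^ (k + 1) * ε)) * ENNReal.ofReal (c k * (C * ε ^ p)) := by
                rw [lintegral_mul_const _ (hIm _), lintegral_indicator_one (hE _),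
                  ENNReal.ofReal_mul (hc0 k)]
            _ ≤ ENNReal.ofReal (C₀ * (2 ^ (k + 1) * ε) ^ α) *
                  ENNReal.ofReal (c k * (C * ε ^ p)) := mul_le_mul_left (hQE _ ht) _
            _ ≤ _ := by
                rw [← ENNReal.ofReal_mul (by positivity), mul_comm]
                exact ENNReal.ofReal_le_ofReal (hterm k)
    _ = ENNReal.ofReal (C₀ * (1 + 2 ^ (2 + α) * C) * ε ^ (1 + α)) := by
        have hA : 0 ≤ C₀ * C * 2 ^ (1 + α) * ε ^ (1 + α) := by positivity
        rw [← ENNReal.ofReal_tsum_of_nonneg (fun k => by positivity)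
          (summable_geometric_two.mul_left _), tsum_mul_left, tsum_geometric_two,
          ← ENNReal.ofReal_add (by positivity) (by positivity)]
        congr 1
        rw [show (2 : ℝ) + α = 1 + (1 + α) by ring, Real.rpow_add two_pos 1 (1 + α),
          Real.rpow_one, Real.rpow_add hε 1 α, Real.rpow_one]
        ring

/-! ### Moments of localized means -/

/-- The relations between the sample size `n`, the block length `a`, the effective sample size `N`
and the accuracy `ε = h ^ β`, for a mixing sequence with that sample size. -/
structure SampleScheme {Ω E : Type*} [MeasurableSpace Ω] [MeasurableSpace E] (Pr : Measure Ω)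
    (Z : ℕ → Ω → E) (C₁ hd ε : ℝ) (n a N : ℕ) : Prop where
  n_pos : 0 < n
  a_pos : 0 < a
  N_pos : 0 < N
  div_eq : n / a = N
  hd_pos : 0 < hd
  ε_pos : 0 < ε
  ε_le_one : ε ≤ 1
  balance : N * hd * ε ^ 2 = 1
  mixing : MixingLE Pr Z a (C₁ * Real.exp (-8 * N))

lemma sampleScheme_bandwidth {Ω E : Type*} [MeasurableSpace Ω] [MeasurableSpace E]
    {Pr : Measure Ω} [IsProbabilityMeasure Pr] {Z : ℕ → Ω → E} {d : ℕ} {β C₁ C₂ C₃ : ℝ}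
    (hβ : 0 < β) (hC₁ : 0 < C₁) (hC₂ : 0 < C₂) (hC₃ : 0 < C₃)
    (hmix : ExpStronglyMixing C₁ C₂ C₃ Pr Z) {n : ℕ} (hh : 0 < bandwidth d β C₂ C₃ n) :
    bandwidth d β C₂ C₃ n ≤ 1 ∧
    ∃ a, SampleScheme Pr Z C₁ (bandwidth d β C₂ C₃ n ^ d) (bandwidth d β C₂ C₃ n ^ β) n a
      (effSize C₂ C₃ n) := by
  set N := effSize C₂ C₃ n with hN
  set a : ℕ := ⌈(8 * (n : ℝ) / C₂) ^ (1 / (C₃ + 1))⌉₊ with ha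
  set h := bandwidth d β C₂ C₃ n with hhdef
  have hb : h = (N : ℝ) ^ (-1 / (2 * β + d)) := rfl
  have hexp : 0 < 2 * β + d := by positivity
  have hNdiv : N = n / a := Nat.floor_div_eq_div n a
  have hN0 : 0 < N := by
    rcases Nat.eq_zero_or_pos N with h0 | h0
    · rw [hb, h0, Nat.cast_zero, Real.zero_rpow (by
        rw [neg_div]; exact (neg_neg_of_pos (one_div_pos.2 hexp)).ne)] at hh
      exact absurd hh (lt_irrefl 0)
    · exact h0
  have ha0 : 0 < a := by
    rcases Nat.eq_zero_or_pos a with h0 | h0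
    · rw [hNdiv, h0, Nat.div_zero] at hN0; omega
    · exact h0
  have hn0 : 0 < n := by
    rcases Nat.eq_zero_or_pos n with h0 | h0
    · rw [hNdiv, h0, Nat.zero_div] at hN0; omega
    · exact h0
  have hNR : (1 : ℝ) ≤ N := by exact_mod_cast hN0
  have hh1 : h ≤ 1 := by
    rw [hb]
    refine Real.rpow_le_one_of_one_le_of_nonpos hNR ?_
    rw [neg_div]
    exact neg_nonpos.2 (one_div_pos.2 hexp).le
  refine ⟨hh1, a, hn0, ha0, hN0, hNdiv.symm, by positivity, by positivity,
    Real.rpow_le_one hh.le hh1 hβ.le, ?_, mixingLE_of_mixingCoeff_le ((hmix a ha0).trans ?_)⟩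
  · have h1 : h ^ d * (h ^ β) ^ 2 = h ^ (2 * β + d) := by
      rw [← Real.rpow_natCast h d, ← Real.rpow_natCast (h ^ β) 2, ← Real.rpow_mul hh.le,
        ← Real.rpow_add hh]
      congr 1; push_cast; ring
    rw [mul_assoc, h1, hb, ← Real.rpow_mul (by positivity), div_mul_cancel₀ _ hexp.ne',
      Real.rpow_neg_one]
    exact mul_inv_cancel₀ (by positivity)
  · refine mul_le_mul_of_nonneg_left (Real.exp_le_exp.2 ?_) hC₁.le
    have haR : (0 : ℝ) < a := by exact_mod_cast ha0
    have h1 : (8 * (n : ℝ) / C₂) ^ (1 / (C₃ + 1)) ≤ a := Nat.le_ceil _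
    have h2 : 8 * (n : ℝ) / C₂ ≤ (a : ℝ) ^ (C₃ + 1) := by
      have := Real.rpow_le_rpow (by positivity) h1 (by linarith : 0 ≤ C₃ + 1)
      rwa [← Real.rpow_mul (by positivity), one_div_mul_cancel (by linarith), Real.rpow_one] at this
    rw [Real.rpow_add haR, Real.rpow_one, div_le_iff₀ hC₂] at h2
    have h3 : (N : ℝ) * a ≤ n := by
      rw [hNdiv]; exact_mod_cast Nat.div_mul_le_self n a
    have h4 : 8 * (N : ℝ) ≤ C₂ * (a : ℝ) ^ C₃ := by
      refine le_of_mul_le_mul_right ?_ haR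
      nlinarith
    linarith

/-- The moments of a family of localized means: variables bounded by `M`, with second moments of
order `h ^ d`, have empirical means, normalized by `h ^ d`, within `ε = h ^ β` of their expectations
in every even moment. The constant does not depend on the number of variables. -/
lemma sum_integral_localized_mean_pow_le {Ω E J : Type*} [MeasurableSpace Ω] [MeasurableSpace E]
    [Fintype J] {Pr : Measure Ω} [IsProbabilityMeasure Pr] {P : Measure E}
    [IsProbabilityMeasure P] {Z : ℕ → Ω → E} (hZ : ∀ i, Measurable (Z i))
    (hP : ∀ i, Pr.map (Z i) = P) {C₁ hd ε : ℝ} (hC₁ : 0 ≤ C₁) {n a N : ℕ}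
    (hs : SampleScheme Pr Z C₁ hd ε n a N) {M V : ℝ} (hM : 0 < M) {ξ : J → E → ℝ}
    (hξ : ∀ j, Measurable (ξ j)) (hξM : ∀ᵐ z ∂P, ∑ j, |ξ j z| ≤ M)
    (hV : ∑ j, ∫ z, ξ j z ^ 2 ∂P ≤ V * hd) {k : ℕ} (hk : k ≠ 0) :
    (∀ j, Integrable (fun ω => ((n * hd)⁻¹ * ∑ i ∈ Finset.range n, ξ j (Z i ω)
      - hd⁻¹ * ∫ z, ξ j z ∂P) ^ (2 * k)) Pr) ∧
    ∑ j, ∫ ω, ((n * hd)⁻¹ * ∑ i ∈ Finset.range n, ξ j (Z i ω)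
      - hd⁻¹ * ∫ z, ξ j z ∂P) ^ (2 * k) ∂Pr
      ≤ (2 * k).factorial * Real.exp (V / (8 * M ^ 2) + 8 * C₁) * (4 * M) ^ (2 * k)
        * ε ^ (2 * k) := by
  classical
  obtain ⟨hn, ha, hN, hdiv, hhd, hε, hε1, hbal, hmix⟩ := hs
  -- truncation on a null set
  set D : Set E := {z | ∑ j, |ξ j z| ≤ M} with hD
  have hDm : MeasurableSet D :=
    measurableSet_le (Finset.measurable_fun_sum _ fun j _ => (hξ j).abs) measurable_const
  set ξ' : J → E → ℝ := fun j => D.indicator (ξ j) with hξ'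
  have hξ'm : ∀ j, Measurable (ξ' j) := fun j => (hξ j).indicator hDm
  have hae : ∀ᵐ z ∂P, ∀ j, ξ' j z = ξ j z := hξM.mono fun z hz j =>
    Set.indicator_of_mem (s := D) hz _
  have hξ'M : ∀ z, ∑ j, |ξ' j z| ≤ M := by
    intro z
    by_cases hz : z ∈ D
    · have h1 : ∀ j, ξ' j z = ξ j z := fun j => Set.indicator_of_mem hz _
      simp only [h1]
      exact hz
    · simp [hξ', hz, hM.le]
  have hξ'b : ∀ j z, |ξ' j z| ≤ M := fun j z => abs_le_of_sum_abs_le (hξ'M z) j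
  have hξ'i : ∀ j, Integrable (ξ' j) P := fun j =>
    Integrable.of_bound (hξ'm j).aestronglyMeasurable M (ae_of_all _ (hξ'b j))
  set e : J → ℝ := fun j => ∫ z, ξ' j z ∂P with he
  have hee : ∀ j, ∫ z, ξ j z ∂P = e j := fun j =>
    integral_congr_ae (hae.mono fun z hz => (hz j).symm)
  have heM : ∑ j, |e j| ≤ M := by
    calc ∑ j, |e j| ≤ ∑ j, ∫ z, |ξ' j z| ∂P :=
          Finset.sum_le_sum fun j _ => abs_integral_le_integral_abs
      _ = ∫ z, ∑ j, |ξ' j z| ∂P := (integral_finsetSum _ fun j _ => (hξ'i j).abs).symm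
      _ ≤ ∫ _, M ∂P := integral_mono (integrable_finsetSum _ fun j _ => (hξ'i j).abs)
          (integrable_const _) hξ'M
      _ = M := by simp
  set ζ : J → E → ℝ := fun j z => ξ' j z - e j with hζ
  have hζm : ∀ j, Measurable (ζ j) := fun j => (hξ'm j).sub_const _
  have hζM : ∀ z, ∑ j, |ζ j z| ≤ 2 * M := by
    intro z
    calc ∑ j, |ζ j z| ≤ ∑ j, (|ξ' j z| + |e j|) := Finset.sum_le_sum fun j _ => abs_sub _ _
      _ ≤ 2 * M := by rw [Finset.sum_add_distrib]; linarith [hξ'M z]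
  have hζmean : ∀ j, ∫ z, ζ j z ∂P = 0 := by
    intro j
    simp only [hζ]
    rw [integral_sub (hξ'i j) (integrable_const _)]
    simp [he]
  have hsqi : ∀ j, Integrable (fun z => ξ' j z ^ 2) P := fun j =>
    Integrable.of_bound ((hξ'm j).pow_const 2).aestronglyMeasurable (M ^ 2) (ae_of_all _ fun z => by
      rw [Real.norm_of_nonneg (sq_nonneg _), ← sq_abs]
      exact pow_le_pow_left₀ (abs_nonneg _) (hξ'b j z) 2)
  have hζV : ∑ j, ∫ z, ζ j z ^ 2 ∂P ≤ V * hd := by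
    refine le_trans (Finset.sum_le_sum fun j _ => ?_) hV
    have h1 : ∫ z, ξ j z ^ 2 ∂P = ∫ z, ξ' j z ^ 2 ∂P :=
      integral_congr_ae (hae.mono fun z hz => by simp only [hz j])
    have h2 : ∀ z, ζ j z ^ 2 = ξ' j z ^ 2 - 2 * e j * ξ' j z + e j ^ 2 := fun z => by
      simp only [hζ]; ring
    have h3 : Integrable (fun z => ξ' j z ^ 2 - 2 * e j * ξ' j z) P :=
      (hsqi j).sub ((hξ'i j).const_mul _)
    rw [h1]
    simp only [h2]
    rw [integral_add h3 (integrable_const _), integral_sub (hsqi j) ((hξ'i j).const_mul _),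
      integral_const_mul]
    have : ∫ z, ξ' j z ∂P = e j := rfl
    rw [this]
    simp
    nlinarith [sq_nonneg (e j)]
  have hn' : (0 : ℝ) < n := by exact_mod_cast hn
  have ha' : (0 : ℝ) < a := by exact_mod_cast ha
  have hN' : (1 : ℝ) ≤ N := by exact_mod_cast hN
  set θ : ℝ := ε / (4 * M) with hθ
  have hθ0 : 0 < θ := by positivity
  have hθM : θ * (2 * M) = ε / 2 := by rw [hθ]; field_simp; ring
  set m : J → Ω → ℝ := fun j ω => (n : ℝ)⁻¹ * ∑ i ∈ Finset.range n, ζ j (Z i ω) with hm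
  have hmom := sum_integral_mean_pow_le hZ hP ha (by positivity) hmix hζm hζM hζmean hζV hn
    (N := N + 1) (by omega) hθ0.le (by rw [hθM]; linarith) hk
  -- the localized means are the normalized means of the centered variables, almost surely
  have hdev : ∀ᵐ ω ∂Pr, ∀ j, (n * hd)⁻¹ * ∑ i ∈ Finset.range n, ξ j (Z i ω)
      - hd⁻¹ * ∫ z, ξ j z ∂P = hd⁻¹ * m j ω := by
    have h1 : ∀ᵐ ω ∂Pr, ∀ i j, ξ' j (Z i ω) = ξ j (Z i ω) := by
      refine ae_all_iff.2 fun i => ?_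
      have := hae
      rw [← hP i] at this
      exact ae_of_ae_map (hZ i).aemeasurable this
    filter_upwards [h1] with ω hω j
    simp only [hm, hζ, hω, Finset.sum_sub_distrib, Finset.sum_const, Finset.card_range,
      nsmul_eq_mul, hee]
    field_simp
  have hmm : ∀ j, Measurable (m j) := fun j => (Finset.measurable_fun_sum _ fun i _ =>
    (hζm j).comp (hZ i)).const_mul _
  have hmb : ∀ j ω, |m j ω| ≤ 2 * M := by
    intro j ω
    simp only [hm]
    rw [abs_mul, abs_of_pos (inv_pos.2 hn'), inv_mul_le_iff₀ hn']
    calc |∑ i ∈ Finset.range n, ζ j (Z i ω)| ≤ ∑ i ∈ Finset.range n, |ζ j (Z i ω)| :=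
          Finset.abs_sum_le_sum_abs _ _
      _ ≤ ∑ i ∈ Finset.range n, 2 * M :=
          Finset.sum_le_sum fun i _ => abs_le_of_sum_abs_le (hζM _) j
      _ = n * (2 * M) := by simp
  have hmi : ∀ j, Integrable (fun ω => (hd⁻¹ * m j ω) ^ (2 * k)) Pr := by
    intro j
    refine Integrable.of_bound (((hmm j).const_mul _).pow_const _).aestronglyMeasurable
      ((hd⁻¹ * (2 * M)) ^ (2 * k)) (ae_of_all _ fun ω => ?_)
    rw [norm_pow, Real.norm_eq_abs, abs_mul, abs_of_pos (inv_pos.2 hhd)]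
    exact pow_le_pow_left₀ (by positivity) (mul_le_mul_of_nonneg_left (hmb j ω) (by positivity)) _
  have hdev' : ∀ j, (fun ω => ((n * hd)⁻¹ * ∑ i ∈ Finset.range n, ξ j (Z i ω)
      - hd⁻¹ * ∫ z, ξ j z ∂P) ^ (2 * k)) =ᵐ[Pr] fun ω => (hd⁻¹ * m j ω) ^ (2 * k) := fun j =>
    hdev.mono fun ω hω => by simp only [hω j]
  refine ⟨fun j => (hmi j).congr (hdev' j).symm, ?_⟩
  have e1 : ∑ j, ∫ ω, ((n * hd)⁻¹ * ∑ i ∈ Finset.range n, ξ j (Z i ω)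
      - hd⁻¹ * ∫ z, ξ j z ∂P) ^ (2 * k) ∂Pr
      = hd⁻¹ ^ (2 * k) * ∑ j, ∫ ω, m j ω ^ (2 * k) ∂Pr := by
    rw [Finset.mul_sum]
    refine Finset.sum_congr rfl fun j _ => ?_
    rw [integral_congr_ae (hdev' j)]
    simp only [mul_pow]
    rw [integral_const_mul]
  rw [e1]
  -- the parameter of the exponential moment
  set S : ℝ := ∑ j, ∫ ω, m j ω ^ (2 * k) ∂Pr with hS
  have hS0 : 0 ≤ S := Finset.sum_nonneg fun j _ => integral_nonneg fun ω => by
    simp only [pow_mul]; positivity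
  have hNa : (N : ℝ) ≤ n / a := by
    rw [← hdiv]; exact Nat.cast_div_le
  have hlam : (4 * M * ε * hd)⁻¹ ≤ θ * (n / a) := by
    have h1 : (4 * M * ε * hd)⁻¹ = θ * N := by
      rw [hθ]
      field_simp
      linarith
    rw [h1]
    exact mul_le_mul_of_nonneg_left hNa hθ0.le
  have hexpo : ((N + 1 : ℕ) : ℝ) * (θ ^ 2 * (V * hd) + 4 * (C₁ * Real.exp (-8 * N)) *
      Real.exp ((N + 1 : ℕ) * (θ * (2 * M)))) ≤ V / (8 * M ^ 2) + 8 * C₁ := by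
    have hV0 : 0 ≤ V * hd :=
      (Finset.sum_nonneg fun j _ => integral_nonneg fun z => sq_nonneg _).trans hV
    have h2N : ((N + 1 : ℕ) : ℝ) ≤ 2 * N := by push_cast; linarith
    have h1 : ((N + 1 : ℕ) : ℝ) * (θ ^ 2 * (V * hd)) ≤ V / (8 * M ^ 2) := by
      calc ((N + 1 : ℕ) : ℝ) * (θ ^ 2 * (V * hd)) ≤ 2 * N * (θ ^ 2 * (V * hd)) :=
            mul_le_mul_of_nonneg_right h2N (by positivity)
        _ = V * (N * hd * ε ^ 2) / (8 * M ^ 2) := by rw [hθ]; field_simp; ring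
        _ = V / (8 * M ^ 2) := by rw [hbal, mul_one]
    have h2 : Real.exp (-8 * N) * Real.exp ((N + 1 : ℕ) * (θ * (2 * M))) ≤ Real.exp (-N) := by
      rw [← Real.exp_add]
      refine Real.exp_le_exp.2 ?_
      rw [hθM]
      have : ((N + 1 : ℕ) : ℝ) * (ε / 2) ≤ 2 * N * (1 / 2) :=
        mul_le_mul h2N (by linarith) (by positivity) (by positivity)
      linarith
    have h3 : (N : ℝ) * Real.exp (-N) ≤ 1 := by
      rw [Real.exp_neg, ← div_eq_mul_inv, div_le_one (Real.exp_pos _)]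
      linarith [Real.add_one_le_exp (N : ℝ)]
    have h4 : ((N + 1 : ℕ) : ℝ) * (4 * (C₁ * Real.exp (-8 * N)) *
      Real.exp ((N + 1 : ℕ) * (θ * (2 * M)))) ≤ 8 * C₁ := by
      calc ((N + 1 : ℕ) : ℝ) * (4 * (C₁ * Real.exp (-8 * N)) *
            Real.exp ((N + 1 : ℕ) * (θ * (2 * M))))
          = ((N + 1 : ℕ) : ℝ) * (4 * C₁ * (Real.exp (-8 * N) *
            Real.exp ((N + 1 : ℕ) * (θ * (2 * M))))) := by ring
        _ ≤ (2 * N) * (4 * C₁ * Real.exp (-N)) := by gcongr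
        _ = 8 * C₁ * (N * Real.exp (-N)) := by ring
        _ ≤ 8 * C₁ * 1 := by gcongr
        _ = 8 * C₁ := mul_one _
    rw [mul_add]
    linarith
  have hfin : (4 * M * ε * hd)⁻¹ ^ (2 * k) * S
      ≤ (2 * k).factorial * Real.exp (V / (8 * M ^ 2) + 8 * C₁) := by
    refine (mul_le_mul_of_nonneg_right (pow_le_pow_left₀ (by positivity) hlam _) hS0).trans
      (hmom.trans ?_)
    gcongr
  have hpos : 0 < (4 * M * ε) ^ (2 * k) := by positivity
  calc hd⁻¹ ^ (2 * k) * S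
      = (4 * M * ε) ^ (2 * k) * ((4 * M * ε * hd)⁻¹ ^ (2 * k) * S) := by
        rw [mul_inv (4 * M * ε) hd, mul_pow (4 * M * ε)⁻¹, inv_pow (4 * M * ε)]
        field_simp
    _ ≤ (4 * M * ε) ^ (2 * k) * ((2 * k).factorial * Real.exp (V / (8 * M ^ 2) + 8 * C₁)) :=
        mul_le_mul_of_nonneg_left hfin hpos.le
    _ = _ := by rw [mul_pow (4 * M) ε]; ring

/-! ### The dominating function of the kernel -/

lemma rpow_le_one_add_rpow {x a b : ℝ} (hx : 0 ≤ x) (ha : 0 ≤ a) (hab : a ≤ b) :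
    x ^ a ≤ 1 + x ^ b := by
  have h0 := Real.rpow_nonneg hx b
  rcases le_total x 1 with h | h
  · linarith [Real.rpow_le_one hx h ha]
  · linarith [Real.rpow_le_rpow_of_exponent_le h hab]

/-- The function `K u * (1 + ‖u‖ ^ (2 β))`, which dominates all the summands of the local
polynomial estimator. -/
def kernelEnvelope {d : ℕ} (β : ℝ) (K : Obs d → ℝ) (u : Obs d) : ℝ := K u * (1 + ‖u‖ ^ (2 * β))

section Kernel

variable {d ℓ : ℕ} {β c : ℝ} {K : Obs d → ℝ}

lemma IsKernel.le_apply (hK : IsKernel β ℓ c K) {u : Obs d} (hu : ‖u‖ ≤ c) : c ≤ K u := by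
  simpa [Set.indicator_apply, hu] using hK.lower u

lemma IsKernel.nonneg (hK : IsKernel β ℓ c K) (hc : 0 < c) (u : Obs d) : 0 ≤ K u :=
  (Set.indicator_nonneg (fun _ _ => hc.le) u).trans (hK.lower u)

lemma kernelEnvelope_nonneg (hK : IsKernel β ℓ c K) (hc : 0 < c) (u : Obs d) :
    0 ≤ kernelEnvelope β K u := mul_nonneg (hK.nonneg hc u) (by positivity)

lemma exists_kernelEnvelope_le (hK : IsKernel β ℓ c K) :
    ∃ M : ℝ, 0 < M ∧ ∀ u, kernelEnvelope β K u ≤ M := by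
  obtain ⟨M, hM⟩ := hK.bounded
  refine ⟨max M 1, by positivity, fun u => le_max_of_le_left ?_⟩
  rw [kernelEnvelope, mul_comm]
  exact hM ⟨u, rfl⟩

lemma measurable_kernelEnvelope (hK : IsKernel β ℓ c K) : Measurable (kernelEnvelope β K) :=
  hK.measurable.mul (measurable_const.add (measurable_norm.pow_const _))

lemma integrable_kernelEnvelope_sq (hK : IsKernel β ℓ c K) :
    Integrable fun u => kernelEnvelope β K u ^ 2 := by
  refine (hK.square.const_mul 2).mono'
    ((measurable_kernelEnvelope hK).pow_const 2).aestronglyMeasurable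
    (ae_of_all _ fun u => ?_)
  have h1 : ‖u‖ ^ (4 * β) = (‖u‖ ^ (2 * β)) ^ 2 := by
    rw [← Real.rpow_natCast (‖u‖ ^ (2 * β)) 2, ← Real.rpow_mul (norm_nonneg _)]
    congr 1; push_cast; ring
  rw [Real.norm_of_nonneg (sq_nonneg _), kernelEnvelope, mul_pow, h1]
  nlinarith [mul_nonneg (sq_nonneg (K u)) (sq_nonneg (1 - ‖u‖ ^ (2 * β)))]

lemma kernel_mul_le_envelope (hK : IsKernel β ℓ c K) (hc : 0 < c) {u : Obs d} {y b : ℝ}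
    (hy : |y| ≤ b * (1 + ‖u‖ ^ (2 * β))) : |K u * y| ≤ b * kernelEnvelope β K u := by
  rw [abs_mul, abs_of_nonneg (hK.nonneg hc u), kernelEnvelope]
  nlinarith [mul_le_mul_of_nonneg_left hy (hK.nonneg hc u)]

lemma norm_pow_le_one_add (hℓ : (ℓ : ℝ) ≤ β) {k : ℕ} (hk : k ≤ 2 * ℓ) (u : Obs d) :
    ‖u‖ ^ k ≤ 1 + ‖u‖ ^ (2 * β) := by
  rw [← Real.rpow_natCast]
  refine rpow_le_one_add_rpow (norm_nonneg _) (by positivity) ?_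
  have : (k : ℝ) ≤ 2 * ℓ := by exact_mod_cast hk
  linarith

lemma abs_monom_mul_monom_le (hℓ : (ℓ : ℝ) ≤ β) (s t : Expo d ℓ) (u : Obs d) :
    |monom s.1 u * monom t.1 u| ≤ 1 + ‖u‖ ^ (2 * β) := by
  have hs := s.2
  have ht := t.2
  rw [abs_mul]
  calc |monom s.1 u| * |monom t.1 u| ≤ ‖u‖ ^ s.1.degree * ‖u‖ ^ t.1.degree :=
        mul_le_mul (abs_monom_le _ _) (abs_monom_le _ _) (abs_nonneg _) (by positivity)
    _ = ‖u‖ ^ (s.1.degree + t.1.degree) := (pow_add _ _ _).symm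
    _ ≤ _ := norm_pow_le_one_add hℓ (by omega) u

lemma norm_rpow_mul_one_add_le (hβ : 0 < β) (hℓ : (ℓ : ℝ) ≤ β) (u : Obs d) :
    ‖u‖ ^ β * (1 + ‖u‖ ^ ℓ) ≤ 2 * (1 + ‖u‖ ^ (2 * β)) := by
  have h1 : ‖u‖ ^ β * ‖u‖ ^ ℓ = ‖u‖ ^ (β + ℓ) := by
    rw [← Real.rpow_natCast, Real.rpow_add_of_nonneg (norm_nonneg _) hβ.le (by positivity)]
  have h2 := rpow_le_one_add_rpow (norm_nonneg u) hβ.le (by linarith : β ≤ 2 * β)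
  have h3 := rpow_le_one_add_rpow (norm_nonneg u) (by positivity : 0 ≤ β + ℓ)
    (by linarith : β + ℓ ≤ 2 * β)
  rw [mul_add, mul_one, h1]
  linarith

lemma integrable_kernel (hK : IsKernel β ℓ c K) : Integrable K := by
  by_contra h
  have := hK.integral_eq_one
  rw [integral_undef h] at this
  exact zero_ne_one this

lemma integrable_kernel_mul_norm_rpow (hK : IsKernel β ℓ c K) (hc : 0 < c) (hβ : 0 < β) :
    Integrable fun u : Obs d => K u * (‖u‖ ^ β * (1 + ‖u‖ ^ ℓ)) := by
  refine ((integrable_kernel hK).add (hK.moment.const_mul 2)).mono' ?_ (ae_of_all _ fun u => ?_)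
  · exact (hK.measurable.mul ((measurable_norm.pow_const _).mul
      (measurable_const.add (measurable_norm.pow_const _)))).aestronglyMeasurable
  · have hK0 := hK.nonneg hc u
    have h1 : ‖u‖ ^ β * ‖u‖ ^ ℓ = ‖u‖ ^ (β + ℓ) := by
      rw [← Real.rpow_natCast, Real.rpow_add_of_nonneg (norm_nonneg _) hβ.le (by positivity)]
    have h2 := rpow_le_one_add_rpow (norm_nonneg u) hβ.le
      (by linarith [(Nat.cast_nonneg ℓ : (0 : ℝ) ≤ ℓ)] : β ≤ β + ℓ)
    rw [Real.norm_of_nonneg (by positivity), mul_add, mul_one, h1]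
    simp only [Pi.add_apply]
    nlinarith [mul_le_mul_of_nonneg_left h2 hK0]

end Kernel

/-! ### The pointwise excess risk -/

section Pointwise

variable {d m : ℕ}

/-- Summand of an entry of the Gram matrix of the rescaled monomials at `x`. -/
def gramTerm {ℓ : ℕ} (K : Obs d → ℝ) (h : ℝ) (x : Obs d) (s t : Expo d ℓ)
    (z : Obs d × Fin m) : ℝ :=
  K (h⁻¹ • (z.1 - x)) * (monom s.1 (h⁻¹ • (z.1 - x)) * monom t.1 (h⁻¹ • (z.1 - x)))

/-- Summand of the stochastic error of class `j`: it has conditional mean zero given the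
observation. -/
def noiseTerm {ℓ : ℕ} (K : Obs d → ℝ) (h : ℝ) (x : Obs d) (η : Fin m → Obs d → ℝ)
    (s : Expo d ℓ) (j : Fin m) (z : Obs d × Fin m) : ℝ :=
  K (h⁻¹ • (z.1 - x)) * (monom s.1 (h⁻¹ • (z.1 - x)) * ((if z.2 = j then 1 else 0) - η j z.1))

/-- Summand of the bound for the approximation error by Taylor polynomials; it serves all classes
at the same time. -/
def biasTerm (ℓ : ℕ) (β : ℝ) (K : Obs d → ℝ) (h : ℝ) (x : Obs d) (z : Obs d × Fin m) : ℝ :=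
  K (h⁻¹ • (z.1 - x)) * (‖h⁻¹ • (z.1 - x)‖ ^ β * (1 + ‖h⁻¹ • (z.1 - x)‖ ^ ℓ))

lemma abs_clip_sub_le {a b : ℝ} (h0 : 0 ≤ b) (h1 : b ≤ 1) : |max 0 (min 1 a) - b| ≤ |a - b| := by
  have e : b = max 0 (min 1 b) := by rw [min_eq_right h1, max_eq_right h0]
  conv_lhs => rw [e]
  calc |max 0 (min 1 a) - max 0 (min 1 b)| ≤ max |0 - 0| |min 1 a - min 1 b| :=
        abs_max_sub_max_le_max _ _ _ _
    _ = |min 1 a - min 1 b| := by simp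
    _ ≤ max |1 - 1| |a - b| := abs_min_sub_min_le_max _ _ _ _
    _ = |a - b| := by simp

/-- The error of the estimator of one class probability. -/
lemma abs_classEstimator_sub_le {ℓ n : ℕ} {β L h κ hd : ℝ} {K : Obs d → ℝ}
    (hK0 : ∀ u, 0 ≤ K u) (hh : 0 < h) (hκ : 0 < κ) (hhd : 0 < hd) (hn : 0 < n)
    {η : Fin m → Obs d → ℝ} (D : Fin n → Obs d × Fin m) (x : Obs d)
    (hgram : ∀ a : Expo d ℓ → ℝ, κ * ∑ s, a s ^ 2 ≤ ∑ s, ∑ t, a s * a t *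
      ((n * hd)⁻¹ * ∑ i, gramTerm K h x s t (D i))) {j : Fin m} (hη : η j ∈ HolderClass β ℓ L)
    (h0 : 0 ≤ η j x) (h1 : η j x ≤ 1) :
    |classEstimator ℓ K h D j x - η j x| ≤ κ⁻¹ * (∑ s : Expo d ℓ,
      |(n * hd)⁻¹ * ∑ i, noiseTerm K h x η s j (D i)| +
      Fintype.card (Expo d ℓ) * (L * h ^ β * ((n * hd)⁻¹ * ∑ i, biasTerm ℓ β K h x (D i)))) := by
  obtain ⟨θ, hθ, hθv⟩ := exists_polynomial_eval_eq_taylorPoly ℓ (η j) x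
  have hn' : (0 : ℝ) < n := by exact_mod_cast hn
  have hc : 0 < ((n : ℝ) * hd)⁻¹ := by positivity
  have hval : MvPolynomial.eval (fun _ => 0) θ = η j x := by
    have := hθv 0
    rw [add_zero, taylorPoly_self] at this
    simpa using this
  have hlp := abs_lpEstimator_sub_le (K := K) (h := h) hh.ne' (X := fun i => (D i).1)
    (y := fun i => if (D i).2 = j then 1 else 0) (x := x) hc hκ hgram hθ
  rw [hval] at hlp
  refine (abs_clip_sub_le h0 h1).trans (hlp.trans ?_)
  refine mul_le_mul_of_nonneg_left ?_ (inv_nonneg.2 hκ.le)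
  rw [← nsmul_eq_mul (Fintype.card (Expo d ℓ)), ← Finset.card_univ, ← Finset.sum_const,
    ← Finset.sum_add_distrib]
  refine Finset.sum_le_sum fun s _ => ?_
  have hsplit : ∀ i, K (h⁻¹ • ((D i).1 - x)) * (monom s.1 (h⁻¹ • ((D i).1 - x)) *
      ((if (D i).2 = j then 1 else 0) - MvPolynomial.eval (fun k => ((D i).1 - x) k) θ))
      = noiseTerm K h x η s j (D i) + K (h⁻¹ • ((D i).1 - x)) *
        (monom s.1 (h⁻¹ • ((D i).1 - x)) * (η j (D i).1 - taylorPoly ℓ (η j) x (D i).1)) := by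
    intro i
    rw [hθv, add_sub_cancel, noiseTerm]
    ring
  simp only [hsplit, Finset.sum_add_distrib, mul_add ((n * hd : ℝ)⁻¹)]
  refine (abs_add_le _ _).trans (add_le_add le_rfl ?_)
  rw [abs_mul, abs_of_pos hc, mul_left_comm]
  refine mul_le_mul_of_nonneg_left ?_ hc.le
  rw [Finset.mul_sum]
  refine (Finset.abs_sum_le_sum_abs _ _).trans (Finset.sum_le_sum fun i _ => ?_)
  set u := h⁻¹ • ((D i).1 - x) with hu
  have hres : |η j (D i).1 - taylorPoly ℓ (η j) x (D i).1| ≤ L * h ^ β * ‖u‖ ^ β := by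
    refine (hη.2 x (D i).1).trans (le_of_eq ?_)
    have : ‖x - (D i).1‖ = h * ‖u‖ := by
      rw [hu, norm_smul, norm_inv, Real.norm_of_nonneg hh.le, norm_sub_rev]
      field_simp
    rw [this, Real.mul_rpow hh.le (norm_nonneg _)]
    ring
  have hmon : |monom s.1 u| ≤ 1 + ‖u‖ ^ ℓ := by
    refine (abs_monom_le _ _).trans ?_
    rcases le_total ‖u‖ 1 with h2 | h2
    · have := pow_le_one₀ (n := s.1.degree) (norm_nonneg u) h2
      have := pow_nonneg (norm_nonneg u) ℓ
      linarith
    · have := pow_le_pow_right₀ h2 s.2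
      linarith
  rw [abs_mul, abs_mul, abs_of_nonneg (hK0 u), biasTerm, ← hu]
  calc K u * (|monom s.1 u| * |η j (D i).1 - taylorPoly ℓ (η j) x (D i).1|)
      ≤ K u * ((1 + ‖u‖ ^ ℓ) * (L * h ^ β * ‖u‖ ^ β)) :=
        mul_le_mul_of_nonneg_left (mul_le_mul hmon hres (abs_nonneg _) (by positivity)) (hK0 u)
    _ = _ := by ring

/-- The excess at a point of a plug-in classifier, in terms of the deviations of the Gram matrix
from a positive definite matrix `b`, of the noise of the two classes involved, and of the bias. If
the Gram matrix is off by more than `κ / 2`, the bound holds because the excess is at most one. -/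
lemma excess_le {ℓ n : ℕ} {β L h κ hd : ℝ} {K : Obs d → ℝ} (hL : 0 ≤ L)
    (hK0 : ∀ u, 0 ≤ K u) (hh : 0 < h) (hκ : 0 < κ) (hhd : 0 < hd) (hn : 0 < n)
    {η : Fin m → Obs d → ℝ} (D : Fin n → Obs d × Fin m) (x : Obs d)
    {b : Expo d ℓ → Expo d ℓ → ℝ}
    (hb : ∀ a : Expo d ℓ → ℝ, κ * ∑ s, a s ^ 2 ≤ ∑ s, ∑ t, a s * a t * b s t)
    (hη : ∀ j, η j ∈ HolderClass β ℓ L) (h0 : ∀ j, 0 ≤ η j x) (h1 : ∀ j, η j x ≤ 1)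
    {i₀ j₀ : Fin m} (hj₀ : ∀ j, classEstimator ℓ K h D j x ≤ classEstimator ℓ K h D j₀ x) :
    η i₀ x - η j₀ x ≤ 2 / κ * (∑ s, ∑ t, |(n * hd)⁻¹ * ∑ i, gramTerm K h x s t (D i) - b s t|
      + ∑ s : Expo d ℓ, |(n * hd)⁻¹ * ∑ i, noiseTerm K h x η s i₀ (D i)|
      + ∑ s : Expo d ℓ, |(n * hd)⁻¹ * ∑ i, noiseTerm K h x η s j₀ (D i)|
      + 2 * Fintype.card (Expo d ℓ) * L * h ^ β *
        ((n * hd)⁻¹ * ∑ i, biasTerm ℓ β K h x (D i))) := by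
  set B : Expo d ℓ → Expo d ℓ → ℝ := fun s t => (n * hd)⁻¹ * ∑ i, gramTerm K h x s t (D i) with hB
  set S : Fin m → ℝ := fun j => ∑ s : Expo d ℓ,
    |(n * hd)⁻¹ * ∑ i, noiseTerm K h x η s j (D i)| with hS
  set W : ℝ := (n * hd)⁻¹ * ∑ i, biasTerm ℓ β K h x (D i) with hW
  set N : ℝ := (Fintype.card (Expo d ℓ) : ℝ) with hN
  have hS0 : ∀ j, 0 ≤ S j := fun j => Finset.sum_nonneg fun _ _ => abs_nonneg _
  have hW0 : 0 ≤ W := mul_nonneg (by positivity) (Finset.sum_nonneg fun i _ =>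
    mul_nonneg (hK0 _) (by positivity))
  have hbias : 0 ≤ 2 * N * L * h ^ β * W := by positivity
  set Δ : ℝ := ∑ s, ∑ t, |B s t - b s t| with hΔ
  have hΔ0 : 0 ≤ Δ := Finset.sum_nonneg fun _ _ => Finset.sum_nonneg fun _ _ => abs_nonneg _
  change η i₀ x - η j₀ x ≤ 2 / κ * (Δ + S i₀ + S j₀ + 2 * N * L * h ^ β * W)
  rcases le_or_gt Δ (κ / 2) with hcase | hcase
  · have hgram : ∀ a : Expo d ℓ → ℝ, κ / 2 * ∑ s, a s ^ 2 ≤ ∑ s, ∑ t, a s * a t * B s t := by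
      intro a
      set q : ℝ := ∑ s, a s ^ 2 with hq
      have hq0 : 0 ≤ q := Finset.sum_nonneg fun _ _ => sq_nonneg _
      have haq : ∀ s, a s ^ 2 ≤ q := fun s =>
        Finset.single_le_sum (f := fun s => a s ^ 2) (fun _ _ => sq_nonneg _) (Finset.mem_univ s)
      have hdiff : ∑ s, ∑ t, a s * a t * b s t - ∑ s, ∑ t, a s * a t * B s t ≤ q * Δ := by
        rw [hΔ, Finset.mul_sum, ← Finset.sum_sub_distrib]
        refine Finset.sum_le_sum fun s _ => ?_
        rw [Finset.mul_sum, ← Finset.sum_sub_distrib]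
        refine Finset.sum_le_sum fun t _ => ?_
        have h3 : |a s * a t| ≤ q := by
          rw [abs_mul]
          nlinarith [haq s, haq t, sq_abs (a s), sq_abs (a t), sq_nonneg (|a s| - |a t|)]
        calc a s * a t * b s t - a s * a t * B s t ≤ |a s * a t * (b s t - B s t)| := by
              rw [← mul_sub]; exact le_abs_self _
          _ = |a s * a t| * |B s t - b s t| := by rw [abs_mul, abs_sub_comm]
          _ ≤ q * |B s t - b s t| := mul_le_mul_of_nonneg_right h3 (abs_nonneg _)
      have h4 := hb a
      nlinarith
    have hest := fun j => abs_classEstimator_sub_le hK0 hh (by positivity : 0 < κ / 2) hhd hn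
      D x hgram (hη j) (h0 j) (h1 j)
    have e1 := (abs_le.1 (hest i₀)).1
    have e2 := (abs_le.1 (hest j₀)).2
    have e3 := hj₀ i₀
    rw [inv_div] at e1 e2
    calc η i₀ x - η j₀ x ≤ 2 / κ * (S i₀ + N * (L * h ^ β * W))
          + 2 / κ * (S j₀ + N * (L * h ^ β * W)) := by linarith
      _ = 2 / κ * (S i₀ + S j₀ + 2 * N * L * h ^ β * W) := by ring
      _ ≤ _ := mul_le_mul_of_nonneg_left (by linarith) (by positivity)
  · have e1 : η i₀ x - η j₀ x ≤ 1 := by linarith [h1 i₀, h0 j₀]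
    refine e1.trans ?_
    rw [div_mul_eq_mul_div, le_div_iff₀ hκ]
    linarith [hS0 i₀, hS0 j₀]

end Pointwise

/-! ### Moments of the pointwise excess risk -/

/-- All the families of summands dominated by the envelope of the kernel satisfy the same moment
bound at all points. -/
lemma exists_localized_moment_const {d ℓ : ℕ} {β c C₁ μmax : ℝ} {K : Obs d → ℝ}
    (hK : IsKernel β ℓ c K) (hc : 0 < c) (hC₁ : 0 ≤ C₁) (hμmax : 0 ≤ μmax) {k : ℕ} (hk : k ≠ 0) :
    ∃ C : ℝ, 0 ≤ C ∧ ∀ {m : ℕ} {P : Measure (Obs d × Fin m)} [IsProbabilityMeasure P]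
      {μ : Obs d → ℝ}, P.map Prod.fst = volume.withDensity (fun x => ENNReal.ofReal (μ x)) →
      (∀ x, μ x ≤ μmax) →
      ∀ {Ω : Type*} [MeasurableSpace Ω] {Pr : Measure Ω} [IsProbabilityMeasure Pr]
        {Z : ℕ → Ω → Obs d × Fin m}, (∀ i, Measurable (Z i)) → (∀ i, Pr.map (Z i) = P) →
      ∀ {h ε : ℝ} {n a N : ℕ}, 0 < h → SampleScheme Pr Z C₁ (h ^ d) ε n a N →
      ∀ (x : Obs d) {J : Type} [Fintype J] {ξ : J → Obs d × Fin m → ℝ}, (∀ j, Measurable (ξ j)) →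
      (∀ᵐ z ∂P, ∑ j, |ξ j z| ≤ 2 * kernelEnvelope β K (h⁻¹ • (z.1 - x))) →
      (∀ j, Integrable (fun ω => ((n * h ^ d)⁻¹ * ∑ i ∈ Finset.range n, ξ j (Z i ω)
        - (h ^ d)⁻¹ * ∫ z, ξ j z ∂P) ^ (2 * k)) Pr) ∧
      ∑ j, ∫ ω, ((n * h ^ d)⁻¹ * ∑ i ∈ Finset.range n, ξ j (Z i ω)
        - (h ^ d)⁻¹ * ∫ z, ξ j z ∂P) ^ (2 * k) ∂Pr ≤ C * ε ^ (2 * k) := by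
  obtain ⟨M, hM, hΦM⟩ := exists_kernelEnvelope_le hK
  set V : ℝ := μmax * (4 * ∫ u, kernelEnvelope β K u ^ 2) with hVdef
  refine ⟨(2 * k).factorial * Real.exp (V / (8 * (2 * M) ^ 2) + 8 * C₁) * (4 * (2 * M)) ^ (2 * k),
    by positivity, ?_⟩
  intro m P _ μ hQ hμ Ω _ Pr _ Z hZ hP h ε n a N hh hs x J _ ξ hξ hdom
  refine sum_integral_localized_mean_pow_le hZ hP hC₁ hs (by positivity : 0 < 2 * M) hξ
    (hdom.mono fun z hz => hz.trans (by linarith [hΦM (h⁻¹ • (z.1 - x))])) ?_ hk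
  obtain ⟨hint, hle⟩ := integral_localize_le hh x hμmax hQ hμ
    (F := fun u => 4 * kernelEnvelope β K u ^ 2) (fun u => by positivity)
    ((integrable_kernelEnvelope_sq hK).const_mul 4)
  have hint' : Integrable
      (fun z : Obs d × Fin m => 4 * kernelEnvelope β K (h⁻¹ • (z.1 - x)) ^ 2) P :=
    hint.comp_measurable measurable_fst
  have hpt : ∀ᵐ z ∂P, ∑ j, ξ j z ^ 2 ≤ 4 * kernelEnvelope β K (h⁻¹ • (z.1 - x)) ^ 2 := by
    filter_upwards [hdom] with z hz
    have hΦ0 := kernelEnvelope_nonneg hK hc (h⁻¹ • (z.1 - x))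
    calc ∑ j, ξ j z ^ 2 ≤ ∑ j, |ξ j z| * (2 * kernelEnvelope β K (h⁻¹ • (z.1 - x))) := by
          refine Finset.sum_le_sum fun j _ => ?_
          rw [← sq_abs, sq]
          exact mul_le_mul_of_nonneg_left (abs_le_of_sum_abs_le hz j) (abs_nonneg _)
      _ ≤ 2 * kernelEnvelope β K (h⁻¹ • (z.1 - x)) *
            (2 * kernelEnvelope β K (h⁻¹ • (z.1 - x))) := by
          rw [← Finset.sum_mul]
          exact mul_le_mul_of_nonneg_right hz (by positivity)
      _ = _ := by ring
  have hsqi : ∀ j, Integrable (fun z => ξ j z ^ 2) P := fun j => by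
    refine hint'.mono' ((hξ j).pow_const 2).aestronglyMeasurable (hpt.mono fun z hz => ?_)
    rw [Real.norm_of_nonneg (sq_nonneg _)]
    exact (Finset.single_le_sum (f := fun j => ξ j z ^ 2) (fun _ _ => sq_nonneg _)
      (Finset.mem_univ j)).trans hz
  rw [← integral_finsetSum _ fun j _ => hsqi j]
  refine (integral_mono_ae (integrable_finsetSum _ fun j _ => hsqi j) hint' hpt).trans ?_
  rw [integral_map measurable_fst.aemeasurable hint.aestronglyMeasurable,
    integral_const_mul (4 : ℝ) (fun u : Obs d => kernelEnvelope β K u ^ 2)] at hle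
  refine hle.trans (le_of_eq ?_)
  rw [hVdef]
  ring

lemma add_pow_le_two_pow {a b : ℝ} (ha : 0 ≤ a) (hb : 0 ≤ b) (p : ℕ) :
    (a + b) ^ p ≤ 2 ^ p * (a ^ p + b ^ p) := by
  refine (add_pow_le ha hb p).trans (mul_le_mul_of_nonneg_right ?_ (by positivity))
  exact pow_le_pow_right₀ one_le_two (Nat.sub_le p 1)

lemma sum_pow_le_card_pow {ι : Type*} [Fintype ι] {x : ι → ℝ} (hx : ∀ i, 0 ≤ x i) {p : ℕ}
    (hp : p ≠ 0) : (∑ i, x i) ^ p ≤ (Fintype.card ι : ℝ) ^ p * ∑ i, x i ^ p := by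
  rcases isEmpty_or_nonempty ι with h | h
  · simp [hp]
  obtain ⟨i₀, -, hi₀⟩ := Finset.exists_max_image Finset.univ x Finset.univ_nonempty
  have h1 : ∑ i, x i ≤ Fintype.card ι * x i₀ := by
    calc ∑ i, x i ≤ ∑ _i : ι, x i₀ := Finset.sum_le_sum fun i hi => hi₀ i hi
      _ = _ := by simp
  calc (∑ i, x i) ^ p ≤ (Fintype.card ι * x i₀) ^ p :=
        pow_le_pow_left₀ (Finset.sum_nonneg fun i _ => hx i) h1 p
    _ = (Fintype.card ι : ℝ) ^ p * x i₀ ^ p := mul_pow _ _ _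
    _ ≤ _ := mul_le_mul_of_nonneg_left (Finset.single_le_sum (f := fun i => x i ^ p)
        (fun i _ => pow_nonneg (hx i) p) (Finset.mem_univ i₀)) (by positivity)

section Measurability

variable {d m ℓ : ℕ} {β c : ℝ} {K : Obs d → ℝ}

lemma measurable_localize (h : ℝ) (x : Obs d) :
    Measurable fun z : Obs d × Fin m => h⁻¹ • (z.1 - x) :=
  (measurable_fst.sub_const x).const_smul h⁻¹

lemma measurable_gramTerm (hK : Measurable K) (h : ℝ) (x : Obs d) (s t : Expo d ℓ) :
    Measurable (gramTerm (m := m) K h x s t) :=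
  (hK.comp (measurable_localize h x)).mul
    (((measurable_monom s.1).comp (measurable_localize h x)).mul
    ((measurable_monom t.1).comp (measurable_localize h x)))

lemma measurable_noiseTerm (hK : Measurable K) (h : ℝ) (x : Obs d) {η : Fin m → Obs d → ℝ}
    (hη : ∀ j, Measurable (η j)) (s : Expo d ℓ) (j : Fin m) :
    Measurable (noiseTerm K h x η s j) :=
  (hK.comp (measurable_localize h x)).mul
    (((measurable_monom s.1).comp (measurable_localize h x)).mul
    ((Measurable.ite (measurableSet_class j) measurable_const measurable_const).sub
      ((hη j).comp measurable_fst)))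

lemma measurable_biasTerm (hK : Measurable K) (h : ℝ) (x : Obs d) :
    Measurable (biasTerm (m := m) ℓ β K h x) :=
  (hK.comp (measurable_localize h x)).mul (((measurable_localize h x).norm.pow_const β).mul
    (measurable_const.add ((measurable_localize h x).norm.pow_const ℓ)))

lemma integral_noiseTerm_eq_zero {P : Measure (Obs d × Fin m)} [IsProbabilityMeasure P]
    (hK : IsKernel β ℓ c K) (hc : 0 < c) (hℓ : (ℓ : ℝ) ≤ β) (h : ℝ) (x : Obs d)
    {η : Fin m → Obs d → ℝ} {j : Fin m} (hη : IsCondProb P j (η j)) (s : Expo d ℓ) :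
    ∫ z, noiseTerm K h x η s j z ∂P = 0 := by
  obtain ⟨M, -, hM⟩ := exists_kernelEnvelope_le hK
  set F : Obs d → ℝ := fun x' => K (h⁻¹ • (x' - x)) * monom s.1 (h⁻¹ • (x' - x)) with hF
  have hτ : Measurable fun x' : Obs d => h⁻¹ • (x' - x) := by fun_prop
  have hFm : Measurable F := (hK.measurable.comp hτ).mul ((measurable_monom s.1).comp hτ)
  have hFb : ∀ x', |F x'| ≤ M := by
    intro x'
    refine (kernel_mul_le_envelope hK hc (b := 1) ?_).trans (by linarith [hM (h⁻¹ • (x' - x))])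
    rw [one_mul]
    exact (abs_monom_le _ _).trans (norm_pow_le_one_add hℓ (by linarith [s.2]) _)
  obtain ⟨h1, h2⟩ := integral_mul_indicator_sub_condProb hη hFm hFb
  have h3 : Integrable (fun z : Obs d × Fin m => F z.1 *
      Set.indicator {z : Obs d × Fin m | z.2 = j} (fun _ => (1 : ℝ)) z) P :=
    ((integrable_const (1 : ℝ)).indicator (measurableSet_class j)).bdd_mul
      (hFm.comp measurable_fst).aestronglyMeasurable
      (ae_of_all _ fun z => (hFb z.1 : ‖F z.1‖ ≤ M))
  have h4 : ∀ z, noiseTerm K h x η s j z = F z.1 *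
      Set.indicator {z : Obs d × Fin m | z.2 = j} (fun _ => (1 : ℝ)) z - F z.1 * η j z.1 := by
    intro z
    simp only [noiseTerm, hF, Set.indicator_apply, Set.mem_ofPred_eq]
    ring
  simp only [h4]
  rw [integral_sub h3 h1, h2, sub_self]

end Measurability

/-- The moments of the excess of the plug-in classifier at a point of the support are of the order
of the powers of `h ^ β`, with a constant that depends on the smoothness, density, kernel and mixing
parameters only. The noise of the two classes involved is bounded by the sum over all classes. -/
lemma exists_excess_moment_const {d ℓ : ℕ} {β L c c₀ r₀ μmin μmax C₁ : ℝ} {K : Obs d → ℝ}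
    (hβ : 0 < β) (hℓ : (ℓ : ℝ) ≤ β) (hL : 0 ≤ L) (hK : IsKernel β ℓ c K) (hc : 0 < c)
    (hc₀ : 0 < c₀) (hμmin : 0 < μmin) (hμmax : 0 ≤ μmax) (hC₁ : 0 ≤ C₁) {k : ℕ} (hk : k ≠ 0) :
    ∃ C : ℝ, 0 ≤ C ∧ ∀ {m : ℕ} {P : Measure (Obs d × Fin m)} [IsProbabilityMeasure P]
      {η : Fin m → Obs d → ℝ}, (∀ j, IsCondProb P j (η j)) → (∀ j, η j ∈ HolderClass β ℓ L) →
      ∀ {A : Set (Obs d)} {μ : Obs d → ℝ}, IsCompact A → IsRegularSet c₀ r₀ A →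
      P.map Prod.fst = volume.withDensity (fun x => ENNReal.ofReal (μ x)) →
      (∀ x ∈ A, μmin ≤ μ x) → (∀ x, μ x ≤ μmax) →
      ∀ {Ω : Type*} [MeasurableSpace Ω] {Pr : Measure Ω} [IsProbabilityMeasure Pr]
        {Z : ℕ → Ω → Obs d × Fin m}, (∀ i, Measurable (Z i)) → (∀ i, Pr.map (Z i) = P) →
      ∀ {h : ℝ} {n a N : ℕ}, 0 < h → h * c ≤ r₀ → SampleScheme Pr Z C₁ (h ^ d) (h ^ β) n a N →
      ∀ x ∈ A, (∀ j, 0 ≤ η j x) → (∀ j, η j x ≤ 1) →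
      ∀ (i₀ : Fin m) (j₀ : Ω → Fin m), (∀ j, η j x ≤ η i₀ x) →
      (∀ ω j, classEstimator ℓ K h (fun i : Fin n => Z i ω) j x ≤
        classEstimator ℓ K h (fun i : Fin n => Z i ω) (j₀ ω) x) →
      ∫⁻ ω, ENNReal.ofReal ((η i₀ x - η (j₀ ω) x) ^ (2 * k)) ∂Pr ≤
        ENNReal.ofReal (C * (h ^ β) ^ (2 * k)) := by
  obtain ⟨C, hC, hmom⟩ := exists_localized_moment_const hK hc hC₁ hμmax hk
  obtain ⟨κ, hκ, hgram⟩ := exists_gram_lower_bound (d := d) ℓ (r₀ := r₀) hc hc₀ hμmin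
  set w : ℝ := μmax * ∫ u : Obs d, K u * (‖u‖ ^ β * (1 + ‖u‖ ^ ℓ)) with hw
  have hK0 := hK.nonneg hc
  have hw0 : 0 ≤ w := mul_nonneg hμmax (integral_nonneg fun u => mul_nonneg (hK0 u) (by positivity))
  set N₁ : ℝ := (Fintype.card (Expo d ℓ) : ℝ) with hN₁
  set p : ℕ := 2 * k with hp
  have hp0 : p ≠ 0 := by omega
  refine ⟨(2 / κ) ^ p * (4 ^ p * (N₁ ^ p * N₁ ^ p * (N₁ * (N₁ * C)) + 2 * (N₁ ^ p * (N₁ * C))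
    + (2 * N₁ * L) ^ p * (2 ^ p * (C + w ^ p)))), by positivity, ?_⟩
  intro m P _ η hη hηH A μ hA hreg hQ hμA hμb Ω _ Pr _ Z hZ hP h n a N hh hhc hs x hx h0 h1 i₀ j₀
    hi₀ hj₀
  have hε1 := hs.ε_le_one
  have hn := hs.n_pos
  have hhd := hs.hd_pos
  set ε : ℝ := h ^ β with hε
  have hε0 : 0 < ε := hs.ε_pos
  have hηm : ∀ j, Measurable (η j) := fun j => (hηH j).1.continuous.measurable
  -- the four kinds of terms, as functions on the probability space
  set b : Expo d ℓ → Expo d ℓ → ℝ := fun s t => (h ^ d)⁻¹ * ∫ z, gramTerm K h x s t z ∂P with hb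
  set Γ : Expo d ℓ → Expo d ℓ → Ω → ℝ := fun s t ω =>
    (n * h ^ d)⁻¹ * ∑ i ∈ Finset.range n, gramTerm K h x s t (Z i ω) - b s t with hΓ
  set S : Expo d ℓ → Fin m → Ω → ℝ := fun s j ω =>
    (n * h ^ d)⁻¹ * ∑ i ∈ Finset.range n, noiseTerm K h x η s j (Z i ω) with hS
  set eW : ℝ := (h ^ d)⁻¹ * ∫ z, biasTerm ℓ β K h x z ∂P with heW
  set W : Ω → ℝ := fun ω =>
    (n * h ^ d)⁻¹ * ∑ i ∈ Finset.range n, biasTerm ℓ β K h x (Z i ω) with hWdef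
  -- domination by the envelope
  have hgramdom : ∀ s t z, |gramTerm (m := m) K h x s t z|
      ≤ kernelEnvelope β K (h⁻¹ • (z.1 - x)) := fun s t z =>
    (kernel_mul_le_envelope hK hc (b := 1) (by
      rw [one_mul]; exact abs_monom_mul_monom_le hℓ s t _)).trans_eq (one_mul _)
  have hbiasdom : ∀ z, |biasTerm (m := m) ℓ β K h x z|
      ≤ 2 * kernelEnvelope β K (h⁻¹ • (z.1 - x)) := fun z =>
    kernel_mul_le_envelope hK hc (by
      rw [abs_of_nonneg (by positivity)]; exact norm_rpow_mul_one_add_le hβ hℓ _)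
  have hnoisedom : ∀ s : Expo d ℓ, ∀ᵐ z ∂P, ∑ j, |noiseTerm K h x η s j z|
      ≤ 2 * kernelEnvelope β K (h⁻¹ • (z.1 - x)) := by
    intro s
    filter_upwards [ae_condProb_nonneg hη, ae_sum_condProb_eq_one hη] with z hz0 hz1
    set u := h⁻¹ • (z.1 - x) with hu
    have hsum : ∑ j, |(if z.2 = j then (1 : ℝ) else 0) - η j z.1| ≤ 2 := by
      calc ∑ j, |(if z.2 = j then (1 : ℝ) else 0) - η j z.1|
          ≤ ∑ j, ((if z.2 = j then (1 : ℝ) else 0) + η j z.1) := by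
            refine Finset.sum_le_sum fun j _ => (abs_sub _ _).trans (le_of_eq ?_)
            rw [abs_of_nonneg (hz0 j), abs_of_nonneg (by split_ifs <;> norm_num)]
        _ = 2 := by rw [Finset.sum_add_distrib, hz1]; simp; norm_num
    have hmon : |monom s.1 u| ≤ 1 + ‖u‖ ^ (2 * β) :=
      (abs_monom_le _ _).trans (norm_pow_le_one_add hℓ (by linarith [s.2]) _)
    have hΦ := kernel_mul_le_envelope hK hc (b := 1) (by rwa [one_mul])
    rw [one_mul] at hΦ
    calc ∑ j, |noiseTerm K h x η s j z|
        = |K u * monom s.1 u| * ∑ j, |(if z.2 = j then (1 : ℝ) else 0) - η j z.1| := by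
          rw [Finset.mul_sum]
          refine Finset.sum_congr rfl fun j _ => ?_
          rw [← abs_mul, noiseTerm, mul_assoc]
      _ ≤ kernelEnvelope β K u * 2 :=
          mul_le_mul hΦ hsum (Finset.sum_nonneg fun _ _ => abs_nonneg _)
            (kernelEnvelope_nonneg hK hc u)
      _ = _ := mul_comm _ _
  -- their moments
  have hΓmom : ∀ s t, Integrable (fun ω => Γ s t ω ^ p) Pr ∧ ∫ ω, Γ s t ω ^ p ∂Pr ≤ C * ε ^ p := by
    intro s t
    obtain ⟨i1, i2⟩ := hmom hQ hμb hZ hP hh hs x (J := Unit) (ξ := fun _ => gramTerm K h x s t)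
      (fun _ => measurable_gramTerm hK.measurable h x s t) (ae_of_all _ fun z => by
        have := hgramdom s t z
        have := kernelEnvelope_nonneg hK hc (h⁻¹ • (z.1 - x))
        simp only [Finset.univ_unique, Finset.sum_singleton]
        linarith)
    refine ⟨i1 (), ?_⟩
    simpa only [Finset.univ_unique, Finset.sum_singleton] using i2
  have hSmom : ∀ s, (∀ j, Integrable (fun ω => S s j ω ^ p) Pr) ∧
      ∑ j, ∫ ω, S s j ω ^ p ∂Pr ≤ C * ε ^ p := by
    intro s
    have := hmom hQ hμb hZ hP hh hs x (J := Fin m) (ξ := noiseTerm K h x η s)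
      (measurable_noiseTerm hK.measurable h x hηm s) (hnoisedom s)
    simpa only [integral_noiseTerm_eq_zero hK hc hℓ h x (hη _) s, mul_zero, sub_zero] using this
  have hWmom : Integrable (fun ω => (W ω - eW) ^ p) Pr ∧
      ∫ ω, (W ω - eW) ^ p ∂Pr ≤ C * ε ^ p := by
    obtain ⟨i1, i2⟩ := hmom hQ hμb hZ hP hh hs x (J := Unit) (ξ := fun _ => biasTerm ℓ β K h x)
      (fun _ => measurable_biasTerm hK.measurable h x) (ae_of_all _ fun z => by
        simpa only [Finset.univ_unique, Finset.sum_singleton] using hbiasdom z)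
    refine ⟨i1 (), ?_⟩
    simpa only [Finset.univ_unique, Finset.sum_singleton] using i2
  have heW0 : 0 ≤ eW := mul_nonneg (by positivity) (integral_nonneg fun z =>
    mul_nonneg (hK0 _) (by positivity))
  have heWw : eW ≤ w := by
    obtain ⟨i1, i2⟩ := integral_localize_le hh x hμmax hQ hμb
      (F := fun u => K u * (‖u‖ ^ β * (1 + ‖u‖ ^ ℓ)))
      (fun u => mul_nonneg (hK0 u) (by positivity)) (integrable_kernel_mul_norm_rpow hK hc hβ)
    rw [integral_map measurable_fst.aemeasurable i1.aestronglyMeasurable] at i2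
    rw [heW, inv_mul_le_iff₀ hhd]
    refine i2.trans (le_of_eq ?_)
    rw [hw]; ring
  have hW0 : ∀ ω, 0 ≤ W ω := fun ω => mul_nonneg (by positivity)
    (Finset.sum_nonneg fun i _ => mul_nonneg (hK0 _) (by positivity))
  -- the expected Gram matrix
  obtain ⟨M, -, hM⟩ := exists_kernelEnvelope_le hK
  have hgrami : ∀ s t, Integrable (gramTerm (m := m) K h x s t) P := fun s t =>
    Integrable.of_bound (measurable_gramTerm hK.measurable h x s t).aestronglyMeasurable M
      (ae_of_all _ fun z => (hgramdom s t z).trans (hM _))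
  have hbgram : ∀ a : Expo d ℓ → ℝ, κ * ∑ s, a s ^ 2 ≤ ∑ s, ∑ t, a s * a t * b s t := by
    intro a
    set F : Obs d → ℝ := fun x' => K (h⁻¹ • (x' - x)) * polyFun a (h⁻¹ • (x' - x)) ^ 2 with hF
    have hτ : Measurable fun x' : Obs d => h⁻¹ • (x' - x) := by fun_prop
    have hFm : Measurable F := (hK.measurable.comp hτ).mul
      (((continuous_polyFun a).measurable.comp hτ).pow_const 2)
    have hFeq : ∀ z : Obs d × Fin m, F z.1 = ∑ s, ∑ t, a s * a t * gramTerm K h x s t z := by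
      intro z
      simp only [hF, polyFun, sq, gramTerm]
      rw [Finset.sum_mul_sum]
      simp only [Finset.mul_sum]
      exact Finset.sum_congr rfl fun s _ => Finset.sum_congr rfl fun t _ => by ring
    have hFi : Integrable (fun z : Obs d × Fin m => F z.1) P := by
      simp only [hFeq]
      exact integrable_finsetSum _ fun s _ => integrable_finsetSum _ fun t _ =>
        (hgrami s t).const_mul _
    have hFQ : Integrable F (P.map Prod.fst) :=
      (integrable_map_measure hFm.aestronglyMeasurable measurable_fst.aemeasurable).2 hFi
    have hfinQ : IsFiniteMeasure (P.map (Prod.fst : Obs d × Fin m → Obs d)) := inferInstance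
    have h2 := hgram K hK0 (fun u hu => hK.le_apply hu) A μ _ hA hreg hμA hQ hfinQ x hx h hh hhc a
      hFQ
    rw [integral_map measurable_fst.aemeasurable hFm.aestronglyMeasurable] at h2
    have h3 : ∫ z : Obs d × Fin m, F z.1 ∂P
        = ∑ s, ∑ t, a s * a t * ∫ z, gramTerm K h x s t z ∂P := by
      simp only [hFeq]
      rw [integral_finsetSum _ fun s _ => integrable_finsetSum _ fun t _ =>
        (hgrami s t).const_mul _]
      refine Finset.sum_congr rfl fun s _ => ?_
      rw [integral_finsetSum _ fun t _ => (hgrami s t).const_mul _]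
      exact Finset.sum_congr rfl fun t _ => integral_const_mul _ _
    have h4 : ∑ s, ∑ t, a s * a t * b s t = (h ^ d)⁻¹ * ∫ z : Obs d × Fin m, F z.1 ∂P := by
      rw [h3, Finset.mul_sum]
      refine Finset.sum_congr rfl fun s _ => ?_
      rw [Finset.mul_sum]
      exact Finset.sum_congr rfl fun t _ => by simp only [hb]; ring
    rw [h4, le_inv_mul_iff₀ hhd]
    refine le_trans (le_of_eq ?_) h2
    ring
  -- the bound for the excess and for its powers
  have hev : Even p := ⟨k, by omega⟩
  set H : Ω → ℝ := fun ω => (2 / κ) ^ p * (4 ^ p * (N₁ ^ p * N₁ ^ p * ∑ s, ∑ t, Γ s t ω ^ p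
    + 2 * (N₁ ^ p * ∑ s, ∑ j, S s j ω ^ p)
    + (2 * N₁ * L * ε) ^ p * (2 ^ p * ((W ω - eW) ^ p + w ^ p)))) with hH
  have hptw : ∀ ω, (η i₀ x - η (j₀ ω) x) ^ p ≤ H ω := by
    intro ω
    have hex := excess_le hL hK0 hh hκ hhd hn (fun i : Fin n => Z i ω) x hbgram hηH h0 h1
      (i₀ := i₀) (j₀ := j₀ ω) (hj₀ ω)
    have hfin : ∀ g : Obs d × Fin m → ℝ,
        ∑ i : Fin n, g (Z i ω) = ∑ i ∈ Finset.range n, g (Z i ω) := fun g =>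
      Fin.sum_univ_eq_sum_range (fun i => g (Z i ω)) n
    simp only [fun s t => hfin (gramTerm K h x s t), fun s j => hfin (noiseTerm K h x η s j),
      hfin (biasTerm ℓ β K h x)] at hex
    have hSpow : ∀ j, (∑ s, |S s j ω|) ^ p ≤ N₁ ^ p * ∑ s, ∑ j, S s j ω ^ p := by
      intro j
      refine (sum_pow_le_card_pow (fun s => abs_nonneg _) hp0).trans
        (mul_le_mul_of_nonneg_left (Finset.sum_le_sum fun s _ => ?_) (by positivity))
      rw [hev.pow_abs]
      exact Finset.single_le_sum (f := fun j => S s j ω ^ p) (fun _ _ => hev.pow_nonneg _)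
        (Finset.mem_univ j)
    have hΓpow : (∑ s, ∑ t, |Γ s t ω|) ^ p ≤ N₁ ^ p * N₁ ^ p * ∑ s, ∑ t, Γ s t ω ^ p := by
      refine (sum_pow_le_card_pow (fun s => Finset.sum_nonneg fun t _ => abs_nonneg _) hp0).trans ?_
      rw [mul_assoc]
      refine mul_le_mul_of_nonneg_left ?_ (by positivity)
      rw [Finset.mul_sum]
      refine Finset.sum_le_sum fun s _ => ?_
      refine (sum_pow_le_card_pow (fun t => abs_nonneg _) hp0).trans (le_of_eq ?_)
      simp only [hev.pow_abs]
      rfl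
    have hWpow : W ω ^ p ≤ 2 ^ p * ((W ω - eW) ^ p + w ^ p) := by
      have h2 : W ω ≤ |W ω - eW| + w := by linarith [le_abs_self (W ω - eW)]
      refine (pow_le_pow_left₀ (hW0 ω) h2 p).trans ?_
      refine (add_pow_le_two_pow (abs_nonneg _) hw0 p).trans (le_of_eq ?_)
      rw [hev.pow_abs]
    have hΓs0 : 0 ≤ ∑ s, ∑ t, |Γ s t ω| :=
      Finset.sum_nonneg fun s _ => Finset.sum_nonneg fun t _ => abs_nonneg _
    have hSs0 : ∀ j, 0 ≤ ∑ s, |S s j ω| := fun j => Finset.sum_nonneg fun s _ => abs_nonneg _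
    have hWs0 : 0 ≤ 2 * N₁ * L * ε * W ω := by
      have := hW0 ω
      positivity
    have hfour : (∑ s, ∑ t, |Γ s t ω| + ∑ s, |S s i₀ ω| + ∑ s, |S s (j₀ ω) ω|
        + 2 * N₁ * L * ε * W ω) ^ p ≤ 4 ^ p * (N₁ ^ p * N₁ ^ p * ∑ s, ∑ t, Γ s t ω ^ p
        + 2 * (N₁ ^ p * ∑ s, ∑ j, S s j ω ^ p)
        + (2 * N₁ * L * ε) ^ p * (2 ^ p * ((W ω - eW) ^ p + w ^ p))) := by
      rw [add_assoc]
      refine (add_pow_le_two_pow (add_nonneg hΓs0 (hSs0 _)) (add_nonneg (hSs0 _) hWs0) p).trans ?_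
      have e1 := add_pow_le_two_pow hΓs0 (hSs0 i₀) p
      have e2 := add_pow_le_two_pow (hSs0 (j₀ ω)) hWs0 p
      have e3 : (2 * N₁ * L * ε * W ω) ^ p
          ≤ (2 * N₁ * L * ε) ^ p * (2 ^ p * ((W ω - eW) ^ p + w ^ p)) := by
        rw [mul_pow]
        exact mul_le_mul_of_nonneg_left hWpow (by positivity)
      have e4 : (4 : ℝ) ^ p = 2 ^ p * 2 ^ p := by rw [← mul_pow]; norm_num
      rw [e4, mul_assoc ((2 : ℝ) ^ p)]
      refine mul_le_mul_of_nonneg_left ?_ (by positivity)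
      refine (add_le_add e1 e2).trans ?_
      rw [← mul_add]
      refine mul_le_mul_of_nonneg_left ?_ (by positivity)
      linarith [hSpow i₀, hSpow (j₀ ω)]
    refine (pow_le_pow_left₀ (sub_nonneg.2 (hi₀ _)) hex p).trans ?_
    rw [mul_pow]
    exact mul_le_mul_of_nonneg_left hfour (by positivity)
  have i1 : Integrable (fun ω => ∑ s, ∑ t, Γ s t ω ^ p) Pr :=
    integrable_finsetSum _ fun s _ => integrable_finsetSum _ fun t _ => (hΓmom s t).1
  have i2 : Integrable (fun ω => ∑ s, ∑ j, S s j ω ^ p) Pr :=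
    integrable_finsetSum _ fun s _ => integrable_finsetSum _ fun j _ => (hSmom s).1 j
  have i3 : Integrable (fun ω => (W ω - eW) ^ p + w ^ p) Pr := hWmom.1.add (integrable_const _)
  have i4 : Integrable (fun ω => N₁ ^ p * N₁ ^ p * ∑ s, ∑ t, Γ s t ω ^ p
      + 2 * (N₁ ^ p * ∑ s, ∑ j, S s j ω ^ p)) Pr :=
    (i1.const_mul _).add ((i2.const_mul _).const_mul _)
  have i5 : Integrable (fun ω =>
      (2 * N₁ * L * ε) ^ p * (2 ^ p * ((W ω - eW) ^ p + w ^ p))) Pr :=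
    (i3.const_mul _).const_mul _
  have iH : Integrable H Pr := ((i4.add i5).const_mul _).const_mul _
  have b1 : ∫ ω, ∑ s, ∑ t, Γ s t ω ^ p ∂Pr ≤ N₁ * (N₁ * (C * ε ^ p)) := by
    rw [integral_finsetSum _ fun s _ => integrable_finsetSum _ fun t _ => (hΓmom s t).1]
    refine (Finset.sum_le_card_nsmul _ _ (N₁ * (C * ε ^ p)) fun s _ => ?_).trans (le_of_eq ?_)
    · rw [integral_finsetSum _ fun t _ => (hΓmom s t).1]
      refine (Finset.sum_le_card_nsmul _ _ _ fun t _ => (hΓmom s t).2).trans (le_of_eq ?_)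
      rw [Finset.card_univ, nsmul_eq_mul]
    · rw [Finset.card_univ, nsmul_eq_mul]
  have b2 : ∫ ω, ∑ s, ∑ j, S s j ω ^ p ∂Pr ≤ N₁ * (C * ε ^ p) := by
    rw [integral_finsetSum _ fun s _ => integrable_finsetSum _ fun j _ => (hSmom s).1 j]
    refine (Finset.sum_le_card_nsmul _ _ (C * ε ^ p) fun s _ => ?_).trans (le_of_eq ?_)
    · rw [integral_finsetSum _ fun j _ => (hSmom s).1 j]
      exact (hSmom s).2
    · rw [Finset.card_univ, nsmul_eq_mul]
  have b3 : ∫ ω, ((W ω - eW) ^ p + w ^ p) ∂Pr ≤ C + w ^ p := by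
    rw [integral_add hWmom.1 (integrable_const _)]
    have : C * ε ^ p ≤ C := mul_le_of_le_one_right hC (pow_le_one₀ hε0.le hε1)
    have := hWmom.2
    simp
    linarith
  have hintH : ∫ ω, H ω ∂Pr ≤ (2 / κ) ^ p * (4 ^ p * (N₁ ^ p * N₁ ^ p * (N₁ * (N₁ * C))
      + 2 * (N₁ ^ p * (N₁ * C)) + (2 * N₁ * L) ^ p * (2 ^ p * (C + w ^ p)))) * ε ^ p := by
    simp only [hH]
    rw [integral_const_mul, integral_const_mul, integral_add i4 i5,
      integral_add (i1.const_mul _) ((i2.const_mul _).const_mul _), integral_const_mul,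
      integral_const_mul, integral_const_mul, integral_const_mul, integral_const_mul]
    calc _ ≤ (2 / κ) ^ p * (4 ^ p * (N₁ ^ p * N₁ ^ p * (N₁ * (N₁ * (C * ε ^ p)))
          + 2 * (N₁ ^ p * (N₁ * (C * ε ^ p)))
          + (2 * N₁ * L * ε) ^ p * (2 ^ p * (C + w ^ p)))) := by gcongr
      _ = _ := by rw [mul_pow _ ε]; ring
  calc ∫⁻ ω, ENNReal.ofReal ((η i₀ x - η (j₀ ω) x) ^ p) ∂Pr
      ≤ ∫⁻ ω, ENNReal.ofReal (H ω) ∂Pr :=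
        lintegral_mono fun ω => ENNReal.ofReal_le_ofReal (hptw ω)
    _ = ENNReal.ofReal (∫ ω, H ω ∂Pr) :=
        (ofReal_integral_eq_lintegral_ofReal iH (ae_of_all _ fun ω =>
          (hev.pow_nonneg _).trans (hptw ω))).symm
    _ ≤ _ := ENNReal.ofReal_le_ofReal hintH

/-! ### The risk bound -/

lemma risk_nonneg {d m : ℕ} (P : Measure (Obs d × Fin m)) (f : Obs d → Fin m) : 0 ≤ risk P f :=
  measureReal_nonneg

lemma risk_le_one {d m : ℕ} (P : Measure (Obs d × Fin m)) [IsProbabilityMeasure P]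
    (f : Obs d → Fin m) : risk P f ≤ 1 := measureReal_le_one

/-- The expected excess risk is the iterated integral of the pointwise excess. -/
lemma integral_risk_sub_le {d m : ℕ} {P : Measure (Obs d × Fin m)} [IsProbabilityMeasure P]
    {η : Fin m → Obs d → ℝ} (hη : ∀ j, IsCondProb P j (η j)) (hηm : ∀ j, Measurable (η j))
    {Ω : Type*} [MeasurableSpace Ω] {Pr : Measure Ω} [IsProbabilityMeasure Pr]
    {F : Ω → Obs d → Fin m} (hF : Measurable (Function.uncurry F)) {fstar : Obs d → Fin m}
    (hfstar : Measurable fstar) (hstar : IsArgmax η fstar) {B : ℝ} (hB : 0 ≤ B)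
    (hle : ∫⁻ x, ∫⁻ ω, ENNReal.ofReal (η (fstar x) x - η (F ω x) x) ∂Pr ∂(P.map Prod.fst)
      ≤ ENNReal.ofReal B) :
    ∫ ω, risk P (F ω) ∂Pr - risk P fstar ≤ B := by
  set Q : Measure (Obs d) := P.map Prod.fst with hQ
  have hQprob : IsProbabilityMeasure Q :=
    Measure.isProbabilityMeasure_map measurable_fst.aemeasurable
  have hG : Measurable fun q : Ω × Obs d => η (fstar q.2) q.2 - η (F q.1 q.2) q.2 :=
    (measurable_apply_class hηm (hfstar.comp measurable_snd) measurable_snd).sub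
      (measurable_apply_class hηm hF measurable_snd)
  set E : Ω → ℝ := fun ω => ∫ x, (η (fstar x) x - η (F ω x) x) ∂Q with hE
  have hEm : StronglyMeasurable E := StronglyMeasurable.integral_prod_right' hG.stronglyMeasurable
  have hrisk : ∀ ω, risk P (F ω) = E ω + risk P fstar := fun ω => by
    have hFω : Measurable (F ω) := hF.comp (measurable_prodMk_left (x := ω))
    have : risk P (F ω) - risk P fstar = E ω := risk_sub_risk_eq hη hηm hFω hfstar
    linarith
  have hEi : Integrable E Pr := by
    refine Integrable.of_bound hEm.aestronglyMeasurable 1 (ae_of_all _ fun ω => ?_)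
    have h1 := hrisk ω
    rw [Real.norm_eq_abs, abs_le]
    constructor <;>
      linarith [risk_nonneg P (F ω), risk_le_one P (F ω), risk_nonneg P fstar, risk_le_one P fstar]
  have hpos : ∀ ω x, 0 ≤ η (fstar x) x - η (F ω x) x := fun ω x => sub_nonneg.2 (hstar x _)
  have hE0 : ∀ ω, 0 ≤ E ω := fun ω => integral_nonneg (hpos ω)
  simp only [hrisk]
  rw [integral_add hEi (integrable_const _)]
  simp only [integral_const, probReal_univ, one_smul, add_sub_cancel_right]
  rw [integral_eq_lintegral_of_nonneg_ae (ae_of_all _ hE0) hEm.aestronglyMeasurable]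
  refine ENNReal.toReal_le_of_le_ofReal hB (le_trans ?_ hle)
  rw [lintegral_lintegral_swap (f := fun x ω => ENNReal.ofReal (η (fstar x) x - η (F ω x) x))
    (ENNReal.measurable_ofReal.comp (hG.comp measurable_swap)).aemeasurable]
  refine lintegral_mono fun ω => ?_
  simp only [hE]
  rw [integral_eq_lintegral_of_nonneg_ae (ae_of_all _ (hpos ω))
    (hG.comp measurable_prodMk_left).aestronglyMeasurable]
  exact ENNReal.ofReal_toReal_le

end OvA

end

theorem theorem1 {d : ℕ} (hd : 0 < d)
    (β L : ℝ) (ℓ : ℕ) (hβ : 0 < β) (hL : 0 < L) (hℓ : (ℓ : ℝ) ≤ β) (hβℓ : β ≤ ℓ + 1)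
    (C₀ α : ℝ) (hC₀ : 0 < C₀) (hα : 0 ≤ α)
    (c₀ r₀ μmin μmax : ℝ) (hc₀ : 0 < c₀) (hr₀ : 0 < r₀) (hμmin : 0 < μmin) (hμ : μmin < μmax)
    (S : Set (Obs d)) (hS : IsCompact S)
    (c : ℝ) (hc : 0 < c) (K : Obs d → ℝ) (hK : IsKernel β ℓ c K)
    (C₁ C₂ C₃ : ℝ) (hC₁ : 0 < C₁) (hC₂ : 0 < C₂) (hC₃ : 0 < C₃) :
    ∃ C₈ : ℝ, 0 < C₈ ∧
      ∀ (m : ℕ) (hm : 2 ≤ m)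
        (P : MeasureTheory.Measure (Obs d × Fin m)) [MeasureTheory.IsProbabilityMeasure P]
        (η : Fin m → Obs d → ℝ),
        (∀ j, IsCondProb P j (η j)) →
        (∀ j, η j ∈ HolderClass β ℓ L) →
        StrongDensity c₀ r₀ μmin μmax S (P.map Prod.fst) →
        MarginAssumption hm C₀ α (P.map Prod.fst) η →
      ∀ (Ω : Type*) [MeasurableSpace Ω] (Pr : MeasureTheory.Measure Ω)
        [MeasureTheory.IsProbabilityMeasure Pr] (Z : ℕ → Ω → Obs d × Fin m),
        (∀ i, Measurable (Z i)) →
        (∀ i, Pr.map (Z i) = P) →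
        ExpStronglyMixing C₁ C₂ C₃ Pr Z →
      ∀ n : ℕ, 0 < bandwidth d β C₂ C₃ n → bandwidth d β C₂ C₃ n ≤ r₀ / c →
      ∀ (f : (Fin n → Obs d × Fin m) → Obs d → Fin m) (fstar : Obs d → Fin m),
        Measurable (Function.uncurry f) → IsPlugIn ℓ K (bandwidth d β C₂ C₃ n) f →
        Measurable fstar → IsArgmax η fstar →
        (∫ ω, risk P (f fun i => Z i ω) ∂Pr) - risk P fstar ≤
          C₈ * (effSize C₂ C₃ n : ℝ) ^ (-(β * (1 + α) / (2 * β + d))) := by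
  -- a moment of even order at least `α + 2`
  set k : ℕ := ⌈α⌉₊ + 1 with hk
  have hk0 : k ≠ 0 := by omega
  have hkα : α + 2 ≤ ((2 * k : ℕ) : ℝ) := by
    have := Nat.le_ceil α
    rw [hk]; push_cast; linarith
  have hμmax : 0 < μmax := hμmin.trans hμ
  obtain ⟨C, hC, hmom⟩ := exists_excess_moment_const (r₀ := r₀) hβ hℓ hL.le hK hc hc₀ hμmin
    hμmax.le hC₁.le hk0
  refine ⟨C₀ * (1 + 2 ^ (2 + α) * C), by positivity, ?_⟩
  intro m hm P _ η hη hηH hdens hmargin Ω _ Pr _ Z hZ hP hmix n hh hhc f fstar hf hplug hfstar hstar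
  obtain ⟨A, μ, -, hA, hreg, hμmeas, hQ, hμA, hμoff⟩ := hdens
  obtain ⟨-, a, hs⟩ := sampleScheme_bandwidth hβ hC₁ hC₂ hC₃ hmix hh
  set h := bandwidth d β C₂ C₃ n with hhdef
  have hηm : ∀ j, Measurable (η j) := fun j => (hηH j).1.continuous.measurable
  have hμb : ∀ x, μ x ≤ μmax := fun x => by
    by_cases hx : x ∈ A
    · exact (hμA x hx).2
    · rw [hμoff x hx]; exact hμmax.le
  have hrate : (effSize C₂ C₃ n : ℝ) ^ (-(β * (1 + α) / (2 * β + d))) = (h ^ β) ^ (1 + α) := by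
    rw [hhdef, bandwidth, ← Real.rpow_mul (by positivity), ← Real.rpow_mul (by positivity)]
    congr 1; ring
  rw [hrate]
  set F : Ω → Obs d → Fin m := fun ω => f fun i => Z i ω with hF
  have hsample : Measurable fun q : Ω × Obs d => ((fun i : Fin n => Z i q.1), q.2) :=
    (measurable_pi_iff.2 fun i : Fin n => (hZ i).comp measurable_fst).prodMk measurable_snd
  have hFm : Measurable (Function.uncurry F) := hf.comp hsample
  refine integral_risk_sub_le hη hηm hFm hfstar hstar (by positivity) ?_
  set Q : MeasureTheory.Measure (Obs d) := P.map Prod.fst with hQdef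
  have hQprob : MeasureTheory.IsProbabilityMeasure Q :=
    MeasureTheory.Measure.isProbabilityMeasure_map measurable_fst.aemeasurable
  set E : ℝ → Set (Obs d) := fun t => {x | ∃ j, j ≠ fstar x ∧ η (fstar x) x - η j x ≤ t} with hE
  have hEm : ∀ t, MeasurableSet (E t) := by
    intro t
    have : E t = ⋃ j, ({x | fstar x = j}ᶜ ∩ {x | η (fstar x) x - η j x ≤ t}) := by
      ext x
      simp [hE, eq_comm]
    rw [this]
    exact MeasurableSet.iUnion fun j => (hfstar (measurableSet_singleton j)).compl.inter
      (measurableSet_le ((measurable_apply_class hηm hfstar measurable_id).sub (hηm j))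
        measurable_const)
  have hG : Measurable (Function.uncurry fun (x : Obs d) (ω : Ω) =>
      η (fstar x) x - η (F ω x) x) :=
    (measurable_apply_class hηm (hfstar.comp measurable_fst) measurable_fst).sub
      (measurable_apply_class hηm (hFm.comp measurable_swap) measurable_fst)
  refine lintegral_le_of_margin hG hEm ?_ hC₀.le ?_ hkα hs.ε_pos hC ?_
  · intro x ω t h0 ht
    refine ⟨F ω x, fun e => ?_, ht⟩
    rw [e, sub_self] at h0
    exact lt_irrefl 0 h0
  · intro t ht
    refine (MeasureTheory.measureReal_mono ?_).trans (hmargin t ht)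
    rintro x ⟨j, hj, hjt⟩
    exact (decreasing_sub_decreasing_le hm (fun j => η j x) (hstar x) hj).trans hjt
  · have hae : ∀ᵐ x ∂Q, x ∈ A := by
      rw [hQ, MeasureTheory.ae_withDensity_iff (by fun_prop)]
      refine MeasureTheory.ae_of_all _ fun x hx => ?_
      by_contra hxA
      rw [hμoff x hxA] at hx
      exact hx ENNReal.ofReal_zero
    have hmeas01 : MeasurableSet {x : Obs d | (∀ j, 0 ≤ η j x) ∧ ∑ j, η j x = 1} := by
      refine MeasurableSet.inter ?_ (measurableSet_eq_fun
        (Finset.measurable_fun_sum _ fun j _ => hηm j) measurable_const)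
      exact measurableSet_setOfPred.2 (Measurable.forall fun j =>
        measurableSet_setOfPred.1 (measurableSet_le measurable_const (hηm j)))
    have h01 : ∀ᵐ x ∂Q, (∀ j, 0 ≤ η j x) ∧ ∑ j, η j x = 1 := by
      rw [hQdef, MeasureTheory.ae_map_iff measurable_fst.aemeasurable hmeas01]
      filter_upwards [ae_condProb_nonneg hη, ae_sum_condProb_eq_one hη] with z h1 h2
      exact ⟨h1, h2⟩
    filter_upwards [hae, h01] with x hxA hx
    have hx1 : ∀ j, η j x ≤ 1 := fun j => by
      rw [← hx.2]
      exact Finset.single_le_sum (f := fun j => η j x) (fun j _ => hx.1 j) (Finset.mem_univ j)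
    exact hmom hη hηH hA hreg hQ (fun x hx => (hμA x hx).1) hμb hZ hP hh
      ((le_div_iff₀ hc).1 hhc) hs x hxA hx.1 hx1 (fstar x) (fun ω => F ω x) (hstar x)
      fun ω j => hplug (fun i => Z i ω) x j
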